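/- Let $\mathcal{F}^\omega[\mathbb{P}]$ be the following classical system over the finite types generated from $0$ (natural numbers), $\Omega$ (sample points) and $S$ (events). It contains weakly extensional Peano arithmetic $\mathsf{WE}\text{-}\mathsf{PA}^\omega$ in these types (combinators, simultaneous recursors, full induction, equality of type $0$ as the only primitive predicate, and the quantifier-free rule of extensionality: from $\varphi_0\to s=_\rho t$ infer $\varphi_0\to r[s/x]=_\tau r[t/x]$ for quantifier-free $\varphi_0$), quantifier-free choice $\mathsf{QF}\text{-}\mathsf{AC}$ and dependent choice $\mathsf{DC}$, and constants with axioms stating that equality on $\Omega$ is an equivalence relation, that $S$ is an algebra of subsets of $\Omega$ under $\cup$, complement and $\emptyset$, and that $\mathbb{P}$ is a (finitely additive) probability content on $S$, with values represented as fast converging Cauchy sequences of rationals. For $V\in\{\Omega,S\}$ let $\mathsf{UB}^V_0$ be the schema $$\forall y^{\alpha(0)}\bigl(\forall k^0,x^\alpha,\underline z^{\underline\beta}\,\exists w^0\,\varphi_\exists(y,k,\min\nolimits_\alpha(x,yk),\underline z,w)\to\exists\chi^{0(0)}\,\forall k^0,x^\alpha,\underline z^{\underline\beta}\,\exists w\le_0\chi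 k\;\varphi_\exists(y,k,\min\nolimits_\alpha(x,yk),\underline z,w)\bigr),$$ where $\alpha$ is a type of the form $0(\sigma_k)\cdots(\sigma_1)$, the types in $\underline\beta$ are of the form $V(\tau_m)\cdots(\tau_1)$, and $\varphi_\exists$ is an existential formula (possibly with parameters) all of whose quantifiers have admissible types, that is, types $\tau_0(\tau_k)\cdots(\tau_1)$ with $\tau_0\in\{0,\Omega,S\}$ and each $\tau_i$ of the form $\rho_0(0)\cdots(0)$ with $\rho_0\in\{0,\Omega,S\}$. For a formula $\varphi(\varpi^\Omega)$ and a real $\lambda$, write $$\mathbb{P}[\varphi]\ge\lambda\;:\equiv\;\forall A^S\bigl(\mathbb{P}(A)<_{\mathbb R}\lambda\to\exists\varpi^\Omega\in A^c\,\varphi(\varpi)\bigr).$$ Let $\mathcal{T}:=\mathcal{F}^\omega[\mathbb{P}]+\mathsf{UB}^\Omega_0+\mathsf{UB}^S_0$. Let $\varphi_0(x^0,n^0,k^0,\varpi^\Omega)$ be a quantifier-free formula, possibly with parameters, and let $P$ be a term of type $S(0)(0)(0)$, possibly with parameters, such that $\mathcal{T}$ proves - (measurability) $\forall x,n,k\,\forall\varpi\,(\varpi\in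 P_{x,n,k}\leftrightarrow\varphi_0(x,n,k,\varpi))$, - (monotonicity in $n$) $\forall x,\varpi,k,n,n'\,(n'\ge n\wedge\varphi_0(x,n,k,\varpi)\to\varphi_0(x,n',k,\varpi))$, - (anti-monotonicity in $k$) $\forall x,\varpi,n,k,k'\,(k'\ge k\wedge\varphi_0(x,n,k',\varpi)\to\varphi_0(x,n,k,\varpi))$. Then $\mathcal{T}$ proves the equivalence of 1. $\forall x^0\,(\mathbb{P}[\exists n^0\forall k^0\varphi_0(x,n,k)]\ge 1)$, 2. $\forall m^0\forall x^0\exists n^0\,(\mathbb{P}[\forall k^0\varphi_0(x,n,k)]\ge 1-2^{-m})$. The same holds relative to any finite list $\Delta$ of additional assumptions, used as ordinary (not rule-admissible) hypotheses: if the three conditions are derivable in $\mathcal{T}$ from $\Delta$, then so is the equivalence of (1) and (2). -/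

import Mathlib

namespace ProbLogic

/-! ## Finite types, terms and formulas -/

/-- The finite types over the base types `0` (`nat`), `Ω` (`omega`) and `S` (`event`);
`ρ ⇾ τ` is the type `τ(ρ)` of functionals from `ρ` to `τ`. -/
inductive Ty : Type
  | nat : Ty
  | omega : Ty
  | event : Ty
  | fn : Ty → Ty → Ty

infixr:60 " ⇾ " => Ty.fn

open Ty

/-- `arrs [σ₁, …, σₖ] τ` is the type `τ(σₖ)…(σ₁)` of functionals of `k` arguments. -/
def arrs : List Ty → Ty → Ty
  | [], τ => τ
  | σ :: l, τ => σ ⇾ arrs l τ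

/-- Contexts: lists of types of the variables in scope, the innermost variable first. -/
abbrev Ctx : Type := List Ty

/-- Variables of type `τ` in a context (de Bruijn indices). The same family is used for the
positions of type `τ` in a list of types. -/
inductive Var : Ctx → Ty → Type
  | z {Γ : Ctx} {σ : Ty} : Var (σ :: Γ) σ
  | s {Γ : Ctx} {σ τ : Ty} : Var Γ τ → Var (σ :: Γ) τ

/-- The type of the step functional for the component of type `σ` in a simultaneous recursion
on the tuple of types `l`: it takes the `l`-tuple of previous values and the index. -/
def stepTy (l : List Ty) (σ : Ty) : Ty := arrs l (nat ⇾ σ)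

/-- The constants of the language. -/
inductive Const : Ty → Type
  | zero : Const nat
  | succ : Const (nat ⇾ nat)
  /-- the projector `Π` -/
  | proj (ρ τ : Ty) : Const (ρ ⇾ τ ⇾ ρ)
  /-- the distributor `Σ` -/
  | dist (δ ρ τ : Ty) : Const ((δ ⇾ ρ ⇾ τ) ⇾ (δ ⇾ ρ) ⇾ δ ⇾ τ)
  /-- the `i`-th component of the simultaneous recursor for the tuple of types `l` -/
  | recur (l : List Ty) {ρ : Ty} (i : Var l ρ) :
      Const (nat ⇾ arrs l (arrs (l.map (stepTy l)) ρ))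
  /-- the characteristic function of equality on `Ω` (value `0` means equal) -/
  | eqOmega : Const (omega ⇾ omega ⇾ nat)
  /-- the characteristic function of membership (value `0` means member) -/
  | mem : Const (omega ⇾ event ⇾ nat)
  | union : Const (event ⇾ event ⇾ event)
  | compl : Const (event ⇾ event)
  | empty : Const event
  /-- the probability content, with values in (representatives of) the reals -/
  | prob : Const (event ⇾ nat ⇾ nat)
  /-- an element of `Ω` -/
  | point : Const omega

inductive Term (Γ : Ctx) : Ty → Type
  | var {τ : Ty} : Var Γ τ → Term Γ τ
  | cst {τ : Ty} : Const τ → Term Γ τ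
  | app {ρ τ : Ty} : Term Γ (ρ ⇾ τ) → Term Γ ρ → Term Γ τ

infixl:100 " ⬝ " => Term.app

/-- Formulas. The only predicate symbol is equality of type `0`. -/
inductive Formula : Ctx → Type
  | eq0 {Γ : Ctx} : Term Γ nat → Term Γ nat → Formula Γ
  | bot {Γ : Ctx} : Formula Γ
  | and {Γ : Ctx} : Formula Γ → Formula Γ → Formula Γ
  | or {Γ : Ctx} : Formula Γ → Formula Γ → Formula Γ
  | imp {Γ : Ctx} : Formula Γ → Formula Γ → Formula Γ
  | all {Γ : Ctx} (σ : Ty) : Formula (σ :: Γ) → Formula Γ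
  | ex {Γ : Ctx} (σ : Ty) : Formula (σ :: Γ) → Formula Γ

open Formula

infixr:35 " ⟹ " => Formula.imp
infixr:45 " ⋏ " => Formula.and
infixr:40 " ⋎ " => Formula.or

def Formula.neg {Γ : Ctx} (φ : Formula Γ) : Formula Γ := φ ⟹ bot
def Formula.iff {Γ : Ctx} (φ ψ : Formula Γ) : Formula Γ := (φ ⟹ ψ) ⋏ (ψ ⟹ φ)

infix:30 " ⟺ " => Formula.iff

/-- Quantifier-free formulas. -/
def Formula.QF : {Γ : Ctx} → Formula Γ → Prop
  | _, eq0 _ _ => True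
  | _, bot => True
  | _, and φ ψ => φ.QF ∧ ψ.QF
  | _, or φ ψ => φ.QF ∧ ψ.QF
  | _, imp φ ψ => φ.QF ∧ ψ.QF
  | _, all _ _ => False
  | _, ex _ _ => False

/-- `∀` over a tuple of variables. -/
def alls {Γ : Ctx} : (l : List Ty) → Formula (l ++ Γ) → Formula Γ
  | [], φ => φ
  | σ :: l, φ => alls l (all σ φ)

/-- `∃` over a tuple of variables. -/
def exs {Γ : Ctx} : (l : List Ty) → Formula (l ++ Γ) → Formula Γ
  | [], φ => φ
  | σ :: l, φ => exs l (ex σ φ)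

/-! ## Renaming and substitution -/

/-- Renamings of variables. -/
abbrev Ren (Γ Δ : Ctx) : Type := ∀ ⦃τ : Ty⦄, Var Γ τ → Var Δ τ

/-- Substitutions of terms for variables; a `Sub l Γ` also serves as an `l`-tuple of terms. -/
abbrev Sub (Γ Δ : Ctx) : Type := ∀ ⦃τ : Ty⦄, Var Γ τ → Term Δ τ

def Ren.lift {Γ Δ : Ctx} (r : Ren Γ Δ) (σ : Ty) : Ren (σ :: Γ) (σ :: Δ)
  | _, .z => .z
  | _, .s v => .s (r v)

def Ren.lifts {Γ Δ : Ctx} (r : Ren Γ Δ) : (l : List Ty) → Ren (l ++ Γ) (l ++ Δ)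
  | [] => r
  | σ :: l => Ren.lift (Ren.lifts r l) σ

/-- The renaming that passes to a context with one more variable. -/
def Ren.wk (Γ : Ctx) (σ : Ty) : Ren Γ (σ :: Γ) := fun _ v => .s v

def Term.rename {Γ Δ : Ctx} (r : Ren Γ Δ) : {τ : Ty} → Term Γ τ → Term Δ τ
  | _, .var v => .var (r v)
  | _, .cst c => .cst c
  | _, .app f a => (f.rename r) ⬝ (a.rename r)

def Term.wk {Γ : Ctx} {σ τ : Ty} (t : Term Γ τ) : Term (σ :: Γ) τ := t.rename (Ren.wk Γ σ)

def Formula.rename : {Γ Δ : Ctx} → Ren Γ Δ → Formula Γ → Formula Δ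
  | _, _, r, eq0 s t => eq0 (s.rename r) (t.rename r)
  | _, _, _, bot => bot
  | _, _, r, and φ ψ => (φ.rename r) ⋏ (ψ.rename r)
  | _, _, r, or φ ψ => (φ.rename r) ⋎ (ψ.rename r)
  | _, _, r, imp φ ψ => (φ.rename r) ⟹ (ψ.rename r)
  | _, _, r, all σ φ => all σ (φ.rename (r.lift σ))
  | _, _, r, ex σ φ => ex σ (φ.rename (r.lift σ))

def Formula.wk {Γ : Ctx} {σ : Ty} (φ : Formula Γ) : Formula (σ :: Γ) := φ.rename (Ren.wk Γ σ)

/-- The identity substitution. -/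
def Sub.id (Γ : Ctx) : Sub Γ Γ := fun _ v => .var v

/-- The substitution with value `t` on the innermost variable and `s` elsewhere. -/
def Sub.cons {Γ Δ : Ctx} {σ : Ty} (t : Term Δ σ) (s : Sub Γ Δ) : Sub (σ :: Γ) Δ
  | _, .z => t
  | _, .s v => s v

/-- The substitution with the tuple `a` on the innermost variables `l` and `s` elsewhere. -/
def Sub.append {Γ Δ : Ctx} : {l : List Ty} → (a : Sub l Δ) → (s : Sub Γ Δ) → Sub (l ++ Γ) Δ
  | [], _, s => s
  | _ :: _, a, s => Sub.cons (a .z) (Sub.append (fun _ v => a (.s v)) s)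

def Sub.lift {Γ Δ : Ctx} (s : Sub Γ Δ) (σ : Ty) : Sub (σ :: Γ) (σ :: Δ) :=
  Sub.cons (.var .z) (fun _ v => (s v).wk)

def Sub.lifts {Γ Δ : Ctx} (s : Sub Γ Δ) : (l : List Ty) → Sub (l ++ Γ) (l ++ Δ)
  | [] => s
  | σ :: l => Sub.lift (Sub.lifts s l) σ

def Term.subst {Γ Δ : Ctx} (s : Sub Γ Δ) : {τ : Ty} → Term Γ τ → Term Δ τ
  | _, .var v => s v
  | _, .cst c => .cst c
  | _, .app f a => (f.subst s) ⬝ (a.subst s)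

def Formula.subst : {Γ Δ : Ctx} → Sub Γ Δ → Formula Γ → Formula Δ
  | _, _, r, eq0 s t => eq0 (s.subst r) (t.subst r)
  | _, _, _, bot => bot
  | _, _, r, and φ ψ => (φ.subst r) ⋏ (ψ.subst r)
  | _, _, r, or φ ψ => (φ.subst r) ⋎ (ψ.subst r)
  | _, _, r, imp φ ψ => (φ.subst r) ⟹ (ψ.subst r)
  | _, _, r, all σ φ => all σ (φ.subst (r.lift σ))
  | _, _, r, ex σ φ => ex σ (φ.subst (r.lift σ))

/-- `r[t/x]` for the innermost variable `x`. -/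
def Term.inst {Γ : Ctx} {σ τ : Ty} (r : Term (σ :: Γ) τ) (t : Term Γ σ) : Term Γ τ :=
  r.subst (Sub.cons t (Sub.id Γ))

/-- `φ[t/x]` for the innermost variable `x`. -/
def Formula.inst {Γ : Ctx} {σ : Ty} (φ : Formula (σ :: Γ)) (t : Term Γ σ) : Formula Γ :=
  φ.subst (Sub.cons t (Sub.id Γ))

/-- The variables of an initial block `l` of a context. -/
def Var.inl {Γ : Ctx} {τ : Ty} : {l : List Ty} → Var l τ → Var (l ++ Γ) τ
  | _ :: _, .z => .z
  | _ :: _, .s v => .s (Var.inl v)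

/-- The variables behind an initial block `l` of a context. -/
def Var.inr {Γ : Ctx} {τ : Ty} : (l : List Ty) → Var Γ τ → Var (l ++ Γ) τ
  | [], v => v
  | _ :: l, v => .s (Var.inr l v)

/-- The position in `l.map f` that corresponds to a position in `l`. -/
def Var.map (f : Ty → Ty) {τ : Ty} : {l : List Ty} → Var l τ → Var (l.map f) (f τ)
  | _ :: _, .z => .z
  | _ :: _, .s v => .s (Var.map f v)

/-- Application of a functional to a tuple of arguments. -/
def Term.apps {Γ : Ctx} {τ : Ty} : {l : List Ty} → Term Γ (arrs l τ) → Sub l Γ → Term Γ τ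
  | [], t, _ => t
  | _ :: l, t, a => Term.apps (l := l) (t ⬝ a .z) (fun _ v => a (.s v))

/-- Lambda abstraction of the innermost variable, defined through the combinators. -/
def Term.lam {Γ : Ctx} {σ : Ty} : {τ : Ty} → Term (σ :: Γ) τ → Term Γ (σ ⇾ τ)
  | _, .var .z => .cst (.dist σ (σ ⇾ σ) σ) ⬝ .cst (.proj σ (σ ⇾ σ)) ⬝ .cst (.proj σ σ)
  | _, .var (.s v) => .cst (.proj _ σ) ⬝ .var v
  | _, .cst c => .cst (.proj _ σ) ⬝ .cst c
  | _, .app f a => .cst (.dist σ _ _) ⬝ f.lam ⬝ a.lam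

abbrev v0 {Γ : Ctx} {a : Ty} : Term (a :: Γ) a := .var .z
abbrev v1 {Γ : Ctx} {a b : Ty} : Term (a :: b :: Γ) b := .var (.s .z)
abbrev v2 {Γ : Ctx} {a b c : Ty} : Term (a :: b :: c :: Γ) c := .var (.s (.s .z))
abbrev v3 {Γ : Ctx} {a b c d : Ty} : Term (a :: b :: c :: d :: Γ) d := .var (.s (.s (.s .z)))
abbrev v4 {Γ : Ctx} {a b c d e : Ty} : Term (a :: b :: c :: d :: e :: Γ) e :=
  .var (.s (.s (.s (.s .z))))

/-! ## Arithmetic of type `0`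

Truth values of characteristic terms are `0` for true and `1` for false. -/

section Arithmetic

variable {Γ : Ctx}

def zeroT : Term Γ nat := .cst .zero
def succT (t : Term Γ nat) : Term Γ nat := .cst .succ ⬝ t
def oneT : Term Γ nat := succT zeroT

/-- The `i`-th component of the simultaneous recursion with start values `y` and step
functionals `f`, at the argument `n`. -/
def recT {l : List Ty} {ρ : Ty} (i : Var l ρ) (n : Term Γ nat) (y : Sub l Γ)
    (f : Sub (l.map (stepTy l)) Γ) : Term Γ ρ :=
  Term.apps (Term.apps (.cst (.recur l i) ⬝ n) y) f

/-- Recursion of type `0`: value `a` at `0`, and value `step` at `x + 1`, where in `step` the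
innermost variable is `x` and the next one is the value at `x`. -/
def natRec (n a : Term Γ nat) (step : Term (nat :: nat :: Γ) nat) : Term Γ nat :=
  .cst (.recur [nat] .z) ⬝ n ⬝ a ⬝ step.lam.lam

def predT (t : Term Γ nat) : Term Γ nat := natRec t zeroT v0
def addT (s t : Term Γ nat) : Term Γ nat := natRec t s (succT v1)
def mulT (s t : Term Γ nat) : Term Γ nat := natRec t zeroT (addT v1 s.wk.wk)
/-- Cut-off subtraction. -/
def monusT (s t : Term Γ nat) : Term Γ nat := natRec t s (predT v1)
def pow2T (t : Term Γ nat) : Term Γ nat := natRec t oneT (addT v1 v1)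
/-- `a` if `c = 0`, and `b` otherwise. -/
def condT (c a b : Term Γ nat) : Term Γ nat := natRec c a b.wk.wk
def minT (s t : Term Γ nat) : Term Γ nat := monusT s (monusT s t)
/-- The characteristic term of `s < t`. -/
def ltT (s t : Term Γ nat) : Term Γ nat := monusT oneT (monusT t s)

/-- `s ≤₀ t`. -/
def le0 (s t : Term Γ nat) : Formula Γ := eq0 (monusT s t) zeroT

/-- The Cantor pairing `(a + b)(a + b + 1)/2 + a`. -/
def pairT (a b : Term Γ nat) : Term Γ nat :=
  addT (natRec (addT a b) zeroT (addT v1 (succT v0))) a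

/-- The step functionals of the recursion that enumerates all pairs along the Cantor pairing:
`(a, 0)` is followed by `(0, a + 1)`, and `(a, b + 1)` by `(a + 1, b)`. -/
def unpairSteps : Sub ([nat, nat].map (stepTy [nat, nat])) Γ
  | _, .z => Term.lam (Term.lam (Term.lam (condT v1 zeroT (succT v2))))
  | _, .s .z => Term.lam (Term.lam (Term.lam (condT v1 (succT v2) (predT v1))))

def unpairStart : Sub [nat, nat] Γ
  | _, .z => zeroT
  | _, .s .z => zeroT

def fstT (t : Term Γ nat) : Term Γ nat :=
  recT (l := [nat, nat]) .z t unpairStart unpairSteps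
def sndT (t : Term Γ nat) : Term Γ nat :=
  recT (l := [nat, nat]) (.s .z) t unpairStart unpairSteps

/-! ## Rational numbers and real numbers

A natural number `q` codes the rational `(a - b) / (d + 1)`, where `q` is the pair of the pair of
`a` and `b`, and `d`. -/

def qCode (a b d : Term Γ nat) : Term Γ nat := pairT (pairT a b) d
def qPos (q : Term Γ nat) : Term Γ nat := fstT (fstT q)
def qNegPart (q : Term Γ nat) : Term Γ nat := sndT (fstT q)
def qDen (q : Term Γ nat) : Term Γ nat := succT (sndT q)

def qOne : Term Γ nat := qCode oneT zeroT zeroT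
def qZero : Term Γ nat := qCode zeroT zeroT zeroT
def qAdd (p q : Term Γ nat) : Term Γ nat :=
  qCode (addT (mulT (qPos p) (qDen q)) (mulT (qPos q) (qDen p)))
    (addT (mulT (qNegPart p) (qDen q)) (mulT (qNegPart q) (qDen p)))
    (predT (mulT (qDen p) (qDen q)))
def qNeg (q : Term Γ nat) : Term Γ nat := qCode (qNegPart q) (qPos q) (sndT q)
def qSub (p q : Term Γ nat) : Term Γ nat := qAdd p (qNeg q)
def qAbs (q : Term Γ nat) : Term Γ nat :=
  qCode (addT (monusT (qPos q) (qNegPart q)) (monusT (qNegPart q) (qPos q))) zeroT (sndT q)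
/-- The rational `2⁻ⁿ`. -/
def qPow (n : Term Γ nat) : Term Γ nat := qCode oneT zeroT (predT (pow2T n))

/-- The characteristic term of `p < q` for rationals. -/
def qLtT (p q : Term Γ nat) : Term Γ nat :=
  ltT (addT (mulT (qPos p) (qDen q)) (mulT (qNegPart q) (qDen p)))
    (addT (mulT (qPos q) (qDen p)) (mulT (qNegPart p) (qDen q)))
def qLt (p q : Term Γ nat) : Formula Γ := eq0 (qLtT p q) zeroT
def qLe (p q : Term Γ nat) : Formula Γ := (qLt q p).neg

/-- Nonzero if and only if `|f k - f (k + 1)| ≥ 2⁻ᵏ⁻¹` for some `k < n`. -/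
def badT (f : Term Γ (nat ⇾ nat)) (n : Term Γ nat) : Term Γ nat :=
  natRec n zeroT (addT v1
    (qLtT (qAbs (qSub (f.wk.wk ⬝ v0) (f.wk.wk ⬝ succT v0))) (qPow (succT v0))))

/-- The `n`-th member of the fast Cauchy sequence attached to `f`: it agrees with `f` as long as
`|f k - f (k + 1)| < 2⁻ᵏ⁻¹`, and is constant from the first violation on. In this way every object
of type `1` represents a real number. -/
def hat (f : Term Γ (nat ⇾ nat)) (n : Term Γ nat) : Term Γ nat :=
  natRec n (f ⬝ zeroT) (condT (badT f.wk.wk (succT v0)) (f.wk.wk ⬝ succT v0) v1)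

/-- The real number given by a rational. -/
def ratR (q : Term Γ nat) : Term Γ (nat ⇾ nat) := Term.lam q.wk

def addR (x y : Term Γ (nat ⇾ nat)) : Term Γ (nat ⇾ nat) :=
  Term.lam (qAdd (hat x.wk (succT v0)) (hat y.wk (succT v0)))

def eqR (x y : Term Γ (nat ⇾ nat)) : Formula Γ :=
  all nat (qLt (qAbs (qSub (hat x.wk (succT v0)) (hat y.wk (succT v0)))) (qPow v0))
def ltR (x y : Term Γ (nat ⇾ nat)) : Formula Γ :=
  ex nat (qLe (qPow v0) (qSub (hat y.wk (succT v0)) (hat x.wk (succT v0))))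
def leR (x y : Term Γ (nat ⇾ nat)) : Formula Γ := (ltR y x).neg

end Arithmetic

/-! ## Events and higher-type equality -/

section Events

variable {Γ : Ctx}

def memF (w : Term Γ omega) (A : Term Γ event) : Formula Γ := eq0 (.cst .mem ⬝ w ⬝ A) zeroT
def unionT (A B : Term Γ event) : Term Γ event := .cst .union ⬝ A ⬝ B
def complT (A : Term Γ event) : Term Γ event := .cst .compl ⬝ A
def emptyT : Term Γ event := .cst .empty
def fullT : Term Γ event := complT emptyT
def interT (A B : Term Γ event) : Term Γ event := complT (unionT (complT A) (complT B))
def probT (A : Term Γ event) : Term Γ (nat ⇾ nat) := .cst .prob ⬝ A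

def eqOmegaF (x y : Term Γ omega) : Formula Γ := eq0 (.cst .eqOmega ⬝ x ⬝ y) zeroT
def subsetF (A B : Term Γ event) : Formula Γ :=
  all omega (memF v0 A.wk ⟹ memF v0 B.wk)

/-- Equality of arbitrary type. -/
def eqTy : (τ : Ty) → {Γ : Ctx} → Term Γ τ → Term Γ τ → Formula Γ
  | nat, _, s, t => eq0 s t
  | omega, _, s, t => eqOmegaF s t
  | event, _, s, t => all omega (memF v0 s.wk ⟺ memF v0 t.wk)
  | fn ρ τ, _, s, t => all ρ (eqTy τ (s.wk ⬝ v0) (t.wk ⬝ v0))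

/-- The pointwise minimum of two functionals of type `0(σₖ)…(σ₁)`. -/
def minTy : (l : List Ty) → {Γ : Ctx} → Term Γ (arrs l nat) → Term Γ (arrs l nat) →
    Term Γ (arrs l nat)
  | [], _, s, t => minT s t
  | _ :: l, _, s, t => Term.lam (minTy l (s.wk ⬝ v0) (t.wk ⬝ v0))

end Events

/-! ## The axioms -/

/-- A theory: a set of formulas in each context (open formulas are read universally). -/
abbrev Theory : Type := ∀ ⦃Γ : Ctx⦄, Formula Γ → Prop

/-- The matrix `A₀(x, Y x)` of the conclusion of the axiom of choice: `A₀(x, y)` with a tuple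
`y` of types `ts` and a tuple `x` of types `ss`. -/
def choiceMatrix {Γ : Ctx} (ss ts : List Ty) (A : Formula (ts ++ (ss ++ Γ))) :
    Formula (ss ++ (ts.map (arrs ss) ++ Γ)) :=
  A.subst (Sub.append
    (fun _ i => Term.apps (.var (Var.inr ss (Var.inl (Var.map (arrs ss) i))))
      (fun _ j => .var (Var.inl j)))
    (Sub.append (fun _ j => .var (Var.inl j))
      (fun _ v => .var (Var.inr ss (Var.inr (ts.map (arrs ss)) v)))))

/-- The matrix `A(n, f n, f (n + 1))` of the conclusion of dependent choice, from `A(n, y, z)`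
with tuples `y` and `z` of types `l`. -/
def dcMatrix {Γ : Ctx} (l : List Ty) (A : Formula (l ++ (l ++ (nat :: Γ)))) :
    Formula (nat :: (l.map (fun ρ => nat ⇾ ρ) ++ Γ)) :=
  A.subst (Sub.append
    (fun _ i => .var (.s (Var.inl (Var.map (fun ρ => nat ⇾ ρ) i))) ⬝ succT v0)
    (Sub.append (fun _ i => .var (.s (Var.inl (Var.map (fun ρ => nat ⇾ ρ) i))) ⬝ v0)
      (Sub.cons v0 (fun _ v => .var (.s (Var.inr (l.map (fun ρ => nat ⇾ ρ)) v))))))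

/-- The axioms of the system `𝓕^ω[ℙ]` (besides classical logic and the quantifier-free rule of
extensionality, which are part of the notion of derivation): arithmetic in all finite types,
quantifier-free choice, dependent choice, the algebra of events, and the probability content.
That membership respects equality on `Ω` follows by the rule of extensionality. -/
inductive FAxioms : Theory
  -- equality of type 0 and arithmetic
  | eq_refl {Γ : Ctx} (t : Term Γ nat) : FAxioms (eq0 t t)
  | eq_symm {Γ : Ctx} (s t : Term Γ nat) : FAxioms (eq0 s t ⟹ eq0 t s)
  | eq_trans {Γ : Ctx} (r s t : Term Γ nat) : FAxioms (eq0 r s ⟹ eq0 s t ⟹ eq0 r t)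
  | succ_ne_zero {Γ : Ctx} (t : Term Γ nat) : FAxioms (eq0 (succT t) zeroT).neg
  | succ_inj {Γ : Ctx} (s t : Term Γ nat) : FAxioms (eq0 (succT s) (succT t) ⟹ eq0 s t)
  | induction {Γ : Ctx} (φ : Formula (nat :: Γ)) :
      FAxioms (φ.inst zeroT ⟹
        all nat (φ ⟹ φ.subst (Sub.cons (succT v0) (fun _ v => .var (.s v)))) ⟹ all nat φ)
  -- combinators and recursors
  | proj {Γ : Ctx} {ρ τ : Ty} (x : Term Γ ρ) (y : Term Γ τ) :
      FAxioms (eqTy ρ (.cst (.proj ρ τ) ⬝ x ⬝ y) x)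
  | dist {Γ : Ctx} {δ ρ τ : Ty} (x : Term Γ (δ ⇾ ρ ⇾ τ)) (y : Term Γ (δ ⇾ ρ)) (u : Term Γ δ) :
      FAxioms (eqTy τ (.cst (.dist δ ρ τ) ⬝ x ⬝ y ⬝ u) (x ⬝ u ⬝ (y ⬝ u)))
  | recur_zero {Γ : Ctx} {l : List Ty} {ρ : Ty} (i : Var l ρ) (y : Sub l Γ)
      (f : Sub (l.map (stepTy l)) Γ) : FAxioms (eqTy ρ (recT i zeroT y f) (y i))
  | recur_succ {Γ : Ctx} {l : List Ty} {ρ : Ty} (i : Var l ρ) (n : Term Γ nat) (y : Sub l Γ)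
      (f : Sub (l.map (stepTy l)) Γ) :
      FAxioms (eqTy ρ (recT i (succT n) y f)
        (Term.apps (l := l) (f (Var.map (stepTy l) i)) (fun _ j => recT j n y f) ⬝ n))
  -- choice
  | qf_ac {Γ : Ctx} (ss ts : List Ty) (A : Formula (ts ++ (ss ++ Γ))) (hA : A.QF) :
      FAxioms (alls ss (exs ts A) ⟹
        exs (ts.map (arrs ss)) (alls ss (choiceMatrix ss ts A)))
  | dc {Γ : Ctx} (l : List Ty) (A : Formula (l ++ (l ++ (nat :: Γ)))) :
      FAxioms (all nat (alls l (exs l A)) ⟹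
        exs (l.map (fun ρ => nat ⇾ ρ)) (all nat (dcMatrix l A)))
  -- equality on the sample space and the algebra of events
  | omega_refl {Γ : Ctx} (x : Term Γ omega) : FAxioms (eqOmegaF x x)
  | omega_symm {Γ : Ctx} (x y : Term Γ omega) : FAxioms (eqOmegaF x y ⟹ eqOmegaF y x)
  | omega_trans {Γ : Ctx} (x y u : Term Γ omega) :
      FAxioms (eqOmegaF x y ⟹ eqOmegaF y u ⟹ eqOmegaF x u)
  | mem_union {Γ : Ctx} (w : Term Γ omega) (A B : Term Γ event) :
      FAxioms (memF w (unionT A B) ⟺ (memF w A ⋎ memF w B))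
  | mem_compl {Γ : Ctx} (w : Term Γ omega) (A : Term Γ event) :
      FAxioms (memF w (complT A) ⟺ (memF w A).neg)
  | mem_empty {Γ : Ctx} (w : Term Γ omega) : FAxioms (memF w emptyT).neg
  -- the probability content
  | prob_nonneg {Γ : Ctx} (A : Term Γ event) : FAxioms (leR (ratR qZero) (probT A))
  | prob_empty {Γ : Ctx} : FAxioms (Γ := Γ) (eqR (probT emptyT) (ratR qZero))
  | prob_full {Γ : Ctx} : FAxioms (Γ := Γ) (eqR (probT fullT) (ratR qOne))
  | prob_union_inter {Γ : Ctx} (A B : Term Γ event) :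
      FAxioms (eqR (addR (probT (unionT A B)) (probT (interT A B)))
        (addR (probT A) (probT B)))
  | prob_mono {Γ : Ctx} (A B : Term Γ event) :
      FAxioms (subsetF A B ⟹ leR (probT A) (probT B))

/-- Base types. -/
def IsBase (τ : Ty) : Prop := τ = nat ∨ τ = omega ∨ τ = event

/-- Small types: `τ₀(0)…(0)` with `τ₀` a base type. -/
def IsSmall (τ : Ty) : Prop := ∃ (n : ℕ) (τ₀ : Ty), IsBase τ₀ ∧ τ = arrs (List.replicate n nat) τ₀

/-- Admissible types: `τ₀(τₖ)…(τ₁)` with `τ₀` a base type and `τ₁, …, τₖ` small. -/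
def IsAdmissible (τ : Ty) : Prop :=
  ∃ (l : List Ty) (τ₀ : Ty), IsBase τ₀ ∧ (∀ σ ∈ l, IsSmall σ) ∧ τ = arrs l τ₀

/-- Existential formulas, with all quantifiers of admissible type. -/
inductive IsExistential : {Γ : Ctx} → Formula Γ → Prop
  | qf {Γ : Ctx} {φ : Formula Γ} : φ.QF → IsExistential φ
  | ex {Γ : Ctx} {σ : Ty} {φ : Formula (σ :: Γ)} :
      IsAdmissible σ → IsExistential φ → IsExistential (Formula.ex σ φ)

/-- The types `V(τₘ)…(τ₁)` of the tuple `z` in the uniform boundedness principle. -/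
abbrev ubTypes (V : Ty) (b : List (List Ty)) : List Ty := b.map (fun l => arrs l V)

/-- The formula `φ(y, k, min(x, y k), z, w)`. In `φ` the variables are, from the outside,
`y` of type `α(0)` with `α = 0(σₖ)…(σ₁)`, `k` of type `0`, `x` of type `α`, the tuple `z`, and
`w` of type `0`. -/
def ubMatrix {Γ : Ctx} (V : Ty) (a : List Ty) (b : List (List Ty))
    (φ : Formula (nat :: (ubTypes V b ++ (arrs a nat :: nat :: (nat ⇾ arrs a nat) :: Γ)))) :
    Formula (nat :: (ubTypes V b ++ (arrs a nat :: nat :: (nat ⇾ arrs a nat) :: Γ))) :=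
  φ.subst (((Sub.cons (minTy a v0 (v2 ⬝ v1)) (fun _ v => .var (.s v))).lifts (ubTypes V b)).lift
    nat)

/-- The principle of uniform boundedness (with bounded variable of type `0`) for the abstract
type `V`:
`∀ y (∀ k, x, z ∃ w φ(y, k, min(x, y k), z, w) →
      ∃ χ ∀ k, x, z ∃ w ≤ χ k φ(y, k, min(x, y k), z, w))`
for existential `φ`, possibly with further parameters. -/
inductive UBAxioms (V : Ty) : Theory
  | ub {Γ : Ctx} (a : List Ty) (b : List (List Ty))
      (φ : Formula (nat :: (ubTypes V b ++ (arrs a nat :: nat :: (nat ⇾ arrs a nat) :: Γ))))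
      (hφ : IsExistential φ) :
      UBAxioms V (all (nat ⇾ arrs a nat)
        (all nat (all (arrs a nat) (alls (ubTypes V b) (ex nat (ubMatrix V a b φ)))) ⟹
          ex (nat ⇾ nat) (all nat (all (arrs a nat) (alls (ubTypes V b) (ex nat
            (le0 v0 (.var (.s (Var.inr (ubTypes V b) (.s (.s .z)))) ⬝
                .var (.s (Var.inr (ubTypes V b) (.s .z)))) ⋏
              (ubMatrix V a b φ).rename
                (((((Ren.wk _ (nat ⇾ nat)).lift nat).lift (arrs a nat)).lifts
                  (ubTypes V b)).lift nat))))))))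

/-- The system `𝓕^ω[ℙ] + UB^Ω_0 + UB^S_0`. -/
def FPUB : Theory := fun _ φ => FAxioms φ ∨ UBAxioms omega φ ∨ UBAxioms event φ

/-! ## Derivations -/

/-- `Deriv T Δ φ`: the formula `φ` is derivable from the axioms `T` and the assumptions `Δ` in
classical many-sorted predicate logic (natural deduction) with the quantifier-free rule of
extensionality; the premise of the latter has to be derived without assumptions. -/
inductive Deriv (T : Theory) : {Γ : Ctx} → List (Formula Γ) → Formula Γ → Prop
  | ax {Γ : Ctx} {Δ : List (Formula Γ)} {φ : Formula Γ} : T φ → Deriv T Δ φ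
  | hyp {Γ : Ctx} {Δ : List (Formula Γ)} {φ : Formula Γ} : φ ∈ Δ → Deriv T Δ φ
  | and_intro {Γ : Ctx} {Δ : List (Formula Γ)} {φ ψ : Formula Γ} :
      Deriv T Δ φ → Deriv T Δ ψ → Deriv T Δ (φ ⋏ ψ)
  | and_left {Γ : Ctx} {Δ : List (Formula Γ)} {φ ψ : Formula Γ} :
      Deriv T Δ (φ ⋏ ψ) → Deriv T Δ φ
  | and_right {Γ : Ctx} {Δ : List (Formula Γ)} {φ ψ : Formula Γ} :
      Deriv T Δ (φ ⋏ ψ) → Deriv T Δ ψ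
  | or_left {Γ : Ctx} {Δ : List (Formula Γ)} {φ ψ : Formula Γ} :
      Deriv T Δ φ → Deriv T Δ (φ ⋎ ψ)
  | or_right {Γ : Ctx} {Δ : List (Formula Γ)} {φ ψ : Formula Γ} :
      Deriv T Δ ψ → Deriv T Δ (φ ⋎ ψ)
  | or_elim {Γ : Ctx} {Δ : List (Formula Γ)} {φ ψ χ : Formula Γ} :
      Deriv T Δ (φ ⋎ ψ) → Deriv T (φ :: Δ) χ → Deriv T (ψ :: Δ) χ → Deriv T Δ χ
  | imp_intro {Γ : Ctx} {Δ : List (Formula Γ)} {φ ψ : Formula Γ} :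
      Deriv T (φ :: Δ) ψ → Deriv T Δ (φ ⟹ ψ)
  | imp_elim {Γ : Ctx} {Δ : List (Formula Γ)} {φ ψ : Formula Γ} :
      Deriv T Δ (φ ⟹ ψ) → Deriv T Δ φ → Deriv T Δ ψ
  | by_contra {Γ : Ctx} {Δ : List (Formula Γ)} {φ : Formula Γ} :
      Deriv T (φ.neg :: Δ) bot → Deriv T Δ φ
  | all_intro {Γ : Ctx} {Δ : List (Formula Γ)} {σ : Ty} {φ : Formula (σ :: Γ)} :
      Deriv T (Δ.map Formula.wk) φ → Deriv T Δ (all σ φ)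
  | all_elim {Γ : Ctx} {Δ : List (Formula Γ)} {σ : Ty} {φ : Formula (σ :: Γ)} (t : Term Γ σ) :
      Deriv T Δ (all σ φ) → Deriv T Δ (φ.inst t)
  | ex_intro {Γ : Ctx} {Δ : List (Formula Γ)} {σ : Ty} {φ : Formula (σ :: Γ)} (t : Term Γ σ) :
      Deriv T Δ (φ.inst t) → Deriv T Δ (ex σ φ)
  | ex_elim {Γ : Ctx} {Δ : List (Formula Γ)} {σ : Ty} {φ : Formula (σ :: Γ)} {χ : Formula Γ} :
      Deriv T Δ (ex σ φ) → Deriv T (φ :: Δ.map Formula.wk) χ.wk → Deriv T Δ χ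
  | qf_er {Γ : Ctx} {Δ : List (Formula Γ)} {ρ τ : Ty} {φ : Formula Γ} {s t : Term Γ ρ}
      (r : Term (ρ :: Γ) τ) : φ.QF →
      Deriv T [] (φ ⟹ eqTy ρ s t) → Deriv T Δ (φ ⟹ eqTy τ (r.inst s) (r.inst t))

/-! ## Probabilistic statements -/

section Statements

variable {Γ : Ctx}

/-- `ℙ[φ] ≥ x`, that is, `∀ A (ℙ(A) < x → ∃ ω ∈ Aᶜ φ(ω))`; the sample point `ω` is the innermost
variable of `φ`. -/
def probGe (φ : Formula (omega :: Γ)) (x : Term Γ (nat ⇾ nat)) : Formula Γ :=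
  all event (ltR (probT v0) x.wk ⟹
    ex omega (memF v0 (complT v1) ⋏ φ.rename ((Ren.wk Γ event).lift omega)))

/-- The context of a formula `φ(x, n, k, ω)` with parameters from `Γ`. -/
abbrev MatrixCtx (Γ : Ctx) : Ctx := omega :: nat :: nat :: nat :: Γ

/-- The instance `φ(x, n, k, w)`, in a context `Δ` into which the parameters are embedded by
`e`. -/
def matrixAt {Δ : Ctx} (φ : Formula (MatrixCtx Γ)) (e : Ren Γ Δ) (x n k : Term Δ nat)
    (w : Term Δ omega) : Formula Δ :=
  φ.subst (Sub.cons w (Sub.cons k (Sub.cons n (Sub.cons x (fun _ v => .var (e v))))))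

/-- `∀ x, n, k, ω (ω ∈ P x n k ↔ φ(x, n, k, ω))`. -/
def measurableF (φ : Formula (MatrixCtx Γ)) (P : Term Γ (nat ⇾ nat ⇾ nat ⇾ event)) : Formula Γ :=
  all nat (all nat (all nat (all omega
    (memF v0 (P.wk.wk.wk.wk ⬝ v3 ⬝ v2 ⬝ v1) ⟺
      matrixAt φ (fun _ v => .s (.s (.s (.s v)))) v3 v2 v1 v0))))

/-- `∀ x, ω, k, n, n' (n' ≥ n ∧ φ(x, n, k, ω) → φ(x, n', k, ω))`. -/
def monotoneF (φ : Formula (MatrixCtx Γ)) : Formula Γ :=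
  all nat (all omega (all nat (all nat (all nat
    (le0 v1 v0 ⋏ matrixAt φ (fun _ v => .s (.s (.s (.s (.s v))))) v4 v1 v2 v3 ⟹
      matrixAt φ (fun _ v => .s (.s (.s (.s (.s v))))) v4 v0 v2 v3)))))

/-- `∀ x, ω, n, k, k' (k' ≥ k ∧ φ(x, n, k', ω) → φ(x, n, k, ω))`. -/
def antitoneF (φ : Formula (MatrixCtx Γ)) : Formula Γ :=
  all nat (all omega (all nat (all nat (all nat
    (le0 v1 v0 ⋏ matrixAt φ (fun _ v => .s (.s (.s (.s (.s v))))) v4 v2 v0 v3 ⟹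
      matrixAt φ (fun _ v => .s (.s (.s (.s (.s v))))) v4 v2 v1 v3)))))

/-- `∀ x (ℙ[∃ n ∀ k φ(x, n, k)] ≥ 1)`. -/
def pointwiseF (φ : Formula (MatrixCtx Γ)) : Formula Γ :=
  all nat (probGe
    (ex nat (all nat (matrixAt φ (fun _ v => .s (.s (.s (.s v)))) v3 v1 v0 v2)))
    (ratR qOne))

/-- `∀ m ∀ x ∃ n (ℙ[∀ k φ(x, n, k)] ≥ 1 - 2⁻ᵐ)`. -/
def uniformF (φ : Formula (MatrixCtx Γ)) : Formula Γ :=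
  all nat (all nat (ex nat (probGe
    (all nat (matrixAt φ (fun _ v => .s (.s (.s (.s (.s v))))) v3 v2 v0 v1))
    (ratR (qSub qOne (qPow v2))))))

end Statements

end ProbLogic

/-!
Derivability is reduced to truth in models by a completeness theorem for the weakly extensional
system. A generic ideal of finite consistent sets of formulas, over contexts that grow by Henkin
variables, determines a term model; terms are identified when they agree in all contexts of type
`0`, and the quantifier-free rule of extensionality makes this identify provably equal terms.

In a model, the objects of type `0` form an ordered semiring, and the rational approximations to
probabilities live in its ordered field of fractions. For fixed `x`, let `E n k` be the events
`P x n k`, increasing in `n` and decreasing in `k`. Suppose that (2) fails for `m`, so that each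
`⋂ₖ E n k` lies in an event of probability less than `1 - 2⁻ᵐ`. By `UB^Ω`, a form of compactness of
`Ω`, for each `n` some `E n k` then has probability at most `1 - 2⁻ᵐ`. Dependent choice yields
indices `jₙ` for which `E n jₙ` has the least probability among the `E n k` up to an error that
decreases exponentially in `n`. The union `C n` of `E 0 j₀, …, E n jₙ` satisfies
`ℙ (C (n + 1)) + ℙ (E n k) ≤ ℙ (C n) + ℙ (E (n + 1) jₙ₊₁)` for large `k`, by modularity and because
`C n` and `E (n + 1) jₙ₊₁` both contain `E n k`. By induction, `ℙ (C n)` exceeds no `ℙ (E n k)` by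
more than the accumulated errors, so these probabilities are bounded away from `1`. By `UB^S`, a
single event of probability less than `1` contains all the `C n`, hence also `⋃ₙ ⋂ₖ E n k`, which
contradicts (1).
-/

namespace ProbLogic

open Ty Formula Filter

/-! ## Substitution -/

section Substitution

variable {Γ Δ Θ : Ctx} {σ τ : Ty}

theorem Sub.ext {s t : Sub Γ Δ} (h : ∀ τ (v : Var Γ τ), s v = t v) : s = t := by
  funext τ v; exact h τ v

theorem Sub.ext_cons {s t : Sub (σ :: Γ) Δ} (hz : s .z = t .z)
    (hs : ∀ τ (v : Var Γ τ), s (.s v) = t (.s v)) : s = t := by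
  refine Sub.ext fun τ v => ?_
  cases v with
  | z => exact hz
  | s v => exact hs _ v

/-- A renaming of variables, viewed as a substitution. -/
def Sub.ofRen (r : Ren Γ Δ) : Sub Γ Δ := fun _ v => .var (r v)

/-- Composition of substitutions, in diagrammatic order. -/
def Sub.comp (s : Sub Γ Δ) (s' : Sub Δ Θ) : Sub Γ Θ := fun _ v => (s v).subst s'

namespace Term

theorem rename_eq_subst (r : Ren Γ Δ) (t : Term Γ τ) : t.rename r = t.subst (.ofRen r) := by
  induction t with
  | var v => rfl
  | cst c => rfl
  | app f a hf ha => simp only [Term.rename, Term.subst, hf, ha]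

theorem subst_subst (s : Sub Γ Δ) (s' : Sub Δ Θ) (t : Term Γ τ) :
    (t.subst s).subst s' = t.subst (s.comp s') := by
  induction t with
  | var v => rfl
  | cst c => rfl
  | app f a hf ha => simp only [Term.subst, hf, ha]

theorem subst_id (t : Term Γ τ) : t.subst (Sub.id Γ) = t := by
  induction t with
  | var v => rfl
  | cst c => rfl
  | app f a hf ha => simp only [Term.subst, hf, ha]

theorem subst_wk (s : Sub (σ :: Γ) Δ) (t : Term Γ τ) :
    (t.wk (σ := σ)).subst s = t.subst fun _ v => s (.s v) := by
  rw [Term.wk, rename_eq_subst, subst_subst]; rfl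

theorem wk_subst (s : Sub Γ Δ) (t : Term Γ τ) :
    (t.subst s).wk (σ := σ) = t.subst fun _ v => (s v).wk := by
  rw [Term.wk, rename_eq_subst, subst_subst]
  congr 1
  exact Sub.ext fun τ v => (rename_eq_subst _ _).symm

theorem wk_inst (t : Term Γ τ) (u : Term Γ σ) : t.wk.inst u = t :=
  (subst_wk _ _).trans (subst_id t)

end Term

namespace Sub

theorem comp_id (s : Sub Γ Δ) : s.comp (Sub.id Δ) = s := Sub.ext fun _ v => (s v).subst_id

theorem cons_comp (t : Term Δ σ) (s : Sub Γ Δ) (s' : Sub Δ Θ) :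
    (Sub.cons t s).comp s' = Sub.cons (t.subst s') (s.comp s') :=
  Sub.ext_cons rfl fun _ _ => rfl

theorem lift_comp_cons (s : Sub Γ Δ) (t : Term Θ σ) (s' : Sub Δ Θ) :
    (s.lift σ).comp (Sub.cons t s') = Sub.cons t (s.comp s') :=
  Sub.ext_cons rfl fun _ v => Term.subst_wk (Sub.cons t s') (s v)

theorem lift_comp (s : Sub Γ Δ) (s' : Sub Δ Θ) (σ : Ty) :
    (s.lift σ).comp (s'.lift σ) = (s.comp s').lift σ :=
  Sub.ext_cons rfl fun _ v => (Term.subst_wk (s'.lift σ) (s v)).trans (Term.wk_subst s' (s v)).symm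

theorem lift_ofRen (r : Ren Γ Δ) (σ : Ty) : (ofRen r).lift σ = ofRen (r.lift σ) :=
  Sub.ext_cons rfl fun _ _ => rfl

theorem lift_id (Γ : Ctx) (σ : Ty) : (Sub.id Γ).lift σ = Sub.id (σ :: Γ) :=
  Sub.ext_cons rfl fun _ _ => rfl

end Sub

theorem Term.inst_subst (r : Term (σ :: Γ) τ) (a : Term Γ σ) (s : Sub Γ Δ) :
    (r.inst a).subst s = (r.subst (s.lift σ)).inst (a.subst s) := by
  rw [Term.inst, Term.inst, subst_subst, subst_subst, Sub.cons_comp, Sub.lift_comp_cons,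
    Sub.comp_id]
  rfl

namespace Formula

theorem subst_subst (s : Sub Γ Δ) (s' : Sub Δ Θ) (φ : Formula Γ) :
    (φ.subst s).subst s' = φ.subst (s.comp s') := by
  induction φ generalizing Δ Θ with
  | eq0 a b => simp only [Formula.subst, Term.subst_subst]
  | bot => rfl
  | and φ ψ h₁ h₂ => simp only [Formula.subst, h₁, h₂]
  | or φ ψ h₁ h₂ => simp only [Formula.subst, h₁, h₂]
  | imp φ ψ h₁ h₂ => simp only [Formula.subst, h₁, h₂]
  | all σ φ h => simp only [Formula.subst, h, Sub.lift_comp]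
  | ex σ φ h => simp only [Formula.subst, h, Sub.lift_comp]

theorem rename_eq_subst (r : Ren Γ Δ) (φ : Formula Γ) : φ.rename r = φ.subst (.ofRen r) := by
  induction φ generalizing Δ with
  | eq0 a b => simp only [Formula.rename, Formula.subst, Term.rename_eq_subst]
  | bot => rfl
  | and φ ψ h₁ h₂ => simp only [Formula.rename, Formula.subst, h₁, h₂]
  | or φ ψ h₁ h₂ => simp only [Formula.rename, Formula.subst, h₁, h₂]
  | imp φ ψ h₁ h₂ => simp only [Formula.rename, Formula.subst, h₁, h₂]
  | all σ φ h => simp only [Formula.rename, Formula.subst, h, Sub.lift_ofRen]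
  | ex σ φ h => simp only [Formula.rename, Formula.subst, h, Sub.lift_ofRen]

theorem subst_id (φ : Formula Γ) : φ.subst (Sub.id Γ) = φ := by
  induction φ with
  | eq0 a b => simp only [Formula.subst, Term.subst_id]
  | bot => rfl
  | and φ ψ h₁ h₂ => simp only [Formula.subst, h₁, h₂]
  | or φ ψ h₁ h₂ => simp only [Formula.subst, h₁, h₂]
  | imp φ ψ h₁ h₂ => simp only [Formula.subst, h₁, h₂]
  | all σ φ h => simp only [Formula.subst, h, Sub.lift_id]
  | ex σ φ h => simp only [Formula.subst, h, Sub.lift_id]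

theorem subst_wk (s : Sub (σ :: Γ) Δ) (φ : Formula Γ) :
    (φ.wk (σ := σ)).subst s = φ.subst fun _ v => s (.s v) := by
  rw [Formula.wk, rename_eq_subst, subst_subst]; rfl

theorem inst_subst_lift (φ : Formula (σ :: Γ)) (s : Sub Γ Δ) (t : Term Δ σ) :
    (φ.subst (s.lift σ)).inst t = φ.subst (Sub.cons t s) := by
  rw [Formula.inst, subst_subst, Sub.lift_comp_cons, Sub.comp_id]

theorem inst_subst (φ : Formula (σ :: Γ)) (s : Sub Γ Δ) (t : Term Γ σ) :
    (φ.inst t).subst s = (φ.subst (s.lift σ)).inst (t.subst s) := by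
  rw [inst_subst_lift, Formula.inst, subst_subst, Sub.cons_comp]
  rfl

theorem rename_wk_lift_inst (φ : Formula (σ :: Γ)) :
    (φ.rename ((Ren.wk Γ σ).lift σ)).inst (.var .z) = φ := by
  have hid : Sub.cons (.var .z) (Sub.ofRen (Ren.wk Γ σ)) = Sub.id (σ :: Γ) :=
    Sub.ext_cons rfl fun _ _ => rfl
  rw [rename_eq_subst, ← Sub.lift_ofRen, inst_subst_lift, hid, subst_id]

theorem QF.subst (s : Sub Γ Δ) {φ : Formula Γ} (h : φ.QF) : (φ.subst s).QF := by
  induction φ generalizing Δ with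
  | eq0 a b => trivial
  | bot => trivial
  | and φ ψ h₁ h₂ => exact ⟨h₁ s h.1, h₂ s h.2⟩
  | or φ ψ h₁ h₂ => exact ⟨h₁ s h.1, h₂ s h.2⟩
  | imp φ ψ h₁ h₂ => exact ⟨h₁ s h.1, h₂ s h.2⟩
  | all σ φ _ => exact h.elim
  | ex σ φ _ => exact h.elim

end Formula

theorem IsExistential.subst (s : Sub Γ Δ) {φ : Formula Γ} (h : IsExistential φ) :
    IsExistential (φ.subst s) := by
  induction h generalizing Δ with
  | qf h => exact .qf (h.subst s)
  | ex hσ _ ih => exact .ex hσ (ih _)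

end Substitution

/-! ## Structures -/

/-- Applicative structures for the language. Equality of type `0` is interpreted as identity; no
extensionality is required at higher types. -/
structure Struct where
  D : Ty → Type
  app : ∀ {ρ τ : Ty}, D (ρ ⇾ τ) → D ρ → D τ
  cst : ∀ {τ : Ty}, Const τ → D τ

/-- Assignments of values to the variables of a context. -/
abbrev Struct.Env (M : Struct) (Γ : Ctx) : Type := ∀ ⦃τ : Ty⦄, Var Γ τ → M.D τ

namespace Struct

variable {M : Struct} {Γ Δ : Ctx} {σ τ : Ty}

/-- The assignment `e` extended by the value `a` of the innermost variable. -/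
def Env.cons (a : M.D σ) (e : M.Env Γ) : M.Env (σ :: Γ)
  | _, .z => a
  | _, .s v => e v

infixr:67 " ∷ " => Env.cons

/-- The assignment on the empty context. -/
def Env.nil : M.Env [] := fun _ v => nomatch v

theorem Env.ext_cons {e e' : M.Env (σ :: Γ)} (hz : e .z = e' .z)
    (hs : ∀ τ (v : Var Γ τ), e (.s v) = e' (.s v)) : e = e' := by
  funext τ v
  cases v with
  | z => exact hz
  | s v => exact hs _ v

/-- The value of a term. -/
def eval (e : M.Env Γ) : {τ : Ty} → Term Γ τ → M.D τ
  | _, .var v => e v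
  | _, .cst c => M.cst c
  | _, .app f a => M.app (eval e f) (eval e a)

/-- Tarskian satisfaction of formulas. -/
def Sat : {Γ : Ctx} → M.Env Γ → Formula Γ → Prop
  | _, e, .eq0 s t => eval e s = eval e t
  | _, _, .bot => False
  | _, e, .and φ ψ => Sat e φ ∧ Sat e ψ
  | _, e, .or φ ψ => Sat e φ ∨ Sat e ψ
  | _, e, .imp φ ψ => Sat e φ → Sat e ψ
  | _, e, .all σ φ => ∀ a : M.D σ, Sat (a ∷ e) φ
  | _, e, .ex σ φ => ∃ a : M.D σ, Sat (a ∷ e) φ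

theorem eval_subst (s : Sub Γ Δ) (e : M.Env Δ) (t : Term Γ τ) :
    eval e (t.subst s) = eval (fun _ v => eval e (s v)) t := by
  induction t with
  | var v => rfl
  | cst c => rfl
  | app f a hf ha => simp only [Term.subst, eval, hf, ha]

@[simp] theorem eval_wk (e : M.Env Γ) (a : M.D σ) (t : Term Γ τ) :
    eval (a ∷ e) t.wk = eval e t := by
  rw [Term.wk, Term.rename_eq_subst, eval_subst]; rfl

theorem eval_lift (s : Sub Γ Δ) (e : M.Env Δ) (a : M.D σ) :
    (fun _ v => eval (a ∷ e) (s.lift σ v) : M.Env (σ :: Γ)) = a ∷ fun _ v => eval e (s v) :=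
  Env.ext_cons rfl fun _ v => eval_wk e a (s v)

theorem sat_subst (s : Sub Γ Δ) (e : M.Env Δ) (φ : Formula Γ) :
    Sat e (φ.subst s) ↔ Sat (fun _ v => eval e (s v)) φ := by
  induction φ generalizing Δ with
  | eq0 a b => simp only [Formula.subst, Sat, eval_subst]
  | bot => rfl
  | and φ ψ h₁ h₂ => simp only [Formula.subst, Sat, h₁, h₂]
  | or φ ψ h₁ h₂ => simp only [Formula.subst, Sat, h₁, h₂]
  | imp φ ψ h₁ h₂ => simp only [Formula.subst, Sat, h₁, h₂]
  | all σ φ h => simp only [Formula.subst, Sat, h, eval_lift]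
  | ex σ φ h => simp only [Formula.subst, Sat, h, eval_lift]

theorem sat_rename (r : Ren Γ Δ) (e : M.Env Δ) (φ : Formula Γ) :
    Sat e (φ.rename r) ↔ Sat (fun _ v => e (r v)) φ := by
  rw [Formula.rename_eq_subst, sat_subst]; rfl

theorem sat_inst (e : M.Env Γ) (φ : Formula (σ :: Γ)) (t : Term Γ σ) :
    Sat e (φ.inst t) ↔ Sat (eval e t ∷ e) φ := by
  rw [Formula.inst, sat_subst]
  exact iff_of_eq (congrArg (Sat · φ) (Env.ext_cons rfl fun _ _ => rfl))

end Struct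

/-! ## Countability of the language -/

/-- An injective numbering of the types. -/
def Ty.code : Ty → ℕ
  | nat => 0
  | omega => 1
  | event => 2
  | fn ρ τ => Nat.pair ρ.code τ.code + 3

theorem Ty.code_injective : Function.Injective Ty.code := by
  intro ρ
  induction ρ with
  | fn a b ha hb =>
    intro τ h
    cases τ with
    | fn c d =>
      simp only [Ty.code, Nat.add_right_cancel_iff, Nat.pair_eq_pair] at h
      rw [ha h.1, hb h.2]
    | _ => simp [Ty.code] at h
  | _ => intro τ h; cases τ <;> simp [Ty.code] at h ⊢

instance : Countable Ty := Ty.code_injective.countable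

/-- The de Bruijn index of a variable. -/
def Var.index {Γ : Ctx} {τ : Ty} : Var Γ τ → ℕ
  | .z => 0
  | .s v => v.index + 1

theorem Var.index_injective {Γ : Ctx} {τ : Ty} :
    Function.Injective (Var.index : Var Γ τ → ℕ) := by
  intro v
  induction v with
  | z => intro w h; cases w with
    | z => rfl
    | s w => simp [Var.index] at h
  | s v ih => intro w h; cases w with
    | z => simp [Var.index] at h
    | s w => rw [ih (Nat.succ.inj h)]

instance (Γ : Ctx) (τ : Ty) : Countable (Var Γ τ) := Var.index_injective.countable

instance : Countable (Σ τ, Const τ) := by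
  let f : Fin 9 ⊕ (Ty × Ty) ⊕ (Ty × Ty × Ty) ⊕ (Σ (l : List Ty) (ρ : Ty), Var l ρ) → Σ τ, Const τ
    | .inl 0 => ⟨_, .zero⟩
    | .inl 1 => ⟨_, .succ⟩
    | .inl 2 => ⟨_, .eqOmega⟩
    | .inl 3 => ⟨_, .mem⟩
    | .inl 4 => ⟨_, .union⟩
    | .inl 5 => ⟨_, .compl⟩
    | .inl 6 => ⟨_, .empty⟩
    | .inl 7 => ⟨_, .prob⟩
    | .inl 8 => ⟨_, .point⟩
    | .inr (.inl (a, b)) => ⟨_, .proj a b⟩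
    | .inr (.inr (.inl (a, b, c))) => ⟨_, .dist a b c⟩
    | .inr (.inr (.inr ⟨l, _, i⟩)) => ⟨_, .recur l i⟩
  refine Function.Surjective.countable (f := f) ?_
  rintro ⟨_, c⟩
  cases c with
  | zero => exact ⟨.inl 0, rfl⟩
  | succ => exact ⟨.inl 1, rfl⟩
  | eqOmega => exact ⟨.inl 2, rfl⟩
  | mem => exact ⟨.inl 3, rfl⟩
  | union => exact ⟨.inl 4, rfl⟩
  | compl => exact ⟨.inl 5, rfl⟩
  | empty => exact ⟨.inl 6, rfl⟩
  | prob => exact ⟨.inl 7, rfl⟩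
  | point => exact ⟨.inl 8, rfl⟩
  | proj a b => exact ⟨.inr (.inl (a, b)), rfl⟩
  | dist a b c => exact ⟨.inr (.inr (.inl (a, b, c))), rfl⟩
  | recur l i => exact ⟨.inr (.inr (.inr ⟨l, _, i⟩)), rfl⟩

theorem countable_of_countable_lt {α : Type*} (r : α → ℕ) (h : ∀ n, {a | r a < n}.Countable) :
    Countable α := by
  rw [← Set.countable_univ_iff]
  exact (Set.countable_iUnion h).mono fun a _ => Set.mem_iUnion.2 ⟨r a + 1, Nat.lt_succ_self _⟩

/-- The nesting depth of application in a term. -/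
def Term.depth {Γ : Ctx} : {τ : Ty} → Term Γ τ → ℕ
  | _, .var _ => 0
  | _, .cst _ => 0
  | _, .app f a => max f.depth a.depth + 1

instance (Γ : Ctx) : Countable (Σ τ, Term Γ τ) := by
  refine countable_of_countable_lt (fun t => t.2.depth) fun n => ?_
  induction n with
  | zero => simp
  | succ n ih =>
    have hτ : ∀ τ, {t : Term Γ τ | t.depth < n}.Countable := fun τ =>
      ih.preimage (f := fun t => (⟨τ, t⟩ : Σ τ, Term Γ τ)) sigma_mk_injective
    refine (((Set.countable_range fun v : (Σ τ, Var Γ τ) => (⟨v.1, .var v.2⟩ : Σ τ, Term Γ τ)).union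
      (Set.countable_range fun c : (Σ τ, Const τ) => (⟨c.1, .cst c.2⟩ : Σ τ, Term Γ τ))).union
      (Set.countable_iUnion fun ρ => Set.countable_iUnion fun τ =>
        Set.Countable.image2 (hτ (ρ ⇾ τ)) (hτ ρ)
          (fun f a => (⟨τ, f ⬝ a⟩ : Σ τ, Term Γ τ)))).mono ?_
    rintro ⟨τ, t⟩ h
    cases t with
    | var v => exact .inl (.inl ⟨⟨τ, v⟩, rfl⟩)
    | cst c => exact .inl (.inr ⟨⟨τ, c⟩, rfl⟩)
    | app f a =>
      have h' := max_lt_iff.1 (Nat.lt_of_succ_lt_succ h)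
      exact .inr (Set.mem_iUnion.2 ⟨_, Set.mem_iUnion.2 ⟨_, f, h'.1, a, h'.2, rfl⟩⟩)

instance (Γ : Ctx) (τ : Ty) : Countable (Term Γ τ) :=
  Function.Injective.countable (f := fun t => (⟨τ, t⟩ : Σ τ, Term Γ τ)) sigma_mk_injective

/-- The nesting depth of connectives and quantifiers in a formula. -/
def Formula.depth : {Γ : Ctx} → Formula Γ → ℕ
  | _, eq0 _ _ => 0
  | _, bot => 0
  | _, and φ ψ => max φ.depth ψ.depth + 1
  | _, or φ ψ => max φ.depth ψ.depth + 1
  | _, imp φ ψ => max φ.depth ψ.depth + 1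
  | _, all _ φ => φ.depth + 1
  | _, ex _ φ => φ.depth + 1

instance (Γ : Ctx) : Countable (Formula Γ) := by
  refine countable_of_countable_lt Formula.depth fun n => ?_
  induction n generalizing Γ with
  | zero => simp
  | succ n ih =>
    refine ((((((Set.countable_range fun p : Term Γ nat × Term Γ nat => eq0 p.1 p.2).union
      (Set.countable_singleton bot)).union
      (Set.Countable.image2 (ih Γ) (ih Γ) and)).union
      (Set.Countable.image2 (ih Γ) (ih Γ) or)).union
      (Set.Countable.image2 (ih Γ) (ih Γ) imp)).union
      (Set.countable_iUnion fun σ => ((ih (σ :: Γ)).image (all σ)).union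
        ((ih (σ :: Γ)).image (ex σ)))).mono ?_
    intro φ h
    cases φ with
    | eq0 s t => exact .inl (.inl (.inl (.inl (.inl ⟨(s, t), rfl⟩))))
    | bot => exact .inl (.inl (.inl (.inl (.inr rfl))))
    | and φ ψ =>
      have h' := max_lt_iff.1 (Nat.lt_of_succ_lt_succ h)
      exact .inl (.inl (.inl (.inr ⟨φ, h'.1, ψ, h'.2, rfl⟩)))
    | or φ ψ =>
      have h' := max_lt_iff.1 (Nat.lt_of_succ_lt_succ h)
      exact .inl (.inl (.inr ⟨φ, h'.1, ψ, h'.2, rfl⟩))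
    | imp φ ψ =>
      have h' := max_lt_iff.1 (Nat.lt_of_succ_lt_succ h)
      exact .inl (.inr ⟨φ, h'.1, ψ, h'.2, rfl⟩)
    | all σ φ => exact .inr (Set.mem_iUnion.2 ⟨σ, .inl ⟨φ, Nat.lt_of_succ_lt_succ h, rfl⟩⟩)
    | ex σ φ => exact .inr (Set.mem_iUnion.2 ⟨σ, .inr ⟨φ, Nat.lt_of_succ_lt_succ h, rfl⟩⟩)

/-! ## Derivations -/

namespace Deriv

variable {T : Theory} {Γ : Ctx} {Δ Δ' : List (Formula Γ)} {φ ψ : Formula Γ}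

theorem mono (h : Deriv T Δ φ) (hs : Δ ⊆ Δ') : Deriv T Δ' φ := by
  induction h with
  | ax h => exact .ax h
  | hyp h => exact .hyp (hs h)
  | and_intro _ _ h₁ h₂ => exact .and_intro (h₁ hs) (h₂ hs)
  | and_left _ h => exact .and_left (h hs)
  | and_right _ h => exact .and_right (h hs)
  | or_left _ h => exact .or_left (h hs)
  | or_right _ h => exact .or_right (h hs)
  | or_elim _ _ _ h h₁ h₂ =>
    exact .or_elim (h hs) (h₁ (List.cons_subset_cons _ hs)) (h₂ (List.cons_subset_cons _ hs))
  | imp_intro _ h => exact .imp_intro (h (List.cons_subset_cons _ hs))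
  | imp_elim _ _ h₁ h₂ => exact .imp_elim (h₁ hs) (h₂ hs)
  | by_contra _ h => exact .by_contra (h (List.cons_subset_cons _ hs))
  | all_intro _ h => exact .all_intro (h (List.map_subset _ hs))
  | all_elim t _ h => exact .all_elim t (h hs)
  | ex_intro t _ h => exact .ex_intro t (h hs)
  | ex_elim _ _ h₁ h₂ =>
    exact .ex_elim (h₁ hs) (h₂ (List.cons_subset_cons _ (List.map_subset _ hs)))
  | qf_er r hφ h _ => exact .qf_er r hφ h

theorem mono_theory {T' : Theory} (hT : T ≤ T') (h : Deriv T Δ φ) : Deriv T' Δ φ := by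
  induction h with
  | ax h => exact .ax (hT _ _ h)
  | hyp h => exact .hyp h
  | and_intro _ _ h₁ h₂ => exact .and_intro h₁ h₂
  | and_left _ h => exact .and_left h
  | and_right _ h => exact .and_right h
  | or_left _ h => exact .or_left h
  | or_right _ h => exact .or_right h
  | or_elim _ _ _ h h₁ h₂ => exact .or_elim h h₁ h₂
  | imp_intro _ h => exact .imp_intro h
  | imp_elim _ _ h₁ h₂ => exact .imp_elim h₁ h₂
  | by_contra _ h => exact .by_contra h
  | all_intro _ h => exact .all_intro h
  | all_elim t _ h => exact .all_elim t h
  | ex_intro t _ h => exact .ex_intro t h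
  | ex_elim _ _ h₁ h₂ => exact .ex_elim h₁ h₂
  | qf_er r hφ _ h => exact .qf_er r hφ h

theorem weaken (h : Deriv T [] φ) : Deriv T Δ φ := h.mono (List.nil_subset _)

theorem cons (h : Deriv T Δ φ) : Deriv T (ψ :: Δ) φ := h.mono (List.subset_cons_self _ _)

theorem cut (L : List (Formula Γ)) (hL : ∀ ψ ∈ L, Deriv T Δ ψ) (h : Deriv T L φ) :
    Deriv T Δ φ := by
  induction L generalizing φ with
  | nil => exact h.weaken
  | cons ψ L ih =>
    have hψ : Deriv T Δ (ψ ⟹ φ) := ih (fun χ hχ => hL χ (.tail _ hχ)) (.imp_intro h)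
    exact .imp_elim hψ (hL ψ (.head _))

theorem imp_of_neg (h : Deriv T Δ φ.neg) : Deriv T Δ (φ ⟹ ψ) :=
  .imp_intro (.by_contra (.imp_elim h.cons.cons (.hyp (.tail _ (.head _)))))

theorem neg_of_neg_ex_wk {σ : Ty} (t : Term Γ σ) (h : Deriv T Δ (ex σ φ.wk).neg) :
    Deriv T Δ φ.neg := by
  have hφ : φ.wk.inst t = φ := (Formula.subst_wk _ _).trans φ.subst_id
  exact .imp_intro (.imp_elim h.cons (.ex_intro t (hφ.symm ▸ .hyp (.head _))))

theorem ex_neg_of_neg_all {σ : Ty} {φ : Formula (σ :: Γ)} (h : Deriv T Δ (all σ φ).neg) :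
    Deriv T Δ (ex σ φ.neg) := by
  have hφ : Formula.neg φ =
      (Formula.rename ((Ren.wk Γ σ).lift σ) φ.neg).inst (.var .z) :=
    congrArg Formula.neg (Formula.rename_wk_lift_inst φ).symm
  refine .by_contra (.imp_elim h.cons (.all_intro (.by_contra ?_)))
  exact .imp_elim (φ := (ex σ φ.neg).wk) (.hyp (.tail _ (.head _)))
    (.ex_intro (.var .z) (.hyp (hφ ▸ .head _)))

end Deriv

/-! ## Generic ideals -/

/-- Extensions of a context by finitely many further variables. -/
inductive Ext : Ctx → Ctx → Type
  | refl (Γ : Ctx) : Ext Γ Γ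
  | step {Γ Δ : Ctx} (σ : Ty) : Ext Γ Δ → Ext Γ (σ :: Δ)

namespace Ext

variable {Γ Δ Θ : Ctx}

theorem length_le (e : Ext Γ Δ) : Γ.length ≤ Δ.length := by
  induction e with
  | refl => exact le_rfl
  | step σ _ ih => exact ih.trans (Nat.le_succ _)

instance (Γ Δ : Ctx) : Subsingleton (Ext Γ Δ) := by
  refine ⟨fun e e' => ?_⟩
  induction e with
  | refl => cases e' with
    | refl => rfl
    | step σ e' => exact absurd e'.length_le (Nat.not_succ_le_self _)
  | step σ e ih => cases e' with
    | refl => exact absurd e.length_le (Nat.not_succ_le_self _)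
    | step _ e' => rw [ih e']

/-- The inclusion of the smaller context into the larger one, as a substitution. -/
def sub : {Δ : Ctx} → Ext Γ Δ → Sub Γ Δ
  | _, refl _ => Sub.id Γ
  | _, step _ e => fun _ v => (e.sub v).wk

/-- Composition of extensions. -/
def trans (e : Ext Γ Δ) : {Θ : Ctx} → Ext Δ Θ → Ext Γ Θ
  | _, refl _ => e
  | _, step σ e' => step σ (e.trans e')

theorem sub_comp_sub (e : Ext Γ Δ) (e' : Ext Δ Θ) (e'' : Ext Γ Θ) :
    e.sub.comp e'.sub = e''.sub := by
  rw [Subsingleton.elim e'' (e.trans e')]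
  induction e' with
  | refl => exact Sub.comp_id _
  | step σ e' ih =>
    refine Sub.ext fun τ v => ?_
    simp only [trans, sub, ← ih (e.trans e'), Sub.comp, Term.wk_subst]

end Ext

section

variable {T : Theory} {Γ : Ctx} {σ τ : Ty}

variable (T) in
/-- Finite consistent sets of formulas over a theory; the variables of the context serve as Henkin
constants. -/
structure Stage where
  ctx : Ctx
  hyps : List (Formula ctx)
  consistent : ¬ Deriv T hyps bot

namespace Stage

instance : Preorder (Stage T) where
  le S S' := ∃ e : Ext S.ctx S'.ctx, ∀ ψ ∈ S.hyps, ψ.subst e.sub ∈ S'.hyps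
  le_refl S := ⟨.refl _, fun ψ h => by rwa [Ext.sub, Formula.subst_id]⟩
  le_trans S S' S'' := by
    rintro ⟨e, h⟩ ⟨e', h'⟩
    refine ⟨e.trans e', fun ψ hψ => ?_⟩
    rw [← Ext.sub_comp_sub e e', ← Formula.subst_subst]
    exact h' _ (h _ hψ)

/-- The stage with one more formula. -/
def insert (S : Stage T) (φ : Formula S.ctx) (h : ¬ Deriv T (φ :: S.hyps) bot) : Stage T :=
  ⟨S.ctx, φ :: S.hyps, h⟩

theorem le_insert (S : Stage T) (φ : Formula S.ctx) (h : ¬ Deriv T (φ :: S.hyps) bot) :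
    S ≤ S.insert φ h :=
  ⟨.refl _, fun ψ hψ => ψ.subst_id.symm ▸ List.mem_cons_of_mem _ hψ⟩

/-- The stage with one more variable and a formula about it. -/
def insertVar (S : Stage T) (χ : Formula (σ :: S.ctx))
    (h : ¬ Deriv T (χ :: S.hyps.map Formula.wk) bot) : Stage T :=
  ⟨σ :: S.ctx, χ :: S.hyps.map Formula.wk, h⟩

theorem le_insertVar (S : Stage T) (χ : Formula (σ :: S.ctx))
    (h : ¬ Deriv T (χ :: S.hyps.map Formula.wk) bot) : S ≤ S.insertVar χ h := by
  refine ⟨.step σ (.refl _), fun ψ hψ => .tail _ (List.mem_map.2 ⟨ψ, hψ, ?_⟩)⟩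
  rw [Formula.wk, Formula.rename_eq_subst]
  rfl

/-- The stage contains an instance of `χ` or refutes `∃ χ`. -/
def Witnesses (S : Stage T) (χ : Formula (σ :: Γ)) : Prop :=
  ∃ e : Ext Γ S.ctx, (∃ t, χ.subst (Sub.cons t e.sub) ∈ S.hyps) ∨
    (ex σ χ).neg.subst e.sub ∈ S.hyps

theorem Witnesses.mono {S S' : Stage T} (hS : S ≤ S') {χ : Formula (σ :: Γ)}
    (h : S.Witnesses χ) : S'.Witnesses χ := by
  obtain ⟨e, he⟩ := hS
  obtain ⟨d, h⟩ := h
  refine ⟨d.trans e, ?_⟩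
  rw [← Ext.sub_comp_sub d e]
  rcases h with ⟨t, ht⟩ | hn
  · refine .inl ⟨t.subst e.sub, ?_⟩
    rw [← Sub.cons_comp, ← Formula.subst_subst]
    exact he _ ht
  · refine .inr ?_
    rw [← Formula.subst_subst]
    exact he _ hn

theorem Witnesses.of_subst {S : Stage T} {Δ : Ctx} (e : Ext Γ Δ) {χ : Formula (σ :: Γ)}
    (h : S.Witnesses (χ.subst (e.sub.lift σ))) : S.Witnesses χ := by
  obtain ⟨d, h⟩ := h
  refine ⟨e.trans d, ?_⟩
  rw [← Ext.sub_comp_sub e d]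
  rcases h with ⟨t, ht⟩ | hn
  · exact .inl ⟨t, by rwa [← Sub.lift_comp_cons, ← Formula.subst_subst]⟩
  · exact .inr (by rwa [← Formula.subst_subst])

theorem exists_witnesses (S : Stage T) (χ : Formula (σ :: S.ctx)) :
    ∃ S', S ≤ S' ∧ S'.Witnesses χ := by
  by_cases h : Deriv T (ex σ χ :: S.hyps) bot
  · refine ⟨S.insert (ex σ χ).neg fun h' => S.consistent ?_, S.le_insert _ _, .refl _, .inr ?_⟩
    · exact .imp_elim (.imp_intro h') (.imp_intro h)
    · exact (Formula.subst_id _).symm ▸ List.mem_cons_self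
  · refine ⟨S.insertVar χ fun h' => h ?_, S.le_insertVar _ _, .step σ (.refl _),
      .inl ⟨.var .z, ?_⟩⟩
    · exact .ex_elim (.hyp (.head _))
        (h'.mono (List.cons_subset_cons _ (List.map_subset _ (List.subset_cons_self _ _))))
    · have hid : Sub.cons (.var .z) (Ext.step σ (Ext.refl S.ctx)).sub = Sub.id (σ :: S.ctx) :=
        Sub.ext_cons rfl fun _ _ => rfl
      exact hid.symm ▸ χ.subst_id.symm ▸ List.mem_cons_self

variable (T) in
/-- The dense set of stages that witness a formula, or have no extension whose context contains
that of the formula. -/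
def witnessing (χ : Σ p : Ty × Ctx, Formula (p.1 :: p.2)) : Order.Cofinal (Stage T) where
  carrier := {S | S.Witnesses χ.2 ∨ ∀ S', S ≤ S' → IsEmpty (Ext χ.1.2 S'.ctx)}
  isCofinal S := by
    by_cases h : ∀ S', S ≤ S' → IsEmpty (Ext χ.1.2 S'.ctx)
    · exact ⟨S, .inr h, le_rfl⟩
    · push Not at h
      obtain ⟨S', hS, ⟨e⟩⟩ := h
      obtain ⟨S'', hS', hw⟩ := S'.exists_witnesses (χ.2.subst (e.sub.lift χ.1.1))
      exact ⟨S'', .inl (hw.of_subst e), hS.trans hS'⟩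

end Stage

/-- Ideals of stages that meet all the dense sets of witnessing stages. -/
def Generic (I : Order.Ideal (Stage T)) : Prop := ∀ χ, ∃ S ∈ I, S ∈ Stage.witnessing T χ

theorem exists_generic (S : Stage T) : ∃ I : Order.Ideal (Stage T), S ∈ I ∧ Generic I := by
  have := Encodable.ofCountable (Σ p : Ty × Ctx, Formula (p.1 :: p.2))
  refine ⟨Order.idealOfCofinals S (Stage.witnessing T), Order.mem_idealOfCofinals _ _,
    fun χ => ?_⟩
  obtain ⟨S, h₁, h₂⟩ := Order.cofinal_meets_idealOfCofinals S (Stage.witnessing T) χ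
  exact ⟨S, h₂, h₁⟩

/-- All substitution instances of `φ` are derivable. -/
def Theory.Proves (T : Theory) (φ : Formula Γ) : Prop :=
  ∀ ⦃Δ : Ctx⦄ (s : Sub Γ Δ), Deriv T [] (φ.subst s)

section Holds

variable {I : Order.Ideal (Stage T)} {Δ : Ctx} {φ ψ : Formula Γ}

instance : IsDirectedOrder I := ⟨fun a b => by
  obtain ⟨c, hc, h₁, h₂⟩ := I.directed a.1 a.2 b.1 b.2
  exact ⟨⟨c, hc⟩, h₁, h₂⟩⟩

instance : Nonempty I := I.nonempty.to_subtype

variable (I) in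
/-- Truth at an ideal of stages: eventual derivability. -/
def Holds (φ : Formula Γ) : Prop :=
  ∀ᶠ S : I in atTop, ∀ e : Ext Γ S.1.ctx, Deriv T S.1.hyps (φ.subst e.sub)

theorem eventually_nonempty_ext (S : I) : ∀ᶠ S' : I in atTop, Nonempty (Ext S.1.ctx S'.1.ctx) := by
  filter_upwards [eventually_ge_atTop S] with S' h
  exact ⟨h.choose⟩

theorem exists_common_ext (S S' : I) :
    ∃ S'' : I, Nonempty (Ext S.1.ctx S''.1.ctx) ∧ Nonempty (Ext S'.1.ctx S''.1.ctx) :=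
  ((eventually_nonempty_ext S).and (eventually_nonempty_ext S')).exists

theorem Theory.Proves.holds (h : T.Proves φ) : Holds I φ := .of_forall fun _ _ => (h _).weaken

theorem holds_of_mem (S : I) (e : Ext Γ S.1.ctx) (h : φ.subst e.sub ∈ S.1.hyps) : Holds I φ := by
  filter_upwards [eventually_ge_atTop S] with S' ⟨d, hd⟩ e'
  rw [← Ext.sub_comp_sub e d e', ← Formula.subst_subst]
  exact .hyp (hd _ h)

theorem not_holds_bot (S : I) : ¬ Holds I (bot : Formula S.1.ctx) := fun h => by
  obtain ⟨S', h, ⟨e⟩⟩ := (h.and (eventually_nonempty_ext S)).exists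
  exact S'.1.consistent (h e)

theorem holds_subst_ext (S : I) (e : Ext Γ S.1.ctx) : Holds I (φ.subst e.sub) ↔ Holds I φ := by
  constructor <;> intro h
  · filter_upwards [h, eventually_nonempty_ext S] with S' h ⟨d⟩ e'
    rw [← Ext.sub_comp_sub e d e', ← Formula.subst_subst]
    exact h d
  · filter_upwards [h] with S' h d
    rw [Formula.subst_subst, Ext.sub_comp_sub e d (e.trans d)]
    exact h _

theorem Holds.mp (h₁ : Holds I (φ ⟹ ψ)) (h₂ : Holds I φ) : Holds I ψ := by
  filter_upwards [h₁, h₂] with S h₁ h₂ e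
  exact .imp_elim (h₁ e) (h₂ e)

theorem exists_witnesses_of_generic (hI : Generic I) (S : I) (χ : Formula (σ :: S.1.ctx)) :
    ∃ S' : I, S'.1.Witnesses χ := by
  obtain ⟨R, hR, h⟩ := hI ⟨(σ, S.1.ctx), χ⟩
  obtain ⟨S', hS, hR'⟩ := exists_ge_ge S ⟨R, hR⟩
  exact ⟨S', h.elim (·.mono hR') fun h => ((h S'.1 hR').false hS.choose).elim⟩

theorem holds_or_holds_neg (hI : Generic I) (S : I) (φ : Formula S.1.ctx) :
    Holds I φ ∨ Holds I φ.neg := by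
  obtain ⟨S', e, ⟨t, h⟩ | h⟩ := exists_witnesses_of_generic hI S (φ.wk (σ := nat))
  · exact .inl (holds_of_mem S' e (by rwa [Formula.subst_wk] at h))
  · refine .inr ((holds_of_mem S' e h).mono fun S h d => ?_)
    have hwk : (φ.wk (σ := nat)).subst (d.sub.lift nat) = (φ.subst d.sub).wk := by
      rw [Formula.subst_wk, Formula.wk, Formula.rename_eq_subst, Formula.subst_subst]
      exact congrArg (Formula.subst · φ) (Sub.ext fun _ v => Term.rename_eq_subst _ _)
    exact .neg_of_neg_ex_wk zeroT (hwk ▸ h d)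

theorem holds_neg_iff (hI : Generic I) (S : I) (φ : Formula S.1.ctx) :
    Holds I φ.neg ↔ ¬ Holds I φ :=
  ⟨fun h h' => not_holds_bot S (h.mp h'), fun h => (holds_or_holds_neg hI S φ).resolve_left h⟩

theorem holds_imp_iff (hI : Generic I) (S : I) (φ ψ : Formula S.1.ctx) :
    Holds I (φ ⟹ ψ) ↔ (Holds I φ → Holds I ψ) := by
  refine ⟨Holds.mp, fun h => ?_⟩
  rcases holds_or_holds_neg hI S φ with h' | h'
  · exact (h h').mono fun S h e => .imp_intro (h e).cons
  · exact h'.mono fun S h e => (h e).imp_of_neg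

theorem holds_and_iff (φ ψ : Formula Γ) : Holds I (φ ⋏ ψ) ↔ Holds I φ ∧ Holds I ψ :=
  ⟨fun h => ⟨h.mono fun _ h e => .and_left (h e), h.mono fun _ h e => .and_right (h e)⟩,
    fun h => (h.1.and h.2).mono fun _ h e => .and_intro (h.1 e) (h.2 e)⟩

theorem holds_or_iff (hI : Generic I) (S : I) (φ ψ : Formula S.1.ctx) :
    Holds I (φ ⋎ ψ) ↔ Holds I φ ∨ Holds I ψ := by
  constructor
  · intro h
    by_contra! hn
    refine not_holds_bot S ?_
    filter_upwards [h, (holds_neg_iff hI S φ).2 hn.1, (holds_neg_iff hI S ψ).2 hn.2]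
      with S h h₁ h₂ e
    exact .or_elim (h e) (.imp_elim (h₁ e).cons (.hyp (.head _)))
      (.imp_elim (h₂ e).cons (.hyp (.head _)))
  · rintro (h | h)
    · exact h.mono fun _ h e => .or_left (h e)
    · exact h.mono fun _ h e => .or_right (h e)

theorem Holds.exists_of_ex (hI : Generic I) (S : I) {χ : Formula (σ :: S.1.ctx)}
    (h : Holds I (ex σ χ)) : ∃ (S' : I) (e : Ext S.1.ctx S'.1.ctx) (t : Term S'.1.ctx σ),
      Holds I (χ.subst (Sub.cons t e.sub)) := by
  obtain ⟨S', e, ⟨t, ht⟩ | hn⟩ := exists_witnesses_of_generic hI S χ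
  · refine ⟨S', e, t, holds_of_mem S' (.refl _) ?_⟩
    rwa [Ext.sub, Formula.subst_id]
  · exact absurd h ((holds_neg_iff hI S _).1 (holds_of_mem S' e hn))

theorem Holds.ex_intro (S' : I) {χ : Formula (σ :: Γ)} (e : Ext Γ S'.1.ctx)
    (t : Term S'.1.ctx σ) (h : Holds I (χ.subst (Sub.cons t e.sub))) : Holds I (ex σ χ) := by
  filter_upwards [h, eventually_nonempty_ext S'] with S h ⟨d⟩ e'
  refine .ex_intro (t.subst d.sub) ?_
  have hd := h d
  rwa [Formula.subst_subst, Sub.cons_comp, Ext.sub_comp_sub e d e',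
    ← Formula.inst_subst_lift] at hd

theorem Holds.all_elim (S : I) {χ : Formula (σ :: S.1.ctx)} (h : Holds I (all σ χ)) {S' : I}
    (e : Ext S.1.ctx S'.1.ctx) (t : Term S'.1.ctx σ) :
    Holds I (χ.subst (Sub.cons t e.sub)) := by
  filter_upwards [h, eventually_nonempty_ext S] with R h ⟨d⟩ e'
  have hd := Deriv.all_elim (t.subst e'.sub) (h d)
  rwa [Formula.inst_subst_lift, ← Ext.sub_comp_sub e e' d, ← Sub.cons_comp,
    ← Formula.subst_subst] at hd

theorem exists_of_not_holds_all (hI : Generic I) (S : I) {χ : Formula (σ :: S.1.ctx)}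
    (h : ¬ Holds I (all σ χ)) :
    ∃ (S' : I) (e : Ext S.1.ctx S'.1.ctx) (t : Term S'.1.ctx σ),
      ¬ Holds I (χ.subst (Sub.cons t e.sub)) := by
  have hex : Holds I (ex σ χ.neg) :=
    ((holds_neg_iff hI S _).2 h).mono fun _ h e => Deriv.ex_neg_of_neg_all (h e)
  obtain ⟨S', e, t, ht⟩ := hex.exists_of_ex hI S
  exact ⟨S', e, t, (holds_neg_iff hI S' _).1 ht⟩

end Holds

end

section

/-! ## The term model -/

open Struct

variable {T : Theory} {Γ : Ctx} {ρ σ τ : Ty}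

/-- Theories in which equality of type `0` is an equivalence relation; congruence comes from the
rule of extensionality. -/
class Theory.HasEquality (T : Theory) : Prop where
  refl : ∀ {Γ : Ctx} (t : Term Γ nat), T (eq0 t t)
  symm : ∀ {Γ : Ctx} (s t : Term Γ nat), T (eq0 s t ⟹ eq0 t s)
  trans : ∀ {Γ : Ctx} (r s t : Term Γ nat), T (eq0 r s ⟹ eq0 s t ⟹ eq0 r t)

theorem Theory.HasEquality.of_le {T : Theory} (hT : FAxioms ≤ T) : T.HasEquality where
  refl t := hT _ _ (.eq_refl t)
  symm s t := hT _ _ (.eq_symm s t)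
  trans r s t := hT _ _ (.eq_trans r s t)

section Leibniz

variable {I : Order.Ideal (Stage T)} [T.HasEquality]

theorem holds_eq0_refl (t : Term Γ nat) : Holds I (eq0 t t) :=
  Theory.Proves.holds fun _ _ => .ax (Theory.HasEquality.refl _)

theorem Holds.eq0_symm {s t : Term Γ nat} (h : Holds I (eq0 s t)) : Holds I (eq0 t s) :=
  Holds.mp (φ := eq0 s t)
    (Theory.Proves.holds fun _ _ => .ax (Theory.HasEquality.symm _ _)) h

theorem Holds.eq0_trans {r s t : Term Γ nat} (h : Holds I (eq0 r s)) (h' : Holds I (eq0 s t)) :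
    Holds I (eq0 r t) :=
  Holds.mp (φ := eq0 s t) (Holds.mp (φ := eq0 r s)
    (Theory.Proves.holds fun _ _ => .ax (Theory.HasEquality.trans _ _ _)) h) h'

variable (I) in
/-- Leibniz equality of terms over stages, tested in contexts of type `0`. -/
def LeibnizEq (x y : Σ S : I, Term S.1.ctx τ) : Prop :=
  ∀ (S : I) (e : Ext x.1.1.ctx S.1.ctx) (d : Ext y.1.1.ctx S.1.ctx) (r : Term (τ :: S.1.ctx) nat),
    Holds I (eq0 (r.inst (x.2.subst e.sub)) (r.inst (y.2.subst d.sub)))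

theorem LeibnizEq.trans {x y z : Σ S : I, Term S.1.ctx τ} (h : LeibnizEq I x y)
    (h' : LeibnizEq I y z) : LeibnizEq I x z := by
  intro S e d r
  obtain ⟨S', ⟨a⟩, ⟨b⟩⟩ := exists_common_ext S y.1
  have h₁ := h S' (e.trans a) b (r.subst (a.sub.lift τ))
  have h₂ := h' S' b (d.trans a) (r.subst (a.sub.lift τ))
  have h₃ := h₁.eq0_trans h₂
  rw [← Ext.sub_comp_sub e a, ← Ext.sub_comp_sub d a, ← Term.subst_subst, ← Term.subst_subst,
    ← Term.inst_subst, ← Term.inst_subst] at h₃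
  exact (holds_subst_ext S' a).1 h₃

variable (I) in
/-- Leibniz equality of terms over stages, as a setoid. -/
def leibnizSetoid (τ : Ty) : Setoid (Σ S : I, Term S.1.ctx τ) where
  r := LeibnizEq I
  iseqv :=
    { refl := fun x S e d r => by rw [Subsingleton.elim e d]; exact holds_eq0_refl _
      symm := fun h S e d r => (h S d e r).eq0_symm
      trans := LeibnizEq.trans }

variable (I) in
/-- The objects of type `τ` of the term model. -/
abbrev Carrier (τ : Ty) : Type := Quotient (leibnizSetoid I τ)

/-- The object of the term model given by a term. -/
def mk (S : I) (t : Term S.1.ctx τ) : Carrier I τ := Quotient.mk _ ⟨S, t⟩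

theorem mk_subst_ext {S S' : I} (e : Ext S.1.ctx S'.1.ctx) (t : Term S.1.ctx τ) :
    mk S' (t.subst e.sub) = mk S t := by
  refine Quotient.sound fun R d d' r => ?_
  dsimp only
  rw [Term.subst_subst, Ext.sub_comp_sub e d d']
  exact holds_eq0_refl _

theorem mk_eq_mk_iff (S : I) (a b : Term S.1.ctx τ) : mk S a = mk S b ↔
    ∀ (S' : I) (e : Ext S.1.ctx S'.1.ctx) (r : Term (τ :: S'.1.ctx) nat),
      Holds I (eq0 (r.inst (a.subst e.sub)) (r.inst (b.subst e.sub))) := by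
  refine ⟨fun h S' e r => Quotient.exact h S' e e r, fun h => Quotient.sound fun S' e d r => ?_⟩
  rw [Subsingleton.elim d e]
  exact h S' e r

theorem exists_eq_mk (S : I) (x : Carrier I τ) :
    ∃ (S' : I) (_ : Ext S.1.ctx S'.1.ctx) (t : Term S'.1.ctx τ), x = mk S' t := by
  induction x using Quotient.inductionOn with
  | h x =>
    obtain ⟨S', ⟨e⟩, ⟨d⟩⟩ := exists_common_ext S x.1
    exact ⟨S', e, x.2.subst d.sub, (mk_subst_ext d x.2).symm⟩

theorem mk_congr (S : I) {a b : Term S.1.ctx ρ} (h : mk S a = mk S b)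
    (r : Term (ρ :: S.1.ctx) τ) : mk S (r.inst a) = mk S (r.inst b) := by
  rw [mk_eq_mk_iff] at h ⊢
  intro S' e q
  have key (u : Term S'.1.ctx ρ) :
      (q.subst (Sub.cons (r.subst (e.sub.lift ρ)) fun _ v => .var (.s v))).inst u =
        q.inst ((r.subst (e.sub.lift ρ)).inst u) := by
    rw [Term.inst, Term.subst_subst]
    exact congrArg (Term.subst · q) (Sub.ext_cons rfl fun _ _ => rfl)
  have hq := h S' e (q.subst (Sub.cons (r.subst (e.sub.lift ρ)) fun _ v => .var (.s v)))
  rwa [key, key, ← Term.inst_subst, ← Term.inst_subst] at hq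

theorem mk_app_congr (S : I) {f g : Term S.1.ctx (ρ ⇾ τ)} {a b : Term S.1.ctx ρ}
    (hf : mk S f = mk S g) (ha : mk S a = mk S b) : mk S (f ⬝ a) = mk S (g ⬝ b) := by
  have happ (u : Term S.1.ctx (ρ ⇾ τ)) : (v0 ⬝ a.wk : Term (_ :: _) τ).inst u = u ⬝ a :=
    congrArg (Term.app u) (Term.wk_inst a u)
  have happ' (u : Term S.1.ctx ρ) : (g.wk ⬝ v0 : Term (_ :: _) τ).inst u = g ⬝ u :=
    congrArg (Term.app · u) (Term.wk_inst g u)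
  calc mk S (f ⬝ a) = mk S (g ⬝ a) := happ f ▸ happ g ▸ mk_congr S hf (v0 ⬝ a.wk)
    _ = mk S (g ⬝ b) := happ' a ▸ happ' b ▸ mk_congr S ha (g.wk ⬝ v0)

theorem mk_nat_eq_mk_iff (S : I) (a b : Term S.1.ctx nat) :
    mk S a = mk S b ↔ Holds I (eq0 a b) := by
  rw [mk_eq_mk_iff]
  constructor
  · intro h
    have h₀ := h S (.refl _) v0
    rwa [Ext.sub, Term.subst_id, Term.subst_id] at h₀
  · intro h S' e r
    have hr : T.Proves (eq0 (a.subst e.sub) (b.subst e.sub) ⟹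
        eq0 (r.inst (a.subst e.sub)) (r.inst (b.subst e.sub))) := fun Δ s => by
      simp only [Formula.subst, Term.inst_subst]
      exact .qf_er (ρ := nat) (τ := nat) _ trivial (.imp_intro (.hyp (.head _)))
    exact hr.holds.mp ((holds_subst_ext (φ := eq0 a b) S' e).2 h)

theorem mk_eq_mk_of_deriv (S : I) {a b : Term S.1.ctx τ}
    (h : ∀ ⦃Δ : Ctx⦄ (s : Sub S.1.ctx Δ), Deriv T [] (eqTy τ (a.subst s) (b.subst s))) :
    mk S a = mk S b := by
  rw [mk_eq_mk_iff]
  intro S' e r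
  refine Theory.Proves.holds fun Δ s => ?_
  simp only [Formula.subst, Term.inst_subst, Term.subst_subst]
  exact .imp_elim (φ := bot ⟹ bot) (.qf_er (τ := nat) _ ⟨trivial, trivial⟩
    (.imp_intro (h _).weaken)) (.imp_intro (.hyp (.head _)))

theorem exists_app (F : Carrier I (ρ ⇾ τ)) (X : Carrier I ρ) : ∃ Y : Carrier I τ,
    ∀ (S : I) (f : Term S.1.ctx (ρ ⇾ τ)) (a : Term S.1.ctx ρ),
      mk S f = F → mk S a = X → mk S (f ⬝ a) = Y := by
  obtain ⟨S₁, _, g, rfl⟩ := exists_eq_mk (Classical.arbitrary I) F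
  obtain ⟨S₂, e, b, rfl⟩ := exists_eq_mk S₁ X
  refine ⟨mk S₂ (g.subst e.sub ⬝ b), fun S f a hf ha => ?_⟩
  obtain ⟨S', ⟨d⟩, ⟨d'⟩⟩ := exists_common_ext S S₂
  rw [← mk_subst_ext d, ← mk_subst_ext d']
  apply mk_app_congr
  · rw [mk_subst_ext, mk_subst_ext, mk_subst_ext, hf]
  · rw [mk_subst_ext, mk_subst_ext, ha]

variable (I) in
/-- The term model of an ideal of stages. -/
noncomputable def termModel : Struct where
  D := Carrier I
  app F X := (exists_app F X).choose
  cst c := mk (Classical.arbitrary I) (.cst c)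

theorem termModel_app (S : I) (f : Term S.1.ctx (ρ ⇾ τ)) (a : Term S.1.ctx ρ) :
    (termModel I).app (mk S f) (mk S a) = mk S (f ⬝ a) :=
  ((exists_app _ _).choose_spec S f a rfl rfl).symm

theorem termModel_cst (S : I) (c : Const τ) : (termModel I).cst c = mk S (.cst c) := by
  obtain ⟨S', ⟨e⟩, ⟨e'⟩⟩ := exists_common_ext S (Classical.arbitrary I)
  exact (mk_subst_ext e' (.cst c)).symm.trans (mk_subst_ext e (.cst c))

/-- The assignment in the term model given by a substitution. -/
def mkEnv (S : I) (s : Sub Γ S.1.ctx) : (termModel I).Env Γ := fun _ v => mk S (s v)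

theorem termModel_eval (S : I) (s : Sub Γ S.1.ctx) (t : Term Γ τ) :
    eval (mkEnv S s) t = mk S (t.subst s) := by
  induction t with
  | var v => rfl
  | cst c => exact termModel_cst S c
  | app f a hf ha => exact (congrArg₂ _ hf ha).trans (termModel_app S _ _)

theorem cons_mkEnv {S S' : I} (e : Ext S.1.ctx S'.1.ctx) (s : Sub Γ S.1.ctx)
    (t : Term S'.1.ctx σ) : mk S' t ∷ mkEnv S s = mkEnv S' (Sub.cons t (s.comp e.sub)) :=
  Env.ext_cons rfl fun _ v => (mk_subst_ext e (s v)).symm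

theorem exists_eq_mkEnv (E : (termModel I).Env Γ) :
    ∃ (S : I) (s : Sub Γ S.1.ctx), E = mkEnv S s := by
  induction Γ with
  | nil =>
    exact ⟨Classical.arbitrary I, (fun _ v => nomatch v), by funext τ v; exact nomatch v⟩
  | cons σ Γ ih =>
    obtain ⟨S, s, hs⟩ := ih fun _ v => E (.s v)
    obtain ⟨S', e, t, ht⟩ := exists_eq_mk S (E .z)
    refine ⟨S', Sub.cons t (s.comp e.sub), ?_⟩
    rw [← cons_mkEnv, ← hs, ← ht]
    exact Env.ext_cons rfl fun _ _ => rfl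

theorem termModel_sat (hI : Generic I) (φ : Formula Γ) (S : I) (s : Sub Γ S.1.ctx) :
    Sat (mkEnv S s) φ ↔ Holds I (φ.subst s) := by
  induction φ generalizing S with
  | eq0 a b => simp only [Sat, termModel_eval, Formula.subst]; exact mk_nat_eq_mk_iff S _ _
  | bot => exact ⟨False.elim, not_holds_bot S⟩
  | and φ ψ h₁ h₂ => simp only [Sat, h₁, h₂, Formula.subst, holds_and_iff]
  | or φ ψ h₁ h₂ => simp only [Sat, h₁, h₂, Formula.subst, holds_or_iff hI]
  | imp φ ψ h₁ h₂ => simp only [Sat, h₁, h₂, Formula.subst, holds_imp_iff hI]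
  | all σ φ h =>
    simp only [Sat, Formula.subst]
    constructor
    · intro hs
      by_contra hn
      obtain ⟨S', e, t, ht⟩ := exists_of_not_holds_all hI S hn
      have hx := hs (mk S' t)
      rw [cons_mkEnv e, h] at hx
      exact ht (by rwa [Formula.subst_subst, Sub.lift_comp_cons])
    · intro ht x
      obtain ⟨S', e, t, rfl⟩ := exists_eq_mk S x
      have hx := ht.all_elim S e t
      rwa [Formula.subst_subst, Sub.lift_comp_cons, ← h, ← cons_mkEnv] at hx
  | ex σ φ h =>
    simp only [Sat, Formula.subst]
    constructor
    · rintro ⟨x, hx⟩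
      obtain ⟨S', e, t, rfl⟩ := exists_eq_mk S x
      rw [cons_mkEnv e, h, ← Sub.lift_comp_cons, ← Formula.subst_subst] at hx
      exact .ex_intro S' e t hx
    · intro ht
      obtain ⟨S', e, t, ht⟩ := ht.exists_of_ex hI S
      refine ⟨mk S' t, ?_⟩
      rwa [cons_mkEnv e, h, ← Sub.lift_comp_cons, ← Formula.subst_subst]

end Leibniz

/-- The structure `M` satisfies the formulas all of whose substitution instances are derivable, and
identifies the terms that are provably equal in all instances. -/
class Struct.IsModel (T : Theory) (M : Struct) : Prop where
  sat : ∀ {Γ : Ctx} {φ : Formula Γ}, T.Proves φ → ∀ e : M.Env Γ, Sat e φ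
  eval_eq : ∀ {Γ : Ctx} {τ : Ty} {a b : Term Γ τ},
    (∀ ⦃Δ : Ctx⦄ (s : Sub Γ Δ), Deriv T [] (eqTy τ (a.subst s) (b.subst s))) →
    ∀ e : M.Env Γ, eval e a = eval e b

theorem Struct.IsModel.mono {T' : Theory} {M : Struct} (h : M.IsModel T') (hT : T ≤ T') :
    M.IsModel T where
  sat hφ e := h.sat (fun _ s => (hφ s).mono_theory hT) e
  eval_eq hab e := h.eval_eq (fun _ s => (hab s).mono_theory hT) e

theorem termModel_isModel [T.HasEquality] {I : Order.Ideal (Stage T)} (hI : Generic I) :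
    (termModel I).IsModel T := by
  constructor
  · intro Γ φ h E
    obtain ⟨S, s, rfl⟩ := exists_eq_mkEnv E
    rw [termModel_sat hI]
    refine Theory.Proves.holds fun Δ s' => ?_
    rw [Formula.subst_subst]
    exact h _
  · intro Γ τ a b h E
    obtain ⟨S, s, rfl⟩ := exists_eq_mkEnv E
    rw [termModel_eval, termModel_eval]
    refine mk_eq_mk_of_deriv S fun Δ s' => ?_
    rw [Term.subst_subst, Term.subst_subst]
    exact h _

theorem completeness [T.HasEquality] (Δ : List (Formula Γ)) (φ : Formula Γ)
    (h : ∀ M : Struct, M.IsModel T → ∀ e : M.Env Γ, (∀ ψ ∈ Δ, Sat e ψ) → Sat e φ) :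
    Deriv T Δ φ := by
  by_contra hn
  let S₀ : Stage T := ⟨Γ, φ.neg :: Δ, fun h => hn (.by_contra h)⟩
  obtain ⟨I, hS, hI⟩ := exists_generic S₀
  let S : I := ⟨S₀, hS⟩
  have hsat : ∀ ψ ∈ φ.neg :: Δ, Sat (mkEnv S (Sub.id Γ)) ψ := by
    intro ψ hψ
    rw [termModel_sat hI, Formula.subst_id]
    refine holds_of_mem S (.refl _) ?_
    rwa [Ext.sub, Formula.subst_id]
  exact hsat φ.neg (.head _) (h _ (termModel_isModel hI) _ fun ψ hψ => hsat ψ (.tail _ hψ))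

end

/-! ## The ordered field of fractions of an ordered semiring -/

section Differences

open Algebra

variable {N : Type*} [CommSemiring N]

namespace Difference

/-- The additive map underlying the embedding `ofHom` of a semiring in its ring of differences. -/
def of : N →+ GrothendieckAddGroup N := GrothendieckAddGroup.of

theorem lift_of {A : Type*} [AddCommGroup A] (f : N →+ A) (a : N) :
    GrothendieckAddGroup.lift f (of a) = f a :=
  DFunLike.congr_fun (GrothendieckAddGroup.lift.symm_apply_apply f) a

theorem hom_ext {A : Type*} [AddCommGroup A] {f g : GrothendieckAddGroup N →+ A}
    (h : ∀ a, f (of a) = g (of a)) : f = g :=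
  GrothendieckAddGroup.lift.symm.injective (DFunLike.ext _ _ h)

theorem mk_eq_sub (a : N) (b : (⊤ : AddSubmonoid N)) :
    AddLocalization.mk a b = of a - of (b : N) := by
  simp [of, ← AddLocalization.mk_zero_eq_addMonoidOf_mk]

theorem exists_eq_sub (x : GrothendieckAddGroup N) : ∃ a b : N, x = of a - of b := by
  induction x using AddLocalization.induction_on with
  | H y => exact ⟨y.1, y.2, mk_eq_sub _ _⟩

/-- The biadditive extension of the multiplication of `N`. -/
noncomputable def mulHom :
    GrothendieckAddGroup N →+ GrothendieckAddGroup N →+ GrothendieckAddGroup N :=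
  GrothendieckAddGroup.lift
    { toFun a := GrothendieckAddGroup.lift (of.comp (AddMonoidHom.mulLeft a))
      map_zero' := hom_ext fun b => by simp [lift_of]
      map_add' a b := hom_ext fun c => by simp [lift_of, add_mul] }

noncomputable instance : NonUnitalNonAssocRing (GrothendieckAddGroup N) where
  mul x y := mulHom x y
  left_distrib x := map_add (mulHom x)
  right_distrib x y z := DFunLike.congr_fun (map_add mulHom x y) z
  zero_mul x := DFunLike.congr_fun (map_zero mulHom) x
  mul_zero x := map_zero (mulHom x)

theorem of_mul (a b : N) : of (a * b) = of a * of b := by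
  change _ = mulHom _ _
  rw [mulHom, lift_of]
  exact (lift_of (of.comp (AddMonoidHom.mulLeft a)) b).symm

noncomputable instance : CommRing (GrothendieckAddGroup N) where
  __ := (inferInstance : NonUnitalNonAssocRing (GrothendieckAddGroup N))
  one := of 1
  mul_assoc x y z := by
    obtain ⟨a, b, rfl⟩ := exists_eq_sub x
    obtain ⟨c, d, rfl⟩ := exists_eq_sub y
    obtain ⟨e, f, rfl⟩ := exists_eq_sub z
    simp only [sub_mul, mul_sub, ← of_mul, mul_assoc]
  one_mul x := by
    obtain ⟨a, b, rfl⟩ := exists_eq_sub x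
    change of 1 * _ = _
    simp only [mul_sub, ← of_mul, one_mul]
  mul_one x := by
    obtain ⟨a, b, rfl⟩ := exists_eq_sub x
    change _ * of 1 = _
    simp only [sub_mul, ← of_mul, mul_one]
  mul_comm x y := by
    obtain ⟨a, b, rfl⟩ := exists_eq_sub x
    obtain ⟨c, d, rfl⟩ := exists_eq_sub y
    simp only [sub_mul, mul_sub, ← of_mul, mul_comm]
    abel

variable (N) in
/-- The homomorphism from a semiring to its ring of differences. -/
def ofHom : N →+* GrothendieckAddGroup N where
  __ := of
  map_one' := rfl
  map_mul' := of_mul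

variable [LinearOrder N] [IsStrictOrderedRing N]

theorem ofHom_strictMono : StrictMono (ofHom N) := fun a b h => by
  change AddLocalization.mk a 0 < AddLocalization.mk b 0
  simpa [AddLocalization.mk_lt_mk] using h

theorem exists_pos_eq {x : GrothendieckAddGroup N} [ExistsAddOfLE N] (hx : 0 < x) :
    ∃ a : N, 0 < a ∧ x = ofHom N a := by
  obtain ⟨a, b, rfl⟩ := exists_eq_sub x
  have hba : b < a := ofHom_strictMono.lt_iff_lt.1 (sub_pos.1 hx)
  obtain ⟨c, hc, rfl⟩ := exists_pos_add_of_lt' hba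
  exact ⟨c, hc, by simp [ofHom]⟩

instance [ExistsAddOfLE N] : IsStrictOrderedRing (GrothendieckAddGroup N) :=
  haveI : Nontrivial (GrothendieckAddGroup N) := (ofHom_strictMono (N := N)).injective.nontrivial
  haveI : ZeroLEOneClass (GrothendieckAddGroup N) := ⟨by
    rw [← map_zero (ofHom N), ← map_one (ofHom N)]
    exact ofHom_strictMono.monotone zero_le_one⟩
  .of_mul_pos fun x y hx hy => by
    obtain ⟨a, ha, rfl⟩ := exists_pos_eq hx
    obtain ⟨b, hb, rfl⟩ := exists_pos_eq hy
    rw [← map_mul, ← map_zero (ofHom N)]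
    exact ofHom_strictMono (mul_pos ha hb)

end Difference
end Differences

section Fractions

variable (R : Type*) [CommRing R] [LinearOrder R] [IsStrictOrderedRing R]

/-- The nonnegative fractions of an ordered ring. -/
noncomputable def fracCone : RingCone (FractionRing R) where
  carrier := {x | ∃ a b : R, 0 ≤ a ∧ 0 < b ∧ x * algebraMap R _ b = algebraMap R _ a}
  zero_mem' := ⟨0, 1, le_rfl, one_pos, by simp⟩
  one_mem' := ⟨1, 1, zero_le_one, one_pos, by simp⟩
  add_mem' := by
    rintro x y ⟨a, b, ha, hb, h⟩ ⟨c, d, hc, hd, h'⟩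
    refine ⟨a * d + c * b, b * d, by positivity, by positivity, ?_⟩
    simp only [map_mul, map_add]
    linear_combination algebraMap R (FractionRing R) d * h + algebraMap R (FractionRing R) b * h'
  mul_mem' := by
    rintro x y ⟨a, b, ha, hb, h⟩ ⟨c, d, hc, hd, h'⟩
    refine ⟨a * c, b * d, by positivity, by positivity, ?_⟩
    simp only [map_mul]
    rw [← h, ← h']; ring
  eq_zero_of_mem_of_neg_mem' := by
    rintro x ⟨a, b, ha, hb, h⟩ ⟨c, d, hc, hd, h'⟩
    have hsum : a * d + c * b = 0 := by
      apply IsFractionRing.injective R (FractionRing R)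
      simp only [map_mul, map_add, map_zero]
      rw [← h, ← h']; ring
    have had : a * d = 0 := le_antisymm (by nlinarith [mul_nonneg hc hb.le]) (by positivity)
    rw [(mul_eq_zero.1 had).resolve_right hd.ne', map_zero, mul_eq_zero] at h
    refine h.resolve_right fun hb' => hb.ne' ?_
    exact IsFractionRing.injective R (FractionRing R) (hb'.trans (map_zero _).symm)

theorem mem_fracCone_or_neg_mem (x : FractionRing R) : x ∈ fracCone R ∨ -x ∈ fracCone R := by
  obtain ⟨a, b, hb, rfl⟩ := IsFractionRing.div_surjective (A := R) x
  have hb' : algebraMap R (FractionRing R) b ≠ 0 :=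
    IsFractionRing.to_map_ne_zero_of_mem_nonZeroDivisors hb
  rcases lt_or_gt_of_ne (nonZeroDivisors.ne_zero hb) with hb₁ | hb₁ <;>
    rcases le_total 0 a with ha | ha
  · exact .inr ⟨a, -b, ha, by linarith, by rw [map_neg]; field_simp⟩
  · exact .inl ⟨-a, -b, by linarith, by linarith, by rw [map_neg, map_neg]; field_simp⟩
  · exact .inl ⟨a, b, ha, hb₁, by field_simp⟩
  · exact .inr ⟨-a, b, by linarith, hb₁, by rw [map_neg]; field_simp⟩

noncomputable instance fracLinearOrder : LinearOrder (FractionRing R) :=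
  haveI : HasMemOrNegMem (fracCone R) := ⟨mem_fracCone_or_neg_mem R⟩
  letI := Classical.decPred (· ∈ fracCone R)
  LinearOrder.mkOfAddGroupCone (fracCone R)

instance fracIsOrderedRing : IsOrderedRing (FractionRing R) := IsOrderedRing.mkOfCone (fracCone R)

instance fracIsStrictOrderedRing : IsStrictOrderedRing (FractionRing R) :=
  .of_mul_pos fun _ _ hx hy =>
    lt_of_le_of_ne (mul_nonneg hx.le hy.le) (mul_ne_zero hx.ne' hy.ne').symm

theorem algebraMap_fractionRing_strictMono : StrictMono (algebraMap R (FractionRing R)) := by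
  intro a b h
  refine lt_of_le_of_ne ?_ fun h' => h.ne (IsFractionRing.injective R (FractionRing R) h')
  change _ - _ ∈ fracCone R
  exact ⟨b - a, 1, sub_nonneg.2 h.le, one_pos, by simp⟩

end Fractions

/-! ## Arithmetic in a model -/

namespace Struct

variable {M : Struct} {Γ : Ctx}

section Eval

variable {σ τ : Ty} (e : M.Env Γ)

@[simp] theorem eval_var_z (a : M.D σ) : eval (a ∷ e) (.var .z) = a := rfl

@[simp] theorem eval_var_s (a : M.D σ) (v : Var Γ τ) :
    eval (a ∷ e) (.var (.s v)) = eval e (.var v) := rfl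

@[simp] theorem eval_app (f : Term Γ (σ ⇾ τ)) (a : Term Γ σ) :
    eval e (f ⬝ a) = M.app (eval e f) (eval e a) := rfl

@[simp] theorem eval_cst (c : Const τ) : eval e (.cst c) = M.cst c := rfl

@[simp] theorem sat_eq0 (s t : Term Γ nat) : Sat e (eq0 s t) ↔ eval e s = eval e t := Iff.rfl

@[simp] theorem sat_and (φ ψ : Formula Γ) : Sat e (φ ⋏ ψ) ↔ Sat e φ ∧ Sat e ψ := Iff.rfl

@[simp] theorem sat_or (φ ψ : Formula Γ) : Sat e (φ ⋎ ψ) ↔ Sat e φ ∨ Sat e ψ := Iff.rfl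

@[simp] theorem sat_imp (φ ψ : Formula Γ) : Sat e (φ ⟹ ψ) ↔ (Sat e φ → Sat e ψ) := Iff.rfl

@[simp] theorem sat_neg (φ : Formula Γ) : Sat e φ.neg ↔ ¬ Sat e φ := Iff.rfl

@[simp] theorem sat_iff (φ ψ : Formula Γ) : Sat e (φ ⟺ ψ) ↔ (Sat e φ ↔ Sat e ψ) := iff_def.symm

@[simp] theorem sat_all (φ : Formula (σ :: Γ)) :
    Sat e (all σ φ) ↔ ∀ a : M.D σ, Sat (a ∷ e) φ := Iff.rfl

@[simp] theorem sat_ex (φ : Formula (σ :: Γ)) :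
    Sat e (ex σ φ) ↔ ∃ a : M.D σ, Sat (a ∷ e) φ := Iff.rfl

end Eval

/-- Recursion of type `0` in a structure: the value at `0` is `a`, and the value at `x + 1` is
obtained by applying `f` to the value at `x` and to `x`. -/
def recNat (n a : M.D nat) (f : M.D (nat ⇾ nat ⇾ nat)) : M.D nat :=
  M.app (M.app (M.app (M.cst (.recur [nat] .z)) n) a) f

theorem eval_natRec (e : M.Env Γ) (n a : Term Γ nat) (t : Term (nat :: nat :: Γ) nat) :
    eval e (natRec n a t) = recNat (eval e n) (eval e a) (eval e t.lam.lam) := rfl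

instance : Zero (M.D nat) := ⟨M.cst .zero⟩

instance : One (M.D nat) := ⟨M.app (M.cst .succ) 0⟩

instance : Add (M.D nat) :=
  ⟨fun x y => recNat y x (eval (M := M) Env.nil (succT v1).lam.lam)⟩

instance : Mul (M.D nat) := ⟨fun x y => recNat y 0 (eval (x ∷ Env.nil) (addT v1 v2).lam.lam)⟩

/-- The predecessor function of a structure, with value `0` at `0` in models. -/
def pred (x : M.D nat) : M.D nat := recNat x 0 (eval (M := M) Env.nil v0.lam.lam)

instance : _root_.Sub (M.D nat) :=
  ⟨fun x y => recNat y x (eval (M := M) Env.nil (predT v1).lam.lam)⟩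

/-- The function `x ↦ 2 ^ x` of a structure. -/
def pow2 (x : M.D nat) : M.D nat := recNat x 1 (eval (M := M) Env.nil (addT v1 v1).lam.lam)

@[simp] theorem eval_zeroT (e : M.Env Γ) : eval e zeroT = 0 := rfl

@[simp] theorem eval_oneT (e : M.Env Γ) : eval e oneT = 1 := rfl

section EvalClosedSteps

variable (e : M.Env Γ) (s t : Term Γ nat)

@[simp] theorem eval_predT : eval e (predT s) = pred (eval e s) := rfl

@[simp] theorem eval_addT : eval e (addT s t) = eval e s + eval e t := rfl

@[simp] theorem eval_monusT : eval e (monusT s t) = eval e s - eval e t := rfl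

@[simp] theorem eval_pow2T : eval e (pow2T s) = pow2 (eval e s) := rfl

end EvalClosedSteps

variable [M.IsModel FAxioms]

theorem app_proj {ρ τ : Ty} (x : M.D ρ) (y : M.D τ) :
    M.app (M.app (M.cst (.proj ρ τ)) x) y = x :=
  IsModel.eval_eq (T := FAxioms) (Γ := [ρ, τ]) (a := .cst (.proj ρ τ) ⬝ v0 ⬝ v1) (b := v0)
    (fun _ _ => .ax (.proj _ _)) (x ∷ y ∷ Env.nil)

theorem app_dist {δ ρ τ : Ty} (x : M.D (δ ⇾ ρ ⇾ τ)) (y : M.D (δ ⇾ ρ)) (u : M.D δ) :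
    M.app (M.app (M.app (M.cst (.dist δ ρ τ)) x) y) u = M.app (M.app x u) (M.app y u) :=
  IsModel.eval_eq (T := FAxioms) (Γ := [δ ⇾ ρ ⇾ τ, δ ⇾ ρ, δ])
    (a := .cst (.dist δ ρ τ) ⬝ v0 ⬝ v1 ⬝ v2) (b := v0 ⬝ v2 ⬝ (v1 ⬝ v2))
    (fun _ _ => .ax (.dist _ _ _)) (x ∷ y ∷ u ∷ Env.nil)

@[simp] theorem app_eval_lam {σ : Ty} (e : M.Env Γ) (x : M.D σ) :
    {τ : Ty} → (t : Term (σ :: Γ) τ) → M.app (eval e t.lam) x = eval (x ∷ e) t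
  | _, .var .z => by simp only [Term.lam, eval_app, eval_cst, app_dist, app_proj, eval_var_z]
  | _, .var (.s v) => by simp only [Term.lam, eval_app, eval_cst, app_proj, eval_var_s]
  | _, .cst c => by simp only [Term.lam, eval_app, eval_cst, app_proj]
  | _, .app f a => by
    simp only [Term.lam, eval_app, eval_cst, app_dist, app_eval_lam e x f, app_eval_lam e x a]

@[simp] theorem recNat_zero (a : M.D nat) (f : M.D (nat ⇾ nat ⇾ nat)) : recNat 0 a f = a :=
  IsModel.eval_eq (T := FAxioms) (Γ := [nat, nat ⇾ nat ⇾ nat])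
    (a := .cst (.recur [nat] .z) ⬝ zeroT ⬝ v0 ⬝ v1) (b := v0)
    (fun _ s => .ax (.recur_zero (l := [nat]) .z (Sub.cons (s .z) nofun)
      (Sub.cons (s (.s .z)) nofun))) (a ∷ f ∷ Env.nil)

theorem recNat_succ (n a : M.D nat) (f : M.D (nat ⇾ nat ⇾ nat)) :
    recNat (M.app (M.cst .succ) n) a f = M.app (M.app f (recNat n a f)) n :=
  IsModel.eval_eq (T := FAxioms) (Γ := [nat, nat, nat ⇾ nat ⇾ nat])
    (a := .cst (.recur [nat] .z) ⬝ succT v0 ⬝ v1 ⬝ v2)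
    (b := v2 ⬝ (.cst (.recur [nat] .z) ⬝ v0 ⬝ v1 ⬝ v2) ⬝ v0)
    (fun _ s => .ax (.recur_succ (l := [nat]) .z (s .z)
      (Sub.cons (s (.s .z)) nofun) (Sub.cons (s (.s (.s .z))) nofun))) (n ∷ a ∷ f ∷ Env.nil)

theorem app_succ (x : M.D nat) : M.app (M.cst .succ) x = x + 1 := by
  change _ = recNat (M.app (M.cst .succ) 0) x _
  rw [recNat_succ, recNat_zero, app_eval_lam, app_eval_lam]
  rfl

@[simp] theorem eval_succT (e : M.Env Γ) (t : Term Γ nat) : eval e (succT t) = eval e t + 1 :=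
  app_succ _

@[simp] theorem recNat_add_one (n a : M.D nat) (f : M.D (nat ⇾ nat ⇾ nat)) :
    recNat (n + 1) a f = M.app (M.app f (recNat n a f)) n := by
  rw [← app_succ, recNat_succ]

protected theorem add_one_ne_zero (x : M.D nat) : x + 1 ≠ 0 := by
  have h := IsModel.sat (T := FAxioms) (Γ := [nat]) (φ := (eq0 (succT v0) zeroT).neg)
    (fun _ _ => .ax (.succ_ne_zero _)) (x ∷ Env.nil)
  simpa using h

theorem eq_of_add_one_eq {x y : M.D nat} (hxy : x + 1 = y + 1) : x = y := by
  have h := IsModel.sat (T := FAxioms) (Γ := [nat, nat])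
    (φ := eq0 (succT v0) (succT v1) ⟹ eq0 v0 v1) (fun _ _ => .ax (.succ_inj _ _)) (x ∷ y ∷ Env.nil)
  simp only [sat_imp, sat_eq0, eval_succT, eval_var_z, eval_var_s] at h
  exact h hxy

theorem proves_induction (φ : Formula (nat :: Γ)) :
    FAxioms.Proves (φ.inst zeroT ⟹ all nat
      (φ ⟹ φ.subst (Sub.cons (succT v0) (fun _ v => .var (.s v)))) ⟹ all nat φ) := by
  intro Δ s
  have hs : (Sub.cons (succT v0) fun _ v => .var (.s v)).comp (s.lift nat) =
      (s.lift nat).comp (Sub.cons (succT v0) fun _ v => .var (.s v)) := by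
    refine Sub.ext fun τ v => ?_
    cases v with
    | z => rfl
    | s v =>
      have h := Term.subst_wk (σ := nat) (Sub.cons (succT v0) fun _ v => .var (.s v)) (s v)
      exact (Term.rename_eq_subst _ _).trans h.symm
  convert Deriv.ax (FAxioms.induction (φ.subst (s.lift nat))) using 1
  simp only [Formula.subst, Formula.inst_subst, Formula.subst_subst, hs]
  rfl

/-- The predicates on the objects of type `0` of a structure that are the extension of a formula
with parameters, and hence subject to the induction schema. -/
def Definable (p : M.D nat → Prop) : Prop :=
  ∃ (Γ : Ctx) (e : M.Env Γ) (φ : Formula (nat :: Γ)), ∀ x, Sat (x ∷ e) φ ↔ p x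

@[elab_as_elim]
theorem induction_on {p : M.D nat → Prop} (x : M.D nat) (definable : Definable p) (zero : p 0)
    (add_one : ∀ x, p x → p (x + 1)) : p x := by
  obtain ⟨Γ, e, φ, hφ⟩ := definable
  have h := IsModel.sat (proves_induction φ) e
  simp only [sat_imp, sat_all, sat_inst, sat_subst] at h
  refine (hφ x).1 (h ((hφ 0).2 zero) (fun x hx => ?_) x)
  convert (hφ (x + 1)).2 (add_one x ((hφ x).1 hx)) using 1
  rw [← app_succ]
  funext τ v
  cases v <;> rfl

theorem eq_zero_or_exists_add_one (x : M.D nat) : x = 0 ∨ ∃ y, x = y + 1 := by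
  induction x using induction_on with
  | definable => exact ⟨_, Env.nil, eq0 v0 zeroT ⋎ ex nat (eq0 v1 (succT v0)), fun _ => by simp⟩
  | zero => exact .inl rfl
  | add_one x => exact .inr ⟨x, rfl⟩

theorem recNat_congr (n a : M.D nat) {f g : M.D (nat ⇾ nat ⇾ nat)}
    (h : ∀ x y, M.app (M.app f x) y = M.app (M.app g x) y) : recNat n a f = recNat n a g := by
  induction n using induction_on with
  | definable => exact ⟨_, a ∷ f ∷ g ∷ Env.nil, eq0 (.cst (.recur [nat] .z) ⬝ v0 ⬝ v1 ⬝ v2)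
      (.cst (.recur [nat] .z) ⬝ v0 ⬝ v1 ⬝ v3), fun _ => Iff.rfl⟩
  | zero => rw [recNat_zero, recNat_zero]
  | add_one n ih => rw [recNat_add_one, recNat_add_one, ih, h]

theorem eval_natRec_eq (e : M.Env Γ) {n a : Term Γ nat} {t : Term (nat :: nat :: Γ) nat}
    {f : M.D (nat ⇾ nat ⇾ nat)} (h : ∀ x y, eval (y ∷ x ∷ e) t = M.app (M.app f x) y) :
    eval e (natRec n a t) = recNat (eval e n) (eval e a) f := by
  rw [eval_natRec]
  exact recNat_congr _ _ fun x y => by rw [app_eval_lam, app_eval_lam, h]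

theorem eval_natRec_congr {Δ : Ctx} {e : M.Env Γ} {e' : M.Env Δ} {n a : Term Γ nat}
    {n' a' : Term Δ nat} {t : Term (nat :: nat :: Γ) nat} {t' : Term (nat :: nat :: Δ) nat}
    (hn : eval e n = eval e' n') (ha : eval e a = eval e' a')
    (ht : ∀ x y, eval (y ∷ x ∷ e) t = eval (y ∷ x ∷ e') t') :
    eval e (natRec n a t) = eval e' (natRec n' a' t') := by
  rw [eval_natRec e', ← hn, ← ha]
  exact eval_natRec_eq e fun x y => by rw [app_eval_lam, app_eval_lam, ht]

theorem eval_natRec_succT (e : M.Env Γ) (n a : Term Γ nat) (t : Term (nat :: nat :: Γ) nat) :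
    eval e (natRec (succT n) a t) = eval (eval e n ∷ eval e (natRec n a t) ∷ e) t := by
  change recNat (M.app (M.cst .succ) (eval e n)) (eval e a) (eval e t.lam.lam) = _
  rw [app_succ, recNat_add_one, app_eval_lam, app_eval_lam, ← eval_natRec]

section EvalArithmetic

variable (e : M.Env Γ) (s t : Term Γ nat)

@[simp] theorem eval_mulT : eval e (mulT s t) = eval e s * eval e t :=
  eval_natRec_eq e fun x y => by simp

theorem eval_condT (c : Term Γ nat) [Decidable (eval e c = 0)] :
    eval e (condT c s t) = if eval e c = 0 then eval e s else eval e t := by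
  rw [condT, eval_natRec]
  rcases eq_zero_or_exists_add_one (eval e c) with h | ⟨y, h⟩
  · rw [if_pos h, h, recNat_zero]
  · rw [if_neg (h ▸ Struct.add_one_ne_zero y), h]
    simp

end EvalArithmetic

@[simp] theorem pred_zero : pred (0 : M.D nat) = 0 := recNat_zero _ _

@[simp] theorem pred_add_one (x : M.D nat) : pred (x + 1) = x := by
  simp only [pred, recNat_add_one, app_eval_lam, eval_var_z]

protected theorem sub_zero (x : M.D nat) : x - 0 = x := recNat_zero _ _

theorem sub_add_one (x y : M.D nat) : x - (y + 1) = pred (x - y) := by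
  change recNat (y + 1) x _ = _
  simp only [recNat_add_one, app_eval_lam, eval_predT, eval_var_z, eval_var_s]
  rfl

@[simp] theorem pow2_zero : pow2 (0 : M.D nat) = 1 := recNat_zero _ _

theorem pow2_add_one (x : M.D nat) : pow2 (x + 1) = pow2 x + pow2 x := by
  simp only [pow2, recNat_add_one, app_eval_lam, eval_addT, eval_var_z, eval_var_s]

section Semiring

variable (x y z : M.D nat)

protected theorem add_zero : x + 0 = x := recNat_zero _ _

theorem add_add_one : x + (y + 1) = x + y + 1 := by
  change recNat (y + 1) x _ = _
  simp only [recNat_add_one, app_eval_lam, eval_succT, eval_var_z, eval_var_s]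
  rfl

protected theorem mul_zero : x * 0 = 0 := recNat_zero _ _

theorem mul_add_one' : x * (y + 1) = x * y + x := by
  change recNat (y + 1) 0 _ = _
  simp only [recNat_add_one, app_eval_lam, eval_addT, eval_var_z, eval_var_s]
  rfl

protected theorem zero_add : 0 + x = x := by
  induction x using induction_on with
  | definable => exact ⟨_, Env.nil, eq0 (addT zeroT v0) v0, fun _ => by simp⟩
  | zero => exact Struct.add_zero 0
  | add_one x ih => rw [add_add_one, ih]

theorem add_one_add : x + 1 + y = x + y + 1 := by
  induction y using induction_on with
  | definable =>
    exact ⟨_, x ∷ Env.nil, eq0 (addT (succT v1) v0) (succT (addT v1 v0)), fun _ => by simp⟩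
  | zero => rw [Struct.add_zero, Struct.add_zero]
  | add_one y ih => rw [add_add_one, add_add_one, ih]

protected theorem add_comm : x + y = y + x := by
  induction y using induction_on with
  | definable => exact ⟨_, x ∷ Env.nil, eq0 (addT v1 v0) (addT v0 v1), fun _ => by simp⟩
  | zero => rw [Struct.add_zero, Struct.zero_add]
  | add_one y ih => rw [add_add_one, add_one_add, ih]

protected theorem add_assoc : x + y + z = x + (y + z) := by
  induction z using induction_on with
  | definable =>
    exact ⟨_, x ∷ y ∷ Env.nil, eq0 (addT (addT v1 v2) v0) (addT v1 (addT v2 v0)),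
      fun _ => by simp⟩
  | zero => rw [Struct.add_zero, Struct.add_zero]
  | add_one z ih => rw [add_add_one, add_add_one, add_add_one, ih]

protected theorem add_right_cancel (h : x + z = y + z) : x = y := by
  induction z using induction_on with
  | definable =>
    exact ⟨_, x ∷ y ∷ Env.nil, eq0 (addT v1 v0) (addT v2 v0) ⟹ eq0 v1 v2, fun _ => by simp⟩
  | zero => rwa [Struct.add_zero, Struct.add_zero] at h
  | add_one z ih => exact ih (eq_of_add_one_eq (by rwa [add_add_one, add_add_one] at h))

protected theorem zero_mul : 0 * x = 0 := by
  induction x using induction_on with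
  | definable => exact ⟨_, Env.nil, eq0 (mulT zeroT v0) zeroT, fun _ => by simp⟩
  | zero => exact Struct.mul_zero 0
  | add_one x ih => rw [mul_add_one', ih, Struct.add_zero]

theorem add_one_mul' : (x + 1) * y = x * y + y := by
  induction y using induction_on with
  | definable =>
    exact ⟨_, x ∷ Env.nil, eq0 (mulT (succT v1) v0) (addT (mulT v1 v0) v0), fun _ => by simp⟩
  | zero => rw [Struct.mul_zero, Struct.mul_zero, Struct.add_zero]
  | add_one y ih =>
    rw [mul_add_one', mul_add_one', ih, add_add_one, add_add_one,
      Struct.add_assoc (x * y) y, Struct.add_comm y, ← Struct.add_assoc]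

protected theorem mul_comm : x * y = y * x := by
  induction y using induction_on with
  | definable => exact ⟨_, x ∷ Env.nil, eq0 (mulT v1 v0) (mulT v0 v1), fun _ => by simp⟩
  | zero => rw [Struct.mul_zero, Struct.zero_mul]
  | add_one y ih => rw [mul_add_one', add_one_mul', ih]

protected theorem mul_add : x * (y + z) = x * y + x * z := by
  induction z using induction_on with
  | definable =>
    exact ⟨_, x ∷ y ∷ Env.nil, eq0 (mulT v1 (addT v2 v0)) (addT (mulT v1 v2) (mulT v1 v0)),
      fun _ => by simp⟩
  | zero => rw [Struct.add_zero, Struct.mul_zero, Struct.add_zero]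
  | add_one z ih => rw [add_add_one, mul_add_one', mul_add_one', ih, Struct.add_assoc]

protected theorem mul_assoc : x * y * z = x * (y * z) := by
  induction z using induction_on with
  | definable =>
    exact ⟨_, x ∷ y ∷ Env.nil, eq0 (mulT (mulT v1 v2) v0) (mulT v1 (mulT v2 v0)),
      fun _ => by simp⟩
  | zero => rw [Struct.mul_zero, Struct.mul_zero, Struct.mul_zero]
  | add_one z ih => rw [mul_add_one', mul_add_one', Struct.mul_add, ih]

protected theorem mul_one : x * 1 = x := by
  rw [← Struct.zero_add 1, mul_add_one', Struct.mul_zero, Struct.zero_add]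

instance : CommSemiring (M.D nat) where
  add_assoc := Struct.add_assoc
  zero_add := Struct.zero_add
  add_zero := Struct.add_zero
  add_comm := Struct.add_comm
  nsmul := nsmulRec
  left_distrib := Struct.mul_add
  right_distrib x y z := by
    rw [Struct.mul_comm, Struct.mul_add, Struct.mul_comm z, Struct.mul_comm z]
  zero_mul := Struct.zero_mul
  mul_zero := Struct.mul_zero
  mul_assoc := Struct.mul_assoc
  one_mul x := by rw [Struct.mul_comm, Struct.mul_one]
  mul_one := Struct.mul_one
  mul_comm := Struct.mul_comm

instance : IsRightCancelAdd (M.D nat) := ⟨fun z x y => Struct.add_right_cancel x y z⟩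

instance : IsCancelAdd (M.D nat) := AddCommMagma.IsRightCancelAdd.toIsCancelAdd _

instance : Nontrivial (M.D nat) :=
  ⟨0, 1, fun h => Struct.add_one_ne_zero (0 : M.D nat) (by rw [zero_add, ← h])⟩

end Semiring

section Order

theorem eq_zero_of_add_eq_zero {x y : M.D nat} (h : x + y = 0) : x = 0 := by
  rcases eq_zero_or_exists_add_one x with hx | ⟨z, rfl⟩
  · exact hx
  · rw [add_right_comm] at h
    exact (Struct.add_one_ne_zero _ h).elim

theorem exists_add_eq_or_exists_add_eq (x y : M.D nat) :
    (∃ z, x + z = y) ∨ ∃ z, y + z = x := by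
  induction y using induction_on with
  | definable =>
    exact ⟨_, x ∷ Env.nil, ex nat (eq0 (addT v2 v0) v1) ⋎ ex nat (eq0 (addT v1 v0) v2),
      fun _ => by simp⟩
  | zero => exact .inr ⟨x, zero_add x⟩
  | add_one y ih =>
    rcases ih with ⟨z, hz⟩ | ⟨z, hz⟩
    · exact .inl ⟨z + 1, by rw [← hz, add_assoc]⟩
    · rcases eq_zero_or_exists_add_one z with rfl | ⟨w, rfl⟩
      · exact .inl ⟨1, by rw [← hz, add_zero]⟩
      · exact .inr ⟨w, by rw [← hz]; ring⟩

noncomputable instance : LinearOrder (M.D nat) where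
  le x y := ∃ z, x + z = y
  le_refl x := ⟨0, add_zero x⟩
  le_trans := by
    rintro x y z ⟨a, rfl⟩ ⟨b, rfl⟩
    exact ⟨a + b, (add_assoc _ _ _).symm⟩
  le_antisymm := by
    rintro x y ⟨a, rfl⟩ ⟨b, h⟩
    rw [add_assoc] at h
    rw [eq_zero_of_add_eq_zero (add_eq_left.1 h), add_zero]
  le_total := exists_add_eq_or_exists_add_eq
  toDecidableLE := Classical.decRel _

variable {x y : M.D nat}

theorem le_def : x ≤ y ↔ ∃ z, x + z = y := Iff.rfl

instance : ExistsAddOfLE (M.D nat) := ⟨fun ⟨z, h⟩ => ⟨z, h.symm⟩⟩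

theorem lt_def : x < y ↔ ∃ z, x + z + 1 = y := by
  constructor
  · intro h
    obtain ⟨z, hz⟩ := h.le
    rcases eq_zero_or_exists_add_one z with rfl | ⟨w, rfl⟩
    · exact (h.ne (by rw [← hz, add_zero])).elim
    · exact ⟨w, by rw [← hz, add_assoc]⟩
  · rintro ⟨z, rfl⟩
    refine lt_of_le_of_ne ⟨z + 1, (add_assoc _ _ _).symm⟩ fun h => ?_
    rw [add_assoc] at h
    exact Struct.add_one_ne_zero z (left_eq_add.1 h)

instance : IsOrderedRing (M.D nat) where
  add_le_add_left := by
    rintro x y ⟨z, rfl⟩ w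
    exact ⟨z, by ring⟩
  zero_le_one := ⟨1, zero_add 1⟩
  mul_le_mul_of_nonneg_left := by
    rintro w _ x y ⟨z, rfl⟩
    exact ⟨w * z, by ring⟩
  mul_le_mul_of_nonneg_right := by
    rintro w _ x y ⟨z, rfl⟩
    exact ⟨z * w, by ring⟩

instance : IsStrictOrderedRing (M.D nat) where
  le_of_add_le_add_left := by
    rintro x y z ⟨w, h⟩
    exact ⟨w, add_left_cancel (a := x) (by rw [← add_assoc, h])⟩
  exists_pair_ne := ⟨0, 1, zero_ne_one⟩
  mul_lt_mul_of_pos_left := by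
    intro w hw x y h
    obtain ⟨v, rfl⟩ := lt_def.1 hw
    obtain ⟨z, rfl⟩ := lt_def.1 h
    exact lt_def.2 ⟨v * z + v + z, by ring⟩
  mul_lt_mul_of_pos_right := by
    intro w hw x y h
    obtain ⟨v, rfl⟩ := lt_def.1 hw
    obtain ⟨z, rfl⟩ := lt_def.1 h
    exact lt_def.2 ⟨v * z + v + z, by ring⟩

instance : CanonicallyOrderedAdd (M.D nat) where
  le_self_add _ y := ⟨y, rfl⟩
  le_add_self _ y := ⟨y, add_comm _ y⟩

theorem add_one_le_iff_lt : x + 1 ≤ y ↔ x < y := by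
  rw [lt_def, le_def]
  exact exists_congr fun z => by rw [add_right_comm]

noncomputable instance : SuccAddOrder (M.D nat) where
  __ := SuccOrder.ofSuccLeIff (· + 1) add_one_le_iff_lt
  succ_eq_add_one _ := rfl

theorem pred_le_iff : pred x ≤ y ↔ x ≤ y + 1 := by
  rcases eq_zero_or_exists_add_one x with rfl | ⟨w, rfl⟩
  · simp only [pred_zero, zero_le]
  · rw [pred_add_one, add_le_add_iff_right]

theorem sub_le_iff_le_add (x y z : M.D nat) : x - y ≤ z ↔ x ≤ z + y := by
  induction y using induction_on generalizing z with
  | definable =>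
    exact ⟨_, x ∷ Env.nil, all nat (ex nat (eq0 (addT (monusT v3 v2) v0) v1) ⟺
      ex nat (eq0 (addT v3 v0) (addT v1 v2))), fun _ => by simp [le_def]⟩
  | zero => rw [Struct.sub_zero, add_zero]
  | add_one y ih => rw [sub_add_one, pred_le_iff, ih, add_right_comm, add_assoc]

instance : OrderedSub (M.D nat) := ⟨sub_le_iff_le_add⟩

@[simp] theorem sat_le0 (e : M.Env Γ) (s t : Term Γ nat) :
    Sat e (le0 s t) ↔ eval e s ≤ eval e t := by
  rw [le0, sat_eq0, eval_monusT, eval_zeroT, tsub_eq_zero_iff_le]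

theorem eval_ltT_eq_zero (e : M.Env Γ) (s t : Term Γ nat) :
    eval e (ltT s t) = 0 ↔ eval e s < eval e t := by
  rw [ltT, eval_monusT, eval_monusT, tsub_eq_zero_iff_le, eval_oneT, Order.one_le_iff_pos,
    tsub_pos_iff_lt]

theorem lt_pow2 (x : M.D nat) : x < pow2 x := by
  induction x using induction_on with
  | definable =>
    exact ⟨_, Env.nil, le0 (succT v0) (pow2T v0), fun _ => by simp⟩
  | zero => exact pow2_zero (M := M) ▸ zero_lt_one
  | add_one x ih =>
    rw [pow2_add_one]
    exact add_lt_add_of_lt_of_le ih (Order.one_le_iff_pos.2 (pos_of_gt ih))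

theorem pow2_pos (x : M.D nat) : 0 < pow2 x := pos_of_gt (lt_pow2 x)

end Order

end Struct

namespace Struct

variable {M : Struct} {Γ : Ctx}

/-! ## Pairing -/

/-- The triangular number `0 + 1 + ⋯ + x` in a structure. -/
def tri (x : M.D nat) : M.D nat :=
  recNat x 0 (eval (M := M) Env.nil (addT v1 (succT v0)).lam.lam)

/-- The Cantor pairing in a structure. -/
def pair (a b : M.D nat) : M.D nat := tri (a + b) + a

/-- The `i`-th component of the simultaneous recursion with two components of type `0`, both of
which start at `0`. -/
def recPair (i : Var [nat, nat] nat) (n : M.D nat) (f g : M.D (nat ⇾ nat ⇾ nat ⇾ nat)) : M.D nat :=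
  M.app (M.app (M.app (M.app (M.app (M.cst (.recur [nat, nat] i)) n) 0) 0) f) g

/-- The first component of the Cantor unpairing in a structure. -/
def unpairFst (n : M.D nat) : M.D nat :=
  recPair .z n (eval Env.nil (unpairSteps .z)) (eval Env.nil (unpairSteps (.s .z)))

/-- The second component of the Cantor unpairing in a structure. -/
def unpairSnd (n : M.D nat) : M.D nat :=
  recPair (.s .z) n (eval Env.nil (unpairSteps .z)) (eval Env.nil (unpairSteps (.s .z)))

theorem eval_triT (e : M.Env Γ) (t : Term Γ nat) :
    eval e (natRec t zeroT (addT v1 (succT v0))) = tri (eval e t) := rfl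

theorem eval_pairT (e : M.Env Γ) (s t : Term Γ nat) :
    eval e (pairT s t) = pair (eval e s) (eval e t) := rfl

variable [M.IsModel FAxioms]

theorem tri_zero : tri (0 : M.D nat) = 0 := recNat_zero _ _

theorem tri_add_one (x : M.D nat) : tri (x + 1) = tri x + (x + 1) := by
  simp only [tri, recNat_add_one, app_eval_lam, eval_addT, eval_succT, eval_var_z, eval_var_s]

section RecPair

variable (n : M.D nat) (f g : M.D (nat ⇾ nat ⇾ nat ⇾ nat))

theorem recPair_fst_zero : recPair .z 0 f g = 0 :=
  IsModel.eval_eq (T := FAxioms) (Γ := [nat ⇾ nat ⇾ nat ⇾ nat, nat ⇾ nat ⇾ nat ⇾ nat])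
    (a := .cst (.recur [nat, nat] .z) ⬝ zeroT ⬝ zeroT ⬝ zeroT ⬝ v0 ⬝ v1) (b := zeroT)
    (fun _ s => .ax (.recur_zero (l := [nat, nat]) .z unpairStart
      (Sub.cons (s .z) (Sub.cons (s (.s .z)) nofun)))) (f ∷ g ∷ Env.nil)

theorem recPair_snd_zero : recPair (.s .z) 0 f g = 0 :=
  IsModel.eval_eq (T := FAxioms) (Γ := [nat ⇾ nat ⇾ nat ⇾ nat, nat ⇾ nat ⇾ nat ⇾ nat])
    (a := .cst (.recur [nat, nat] (.s .z)) ⬝ zeroT ⬝ zeroT ⬝ zeroT ⬝ v0 ⬝ v1) (b := zeroT)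
    (fun _ s => .ax (.recur_zero (l := [nat, nat]) (.s .z) unpairStart
      (Sub.cons (s .z) (Sub.cons (s (.s .z)) nofun)))) (f ∷ g ∷ Env.nil)

theorem recPair_fst_add_one : recPair .z (n + 1) f g =
    M.app (M.app (M.app f (recPair .z n f g)) (recPair (.s .z) n f g)) n := by
  rw [← app_succ]
  exact IsModel.eval_eq (T := FAxioms)
    (Γ := [nat, nat ⇾ nat ⇾ nat ⇾ nat, nat ⇾ nat ⇾ nat ⇾ nat])
    (a := .cst (.recur [nat, nat] .z) ⬝ succT v0 ⬝ zeroT ⬝ zeroT ⬝ v1 ⬝ v2)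
    (b := v1 ⬝ (.cst (.recur [nat, nat] .z) ⬝ v0 ⬝ zeroT ⬝ zeroT ⬝ v1 ⬝ v2) ⬝
      (.cst (.recur [nat, nat] (.s .z)) ⬝ v0 ⬝ zeroT ⬝ zeroT ⬝ v1 ⬝ v2) ⬝ v0)
    (fun _ s => .ax (.recur_succ (l := [nat, nat]) .z (s .z) unpairStart
      (Sub.cons (s (.s .z)) (Sub.cons (s (.s (.s .z))) nofun)))) (n ∷ f ∷ g ∷ Env.nil)

theorem recPair_snd_add_one : recPair (.s .z) (n + 1) f g =
    M.app (M.app (M.app g (recPair .z n f g)) (recPair (.s .z) n f g)) n := by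
  rw [← app_succ]
  exact IsModel.eval_eq (T := FAxioms)
    (Γ := [nat, nat ⇾ nat ⇾ nat ⇾ nat, nat ⇾ nat ⇾ nat ⇾ nat])
    (a := .cst (.recur [nat, nat] (.s .z)) ⬝ succT v0 ⬝ zeroT ⬝ zeroT ⬝ v1 ⬝ v2)
    (b := v2 ⬝ (.cst (.recur [nat, nat] .z) ⬝ v0 ⬝ zeroT ⬝ zeroT ⬝ v1 ⬝ v2) ⬝
      (.cst (.recur [nat, nat] (.s .z)) ⬝ v0 ⬝ zeroT ⬝ zeroT ⬝ v1 ⬝ v2) ⬝ v0)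
    (fun _ s => .ax (.recur_succ (l := [nat, nat]) (.s .z) (s .z) unpairStart
      (Sub.cons (s (.s .z)) (Sub.cons (s (.s (.s .z))) nofun)))) (n ∷ f ∷ g ∷ Env.nil)

variable {f g} in
theorem recPair_congr {f' g' : M.D (nat ⇾ nat ⇾ nat ⇾ nat)}
    (hf : ∀ x y z, M.app (M.app (M.app f x) y) z = M.app (M.app (M.app f' x) y) z)
    (hg : ∀ x y z, M.app (M.app (M.app g x) y) z = M.app (M.app (M.app g' x) y) z) :
    recPair .z n f g = recPair .z n f' g' ∧ recPair (.s .z) n f g = recPair (.s .z) n f' g' := by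
  induction n using induction_on with
  | definable =>
    exact ⟨_, f ∷ g ∷ f' ∷ g' ∷ Env.nil,
      eq0 (.cst (.recur [nat, nat] .z) ⬝ v0 ⬝ zeroT ⬝ zeroT ⬝ v1 ⬝ v2)
        (.cst (.recur [nat, nat] .z) ⬝ v0 ⬝ zeroT ⬝ zeroT ⬝ v3 ⬝ v4) ⋏
      eq0 (.cst (.recur [nat, nat] (.s .z)) ⬝ v0 ⬝ zeroT ⬝ zeroT ⬝ v1 ⬝ v2)
        (.cst (.recur [nat, nat] (.s .z)) ⬝ v0 ⬝ zeroT ⬝ zeroT ⬝ v3 ⬝ v4), fun _ => Iff.rfl⟩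
  | zero => simp only [recPair_fst_zero, recPair_snd_zero, and_self]
  | add_one n ih =>
    simp only [recPair_fst_add_one, recPair_snd_add_one, ih.1, ih.2, hf, hg, and_self]

end RecPair

theorem app_unpairSteps_fst (e : M.Env Γ) (a b n : M.D nat) :
    M.app (M.app (M.app (eval e (unpairSteps .z)) a) b) n = if b = 0 then 0 else a + 1 := by
  change M.app (M.app (M.app (eval e (Term.lam (Term.lam (Term.lam
    (condT v1 zeroT (succT v2)))))) a) b) n = _
  rw [app_eval_lam, app_eval_lam, app_eval_lam, eval_condT]
  simp only [eval_var_z, eval_var_s, eval_zeroT, eval_succT]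

theorem app_unpairSteps_snd (e : M.Env Γ) (a b n : M.D nat) :
    M.app (M.app (M.app (eval e (unpairSteps (.s .z))) a) b) n =
      if b = 0 then a + 1 else pred b := by
  change M.app (M.app (M.app (eval e (Term.lam (Term.lam (Term.lam
    (condT v1 (succT v2) (predT v1)))))) a) b) n = _
  rw [app_eval_lam, app_eval_lam, app_eval_lam, eval_condT]
  simp only [eval_var_z, eval_var_s, eval_predT, eval_succT]

@[simp] theorem eval_fstT (e : M.Env Γ) (t : Term Γ nat) :
    eval e (fstT t) = unpairFst (eval e t) :=
  (recPair_congr _ (fun x y z =>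
    (app_unpairSteps_fst e x y z).trans (app_unpairSteps_fst _ x y z).symm) fun x y z =>
    (app_unpairSteps_snd e x y z).trans (app_unpairSteps_snd _ x y z).symm).1

@[simp] theorem eval_sndT (e : M.Env Γ) (t : Term Γ nat) :
    eval e (sndT t) = unpairSnd (eval e t) :=
  (recPair_congr _ (fun x y z =>
    (app_unpairSteps_fst e x y z).trans (app_unpairSteps_fst _ x y z).symm) fun x y z =>
    (app_unpairSteps_snd e x y z).trans (app_unpairSteps_snd _ x y z).symm).2

theorem unpairFst_add_one (n : M.D nat) :
    unpairFst (n + 1) = if unpairSnd n = 0 then 0 else unpairFst n + 1 := by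
  rw [unpairFst, recPair_fst_add_one, app_unpairSteps_fst]; rfl

theorem unpairSnd_add_one (n : M.D nat) :
    unpairSnd (n + 1) = if unpairSnd n = 0 then unpairFst n + 1 else pred (unpairSnd n) := by
  rw [unpairSnd, recPair_snd_add_one, app_unpairSteps_snd]; rfl

theorem unpair_tri_add {s a : M.D nat} (ha : a ≤ s)
    (hs : unpairFst (tri s) = 0 ∧ unpairSnd (tri s) = s) :
    unpairFst (tri s + a) = a ∧ unpairSnd (tri s + a) + a = s := by
  induction a using induction_on with
  | definable =>
    exact ⟨_, tri s ∷ s ∷ Env.nil, le0 v0 v2 ⟹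
      eq0 (fstT (addT v1 v0)) v0 ⋏ eq0 (addT (sndT (addT v1 v0)) v0) v2, fun _ => by simp⟩
  | zero => simpa using hs
  | add_one a ih =>
    have hlt := add_one_le_iff_lt.1 ha
    obtain ⟨hfst, hsnd⟩ := ih hlt.le
    have hne : unpairSnd (tri s + a) ≠ 0 := fun h => hlt.ne (by rwa [h, zero_add] at hsnd)
    obtain ⟨y, hy⟩ := (eq_zero_or_exists_add_one _).resolve_left hne
    rw [← add_assoc, unpairFst_add_one, unpairSnd_add_one, if_neg hne, if_neg hne, hfst]
    refine ⟨rfl, ?_⟩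
    rw [hy] at hsnd ⊢
    rw [pred_add_one, ← add_assoc, add_right_comm, hsnd]

theorem unpair_tri (s : M.D nat) : unpairFst (tri s) = 0 ∧ unpairSnd (tri s) = s := by
  induction s using induction_on with
  | definable =>
    exact ⟨_, Env.nil, eq0 (fstT (natRec v0 zeroT (addT v1 (succT v0)))) zeroT ⋏
      eq0 (sndT (natRec v0 zeroT (addT v1 (succT v0)))) v0, fun _ => by simp [eval_triT]⟩
  | zero => rw [tri_zero]; exact ⟨recPair_fst_zero _ _, recPair_snd_zero _ _⟩
  | add_one s ih =>
    obtain ⟨hfst, hsnd⟩ := unpair_tri_add le_rfl ih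
    rw [add_eq_right] at hsnd
    rw [tri_add_one, ← add_assoc, unpairFst_add_one, unpairSnd_add_one, if_pos hsnd, if_pos hsnd,
      hfst]
    exact ⟨rfl, rfl⟩

theorem unpairFst_pair (a b : M.D nat) : unpairFst (pair a b) = a :=
  (unpair_tri_add le_self_add (unpair_tri (a + b))).1

theorem unpairSnd_pair (a b : M.D nat) : unpairSnd (pair a b) = b :=
  add_right_cancel ((unpair_tri_add le_self_add (unpair_tri (a + b))).2.trans (add_comm a b))

/-! ## Rational numbers -/

variable (M) in
/-- The ordered field of fractions of the natural numbers of a model, in which the rationals of the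
model are evaluated. -/
abbrev FractionField : Type := FractionRing (Algebra.GrothendieckAddGroup (M.D nat))

/-- The embedding of the natural numbers of a model into its field of fractions. -/
noncomputable def cast : M.D nat →+* M.FractionField :=
  (algebraMap (Algebra.GrothendieckAddGroup (M.D nat)) M.FractionField).comp
    (Difference.ofHom (M.D nat))

theorem cast_strictMono : StrictMono (cast (M := M)) :=
  (algebraMap_fractionRing_strictMono _).comp Difference.ofHom_strictMono

theorem cast_nonneg (x : M.D nat) : 0 ≤ cast x := by
  rw [← map_zero cast]
  exact cast_strictMono.monotone zero_le

theorem cast_le {x y : M.D nat} : cast x ≤ cast y ↔ x ≤ y := cast_strictMono.le_iff_le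

theorem cast_lt {x y : M.D nat} : cast x < cast y ↔ x < y := cast_strictMono.lt_iff_lt

theorem cast_sub (x y : M.D nat) : cast (x - y) = max (cast x - cast y) 0 := by
  rcases le_total x y with h | h
  · rw [tsub_eq_zero_iff_le.2 h, map_zero, max_eq_right (sub_nonpos.2 (cast_le.2 h))]
  · rw [max_eq_left (sub_nonneg.2 (cast_le.2 h)), eq_sub_iff_add_eq, ← map_add,
      tsub_add_cancel_of_le h]

theorem cast_pred {x : M.D nat} (h : x ≠ 0) : cast (pred x) + 1 = cast x := by
  obtain ⟨y, rfl⟩ := (eq_zero_or_exists_add_one x).resolve_left h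
  rw [pred_add_one, map_add, map_one]

/-- The fraction `2⁻ⁿ`. -/
noncomputable def eps (n : M.D nat) : M.FractionField := (cast (pow2 n))⁻¹

theorem eps_pos (n : M.D nat) : 0 < eps n :=
  inv_pos.2 ((map_zero cast).symm.trans_lt (cast_strictMono (pow2_pos n)))

theorem eps_add_one (n : M.D nat) : eps (n + 1) = eps n / 2 := by
  rw [eps, eps, pow2_add_one, map_add, ← two_mul, mul_inv, div_eq_inv_mul]

/-- The fraction coded by a natural number. -/
noncomputable def qval (q : M.D nat) : M.FractionField :=
  (cast (unpairFst (unpairFst q)) - cast (unpairSnd (unpairFst q))) / (cast (unpairSnd q) + 1)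

theorem cast_add_one_pos (x : M.D nat) : 0 < cast x + 1 :=
  add_pos_of_nonneg_of_pos (cast_nonneg x) one_pos

section Rationals

variable (e : M.Env Γ)

theorem qval_qCode (a b d : Term Γ nat) : qval (eval e (qCode a b d)) =
    (cast (eval e a) - cast (eval e b)) / (cast (eval e d) + 1) := by
  rw [qCode, eval_pairT, eval_pairT, qval, unpairFst_pair, unpairSnd_pair, unpairFst_pair,
    unpairSnd_pair]

@[simp] theorem qval_qOne : qval (eval e (qOne : Term Γ nat)) = 1 := by
  simp [qOne, qval_qCode]

@[simp] theorem qval_qZero : qval (eval e (qZero : Term Γ nat)) = 0 := by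
  simp [qZero, qval_qCode]

@[simp] theorem qval_qPow (n : Term Γ nat) : qval (eval e (qPow n)) = eps (eval e n) := by
  rw [qPow, qval_qCode, eval_predT, eval_pow2T, cast_pred (pow2_pos _).ne', eval_zeroT, eval_oneT,
    map_zero, map_one, sub_zero, one_div, eps]

@[simp] theorem qval_qNeg (q : Term Γ nat) : qval (eval e (qNeg q)) = -qval (eval e q) := by
  rw [qNeg, qval_qCode, qNegPart, qPos, qval, eval_fstT, eval_sndT, eval_fstT, eval_sndT,
    ← neg_div, neg_sub]

@[simp] theorem qval_qAdd (p q : Term Γ nat) :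
    qval (eval e (qAdd p q)) = qval (eval e p) + qval (eval e q) := by
  have hp := cast_add_one_pos (unpairSnd (eval e p))
  have hq := cast_add_one_pos (unpairSnd (eval e q))
  have hne : (unpairSnd (eval e p) + 1) * (unpairSnd (eval e q) + 1) ≠ 0 :=
    mul_ne_zero (Struct.add_one_ne_zero _) (Struct.add_one_ne_zero _)
  rw [qAdd, qval_qCode]
  simp only [qval, qPos, qNegPart, qDen, eval_predT, eval_mulT, eval_addT,
    eval_succT, eval_fstT, eval_sndT, cast_pred hne, map_add, map_mul, map_one]
  field_simp
  ring

@[simp] theorem qval_qSub (p q : Term Γ nat) :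
    qval (eval e (qSub p q)) = qval (eval e p) - qval (eval e q) := by
  rw [qSub, qval_qAdd, qval_qNeg, sub_eq_add_neg]

@[simp] theorem qval_qAbs (q : Term Γ nat) : qval (eval e (qAbs q)) = |qval (eval e q)| := by
  rw [qAbs, qval_qCode, qval, abs_div, abs_of_pos (cast_add_one_pos _)]
  simp only [qPos, qNegPart, eval_addT, eval_monusT, eval_zeroT, eval_fstT,
    eval_sndT, map_add, map_zero, cast_sub, sub_zero]
  generalize cast (unpairFst (unpairFst (eval e q))) = a
  generalize cast (unpairSnd (unpairFst (eval e q))) = b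
  congr 1
  rcases le_total a b with h | h
  · rw [max_eq_right (sub_nonpos.2 h), max_eq_left (sub_nonneg.2 h), zero_add, abs_sub_comm,
      abs_of_nonneg (sub_nonneg.2 h)]
  · rw [max_eq_right (sub_nonpos.2 h), max_eq_left (sub_nonneg.2 h), add_zero,
      abs_of_nonneg (sub_nonneg.2 h)]

theorem eval_qLtT_eq_zero (p q : Term Γ nat) :
    eval e (qLtT p q) = 0 ↔ qval (eval e p) < qval (eval e q) := by
  rw [qLtT, eval_ltT_eq_zero, ← cast_lt, qval, qval,
    div_lt_div_iff₀ (cast_add_one_pos _) (cast_add_one_pos _)]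
  simp only [qPos, qNegPart, qDen, eval_addT, eval_mulT, eval_succT, eval_fstT, eval_sndT, map_add,
    map_mul, map_one]
  rw [← sub_pos, ← sub_pos (b := _ * _)]
  ring_nf

theorem eval_qLtT (p q : Term Γ nat) [Decidable (qval (eval e p) < qval (eval e q))] :
    eval e (qLtT p q) = if qval (eval e p) < qval (eval e q) then 0 else 1 := by
  split_ifs with h
  · exact (eval_qLtT_eq_zero e p q).2 h
  · rw [← eval_qLtT_eq_zero] at h
    exact tsub_le_self.antisymm (Order.one_le_iff_pos.2 (pos_iff_ne_zero.2 h))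

@[simp] theorem sat_qLt (p q : Term Γ nat) :
    Sat e (qLt p q) ↔ qval (eval e p) < qval (eval e q) := eval_qLtT_eq_zero e p q

@[simp] theorem sat_qLe (p q : Term Γ nat) :
    Sat e (qLe p q) ↔ qval (eval e p) ≤ qval (eval e q) := by
  rw [qLe, sat_neg, sat_qLt, not_lt]

end Rationals

/-! ## Real numbers -/

/-- The value of `badT` in a structure. -/
def bad (f : M.D (nat ⇾ nat)) (n : M.D nat) : M.D nat := eval (n ∷ f ∷ Env.nil) (badT v1 v0)

/-- The value of `hat` in a structure: the `n`-th member of the fast Cauchy sequence attached to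
`f`. -/
def hatVal (f : M.D (nat ⇾ nat)) (n : M.D nat) : M.D nat := eval (n ∷ f ∷ Env.nil) (hat v1 v0)

section Hat

variable (e : M.Env Γ) (f : Term Γ (nat ⇾ nat)) (n : Term Γ nat)

@[simp] theorem eval_badT : eval e (badT f n) = bad (eval e f) (eval e n) :=
  eval_natRec_congr rfl rfl fun x y => by simp [eval_qLtT]

@[simp] theorem eval_hat : eval e (hat f n) = hatVal (eval e f) (eval e n) :=
  eval_natRec_congr rfl rfl fun x y => by simp [eval_condT]

end Hat

theorem bad_zero (f : M.D (nat ⇾ nat)) : bad f 0 = 0 := recNat_zero _ _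

theorem bad_add_one (f : M.D (nat ⇾ nat)) (n : M.D nat) : bad f (n + 1) = bad f n +
    if |qval (M.app f n) - qval (M.app f (n + 1))| < eps (n + 1) then 0 else 1 := by
  calc bad f (n + 1) = eval (n ∷ f ∷ Env.nil) (badT v1 (succT v0)) := by simp
    _ = eval (n ∷ bad f n ∷ n ∷ f ∷ Env.nil) (addT v1 (qLtT
        (qAbs (qSub (v3 ⬝ v0) (v3 ⬝ succT v0))) (qPow (succT v0)))) := eval_natRec_succT ..
    _ = _ := by simp [eval_qLtT]

@[simp] theorem hatVal_zero (f : M.D (nat ⇾ nat)) : hatVal f 0 = M.app f 0 := recNat_zero _ _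

theorem hatVal_add_one (f : M.D (nat ⇾ nat)) (n : M.D nat) :
    hatVal f (n + 1) = if bad f (n + 1) = 0 then M.app f (n + 1) else hatVal f n := by
  calc hatVal f (n + 1) = eval (n ∷ f ∷ Env.nil) (hat v1 (succT v0)) := by simp
    _ = eval (n ∷ hatVal f n ∷ n ∷ f ∷ Env.nil)
        (condT (badT v3 (succT v0)) (v3 ⬝ succT v0) v1) := eval_natRec_succT ..
    _ = _ := by simp [eval_condT]

theorem hatVal_eq_of_bad_eq_zero {f : M.D (nat ⇾ nat)} {n : M.D nat} (h : bad f n = 0) :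
    hatVal f n = M.app f n := by
  rcases eq_zero_or_exists_add_one n with rfl | ⟨y, rfl⟩
  · exact hatVal_zero f
  · rw [hatVal_add_one, if_pos h]

theorem abs_hatVal_sub_hatVal_add_one_lt (f : M.D (nat ⇾ nat)) (n : M.D nat) :
    |qval (hatVal f n) - qval (hatVal f (n + 1))| < eps (n + 1) := by
  rw [hatVal_add_one]
  split_ifs with h
  · rw [bad_add_one, add_eq_zero] at h
    rw [hatVal_eq_of_bad_eq_zero h.1]
    by_contra hlt
    exact one_ne_zero ((if_neg hlt).symm.trans h.2)
  · rw [sub_self, abs_zero]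
    exact eps_pos _

theorem hatVal_of_const {f : M.D (nat ⇾ nat)} {c : M.D nat} (h : ∀ n, M.app f n = c)
    (n : M.D nat) : hatVal f n = c := by
  induction n using induction_on with
  | definable => exact ⟨_, f ∷ c ∷ Env.nil, eq0 (hat v1 v0) v2, fun _ => by simp⟩
  | zero => rw [hatVal_zero, h]
  | add_one n ih => rw [hatVal_add_one, h, ih, ite_self]

theorem hatVal_of_fast {f : M.D (nat ⇾ nat)}
    (h : ∀ n, |qval (M.app f n) - qval (M.app f (n + 1))| < eps (n + 1)) (n : M.D nat) :
    hatVal f n = M.app f n := by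
  refine hatVal_eq_of_bad_eq_zero ?_
  induction n using induction_on with
  | definable => exact ⟨_, f ∷ Env.nil, eq0 (badT v1 v0) zeroT, fun _ => by simp⟩
  | zero => exact bad_zero f
  | add_one n ih => rw [bad_add_one, if_pos (h n), ih, add_zero]

theorem abs_hatVal_sub_le (f : M.D (nat ⇾ nat)) {n m : M.D nat} (h : n ≤ m) :
    |qval (hatVal f n) - qval (hatVal f m)| ≤ eps n - eps m := by
  obtain ⟨d, rfl⟩ := exists_add_of_le h
  clear h
  induction d using induction_on with
  | definable => exact ⟨_, n ∷ f ∷ Env.nil, qLe (qAbs (qSub (hat v2 v1) (hat v2 (addT v1 v0))))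
      (qSub (qPow v1) (qPow (addT v1 v0))), fun _ => by simp⟩
  | zero => simp
  | add_one d ih =>
    have hstep := abs_hatVal_sub_hatVal_add_one_lt f (n + d)
    have htriangle := abs_sub_le (qval (hatVal f n)) (qval (hatVal f (n + d)))
      (qval (hatVal f (n + d + 1)))
    rw [eps_add_one] at hstep
    rw [← add_assoc, eps_add_one]
    linarith

section Reals

variable (e : M.Env Γ)

@[simp] theorem sat_ltR (x y : Term Γ (nat ⇾ nat)) : Sat e (ltR x y) ↔
    ∃ n, eps n ≤ qval (hatVal (eval e y) (n + 1)) - qval (hatVal (eval e x) (n + 1)) := by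
  simp [ltR]

@[simp] theorem sat_leR (x y : Term Γ (nat ⇾ nat)) : Sat e (leR x y) ↔
    ∀ n, qval (hatVal (eval e x) (n + 1)) - qval (hatVal (eval e y) (n + 1)) < eps n := by
  simp only [leR, sat_neg, sat_ltR, not_exists, not_le]

@[simp] theorem sat_eqR (x y : Term Γ (nat ⇾ nat)) : Sat e (eqR x y) ↔
    ∀ n, |qval (hatVal (eval e x) (n + 1)) - qval (hatVal (eval e y) (n + 1))| < eps n := by
  simp [eqR]

@[simp] theorem hatVal_ratR (q : Term Γ nat) (n : M.D nat) :
    hatVal (eval e (ratR q)) n = eval e q :=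
  hatVal_of_const (fun _ => by rw [ratR, app_eval_lam, eval_wk]) n

theorem qval_hatVal_addR (x y : Term Γ (nat ⇾ nat)) (n : M.D nat) :
    qval (hatVal (eval e (addR x y)) n) =
      qval (hatVal (eval e x) (n + 1)) + qval (hatVal (eval e y) (n + 1)) := by
  have happ : ∀ n, qval (M.app (eval e (addR x y)) n) =
      qval (hatVal (eval e x) (n + 1)) + qval (hatVal (eval e y) (n + 1)) := fun n => by
    rw [addR, app_eval_lam]
    simp
  rw [hatVal_of_fast, happ]
  intro n
  have hx := abs_hatVal_sub_hatVal_add_one_lt (eval e x) (n + 1)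
  have hy := abs_hatVal_sub_hatVal_add_one_lt (eval e y) (n + 1)
  rw [eps_add_one (n + 1)] at hx hy
  rw [happ, happ, add_sub_add_comm]
  exact (abs_add_le _ _).trans_lt (by linarith)

end Reals

end Struct

namespace Struct

variable {M : Struct} {Γ : Ctx}

/-! ## Events and probabilities -/

/-- Membership of a sample point in an event of a structure. -/
instance : Membership (M.D omega) (M.D event) where
  mem A w := M.app (M.app (M.cst .mem) w) A = (0 : M.D nat)

/-- The union of events of a structure. -/
instance : Union (M.D event) := ⟨fun A B => M.app (M.app (M.cst .union) A) B⟩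

/-- The complement of an event of a structure. -/
instance : Compl (M.D event) := ⟨fun A => M.app (M.cst .compl) A⟩

/-- The intersection of events of a structure, which in the system is defined from unions and
complements. -/
instance : Inter (M.D event) := ⟨fun A B => (Aᶜ ∪ Bᶜ)ᶜ⟩

/-- The impossible event of a structure. -/
instance : EmptyCollection (M.D event) := ⟨M.cst .empty⟩

section Eval

variable (e : M.Env Γ)

@[simp] theorem sat_memF (w : Term Γ omega) (A : Term Γ event) :
    Sat e (memF w A) ↔ eval e w ∈ eval e A := Iff.rfl

@[simp] theorem eval_complT (A : Term Γ event) : eval e (complT A) = (eval e A)ᶜ := rfl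

end Eval

variable [M.IsModel FAxioms]

theorem mem_union {w : M.D omega} {A B : M.D event} : w ∈ A ∪ B ↔ w ∈ A ∨ w ∈ B :=
  (sat_iff _ _ _).1 (IsModel.sat (T := FAxioms) (Γ := [omega, event, event])
    (φ := memF v0 (unionT v1 v2) ⟺ (memF v0 v1 ⋎ memF v0 v2))
    (fun _ _ => .ax (.mem_union _ _ _)) (w ∷ A ∷ B ∷ Env.nil))

theorem mem_compl {w : M.D omega} {A : M.D event} : w ∈ Aᶜ ↔ w ∉ A :=
  (sat_iff _ _ _).1 (IsModel.sat (T := FAxioms) (Γ := [omega, event])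
    (φ := memF v0 (complT v1) ⟺ (memF v0 v1).neg)
    (fun _ _ => .ax (.mem_compl _ _)) (w ∷ A ∷ Env.nil))

theorem mem_inter {w : M.D omega} {A B : M.D event} : w ∈ A ∩ B ↔ w ∈ A ∧ w ∈ B :=
  mem_compl.trans (by rw [mem_union, mem_compl, mem_compl, not_or, not_not, not_not])

theorem mem_compl_empty (w : M.D omega) : w ∈ (∅ : M.D event)ᶜ :=
  mem_compl.2 (IsModel.sat (T := FAxioms) (Γ := [omega]) (φ := (memF v0 emptyT).neg)
    (fun _ _ => .ax (.mem_empty _)) (w ∷ Env.nil))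

/-- The `n`-th rational approximation to the probability of an event. -/
noncomputable def prb (A : M.D event) (n : M.D nat) : M.FractionField :=
  qval (hatVal (M.app (M.cst .prob) A) n)

@[simp] theorem qval_hatVal_probT (e : M.Env Γ) (A : Term Γ event) (n : M.D nat) :
    qval (hatVal (eval e (probT A)) n) = prb (eval e A) n := rfl

theorem abs_prb_sub_le (A : M.D event) {n m : M.D nat} (h : n ≤ m) :
    |prb A n - prb A m| ≤ eps n :=
  (abs_hatVal_sub_le _ h).trans (sub_le_self _ (eps_pos m).le)

end Struct

/-- The axioms on the probability content as generalized formulas. They have to be passed to the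
completeness theorem as assumptions: abstraction does not commute with substitution syntactically,
so that a substitution instance of one of these axioms need not be an axiom again. -/
def probAxioms (Γ : Ctx) : List (Formula Γ) :=
  [all event (leR (ratR qZero) (probT v0)),
    all event (all event (subsetF v1 v0 ⟹ leR (probT v1) (probT v0))),
    eqR (probT fullT) (ratR qOne),
    all event (all event (eqR (addR (probT (unionT v1 v0)) (probT (interT v1 v0)))
      (addR (probT v1) (probT v0))))]

theorem deriv_probAxioms {T : Theory} (hT : FAxioms ≤ T) {Γ : Ctx} (Δ : List (Formula Γ)) :
    ∀ φ ∈ probAxioms Γ, Deriv T Δ φ := by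
  simp only [probAxioms, List.forall_mem_cons]
  exact ⟨.all_intro (.ax (hT _ _ (.prob_nonneg _))),
    .all_intro (.all_intro (.ax (hT _ _ (.prob_mono _ _)))), .ax (hT _ _ .prob_full),
    .all_intro (.all_intro (.ax (hT _ _ (.prob_union_inter _ _)))), fun _ h => nomatch h⟩

namespace Struct

/-- Models of arithmetic in which the axioms on the probability content hold, spelled out for the
rational approximations `prb`. -/
class IsProbModel (M : Struct) [M.IsModel FAxioms] : Prop where
  neg_eps_lt_prb (A : M.D event) (n : M.D nat) : -eps n < prb A (n + 1)
  prb_lt_prb_add_eps {A B : M.D event} (h : ∀ w ∈ A, w ∈ B) (n : M.D nat) :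
    prb A (n + 1) < prb B (n + 1) + eps n
  abs_prb_compl_empty_sub_one_lt (n : M.D nat) : |prb (∅ᶜ : M.D event) (n + 1) - 1| < eps n
  abs_prb_union_add_prb_inter_sub_lt (A B : M.D event) (n : M.D nat) :
    |prb (A ∪ B) (n + 1 + 1) + prb (A ∩ B) (n + 1 + 1) -
      (prb A (n + 1 + 1) + prb B (n + 1 + 1))| < eps n

open IsProbModel

variable {M : Struct} [M.IsModel FAxioms] {Γ : Ctx}

theorem IsProbModel.of_sat (e : M.Env Γ) (h : ∀ φ ∈ probAxioms Γ, Sat e φ) : M.IsProbModel := by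
  simp only [probAxioms, List.forall_mem_cons, sat_all, sat_imp, sat_leR, sat_eqR] at h
  obtain ⟨hnonneg, hmono, hfull, hunion, -⟩ := h
  simp only [qval_hatVal_addR, qval_hatVal_probT, hatVal_ratR, qval_qZero, qval_qOne] at *
  exact {
    neg_eps_lt_prb := fun A n => neg_lt.1 ((zero_sub _).symm.trans_lt (hnonneg A n))
    prb_lt_prb_add_eps := fun h n => sub_lt_iff_lt_add'.1 (hmono _ _ h n)
    abs_prb_compl_empty_sub_one_lt := hfull
    abs_prb_union_add_prb_inter_sub_lt := hunion }

theorem prb_lt_one_add [M.IsProbModel] (A : M.D event) (n : M.D nat) :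
    prb A (n + 1) < 1 + 2 * eps n := by
  have hA := prb_lt_prb_add_eps (A := A) (fun w _ => mem_compl_empty w) n
  have hfull := (abs_lt.1 (IsProbModel.abs_prb_compl_empty_sub_one_lt n)).2
  linarith

end Struct

/-! ## Dependent choice and uniform boundedness -/

theorem proves_dc {Γ : Ctx} {ρ : Ty} (φ : Formula (ρ :: ρ :: nat :: Γ)) :
    FAxioms.Proves (all nat (all ρ (ex ρ φ)) ⟹
      ex (nat ⇾ ρ) (all nat (φ.subst (Sub.cons (v1 ⬝ succT v0)
        (Sub.cons (v1 ⬝ v0) (Sub.cons v0 fun _ v => .var (.s (.s v)))))))) := by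
  intro Δ s
  refine .ax ?_
  convert FAxioms.dc [ρ] (φ.subst (((s.lift nat).lift ρ).lift ρ)) using 1
  simp only [Formula.subst, Formula.subst_subst, dcMatrix]
  refine congrArg (fun s => Formula.imp _ (ex _ (all _ (Formula.subst s φ))))
    (Sub.ext_cons rfl fun τ v => ?_)
  rcases v with _ | _ | v
  · rfl
  · rfl
  · simp only [Sub.comp, Sub.lift, Sub.cons, Term.subst, Term.subst_wk]
    rw [Term.wk, Term.rename_eq_subst, Term.wk, Term.rename_eq_subst, Term.subst_subst]
    rfl

namespace Struct

variable {M : Struct} {Γ : Ctx}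

theorem exists_dependent_choice [M.IsModel FAxioms] (e : M.Env Γ) {ρ : Ty}
    (φ : Formula (ρ :: ρ :: nat :: Γ)) (h : ∀ n y, ∃ z, Sat (z ∷ y ∷ n ∷ e) φ) :
    ∃ f : M.D (nat ⇾ ρ), ∀ n, Sat (M.app f (n + 1) ∷ M.app f n ∷ n ∷ e) φ := by
  obtain ⟨f, hf⟩ := IsModel.sat (proves_dc φ) e h
  refine ⟨f, fun n => ?_⟩
  convert (sat_subst _ _ _).1 (hf n) using 1
  refine Env.ext_cons (congrArg (M.app f) (app_succ n).symm) fun τ v => ?_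
  rcases v with _ | _ | v <;> rfl

end Struct

/-- The instance of uniform boundedness for formulas in which only the bounded variable and one
variable of the abstract type are quantified. -/
def ubFormula {Γ : Ctx} (V : Ty) (φ : Formula (nat :: V :: Γ)) : Formula Γ :=
  all (nat ⇾ nat) (all nat (all nat (all V (ex nat
      (φ.subst ((Sub.lift (fun _ v => .var (.s (.s (.s v)))) V).lift nat))))) ⟹
    ex (nat ⇾ nat) (all nat (all nat (all V (ex nat (le0 v0 (v4 ⬝ v3) ⋏
      φ.subst ((Sub.lift (fun _ v => .var (.s (.s (.s (.s v))))) V).lift nat)))))))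

theorem ubAxioms_ubFormula {Γ : Ctx} (V : Ty) {φ : Formula (nat :: V :: Γ)}
    (hφ : IsExistential φ) : UBAxioms V (ubFormula V φ) := by
  have hub := UBAxioms.ub (V := V) [] [[]]
    (φ.subst ((Sub.lift (fun _ v => .var (.s (.s (.s v)))) V).lift nat)) (hφ.subst _)
  have hmatrix (t : Term (nat :: nat :: (nat ⇾ nat) :: Γ) nat) :
      (φ.subst ((Sub.lift (fun _ v => .var (.s (.s (.s v)))) V).lift nat)).subst
        (((Sub.cons t fun _ v => .var (.s v)).lift V).lift nat) =
      φ.subst ((Sub.lift (fun _ v => .var (.s (.s (.s v)))) V).lift nat) := by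
    rw [Formula.subst_subst, Sub.lift_comp, Sub.lift_comp]; rfl
  have hweaken : (φ.subst ((Sub.lift (fun _ v => .var (.s (.s (.s v)))) V).lift nat)).rename
        (((((Ren.wk ((nat ⇾ nat) :: Γ) (nat ⇾ nat)).lift nat).lift nat).lift V).lift nat) =
      φ.subst ((Sub.lift (fun _ v => .var (.s (.s (.s (.s v))))) V).lift nat) := by
    rw [Formula.rename_eq_subst, ← Sub.lift_ofRen, ← Sub.lift_ofRen, Formula.subst_subst,
      Sub.lift_comp, Sub.lift_comp]; rfl
  rw [ubFormula, ← hweaken, ← hmatrix]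
  exact hub

theorem ubFormula_subst {Γ Δ : Ctx} (V : Ty) (φ : Formula (nat :: V :: Γ)) (s : Sub Γ Δ) :
    (ubFormula V φ).subst s = ubFormula V (φ.subst ((s.lift V).lift nat)) := by
  have hcomp₃ : Sub.comp (fun _ v => .var (.s (.s (.s v))))
      (((s.lift (nat ⇾ nat)).lift nat).lift nat) =
      s.comp fun _ v => .var (.s (.s (.s v))) := by
    funext τ v
    simp only [Sub.comp, Sub.lift, Sub.cons, Term.subst, Term.wk, Term.rename_eq_subst,
      Term.subst_subst]
    rfl
  have hcomp₄ : Sub.comp (fun _ v => .var (.s (.s (.s (.s v)))))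
      ((((s.lift (nat ⇾ nat)).lift (nat ⇾ nat)).lift nat).lift nat) =
      s.comp fun _ v => .var (.s (.s (.s (.s v)))) := by
    funext τ v
    simp only [Sub.comp, Sub.lift, Sub.cons, Term.subst, Term.wk, Term.rename_eq_subst,
      Term.subst_subst]
    rfl
  simp only [ubFormula, Formula.subst, Formula.subst_subst, Sub.lift_comp, hcomp₃, hcomp₄]
  rfl

namespace Struct

variable {M : Struct} {Γ : Ctx}

theorem exists_uniform_bound [M.IsModel FAxioms] {V : Ty} [M.IsModel (UBAxioms V)] (e : M.Env Γ)
    {φ : Formula (nat :: V :: Γ)} (hφ : IsExistential φ) (h : ∀ z, ∃ w, Sat (w ∷ z ∷ e) φ) :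
    ∃ N : M.D nat, ∀ z, ∃ w ≤ N, Sat (w ∷ z ∷ e) φ := by
  have hub := IsModel.sat (T := UBAxioms V) (φ := ubFormula V φ) (fun Δ s =>
    .ax (ubFormula_subst V φ s ▸ ubAxioms_ubFormula V (hφ.subst _))) e
  simp only [ubFormula, sat_all, sat_imp, sat_ex, sat_and, sat_subst, sat_le0, eval_lift] at hub
  obtain ⟨χ, hχ⟩ := hub (M.cst .succ) fun _ _ => h
  exact ⟨M.app χ 0, hχ 0 0⟩

end Struct

namespace Struct

open IsProbModel

variable {M : Struct} [M.IsModel FAxioms]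

/-! ## Nearly minimal probabilities and covers -/

theorem eps_le_one (n : M.D nat) : eps n ≤ 1 := by
  refine inv_le_one_of_one_le₀ ?_
  rw [← map_one cast, cast_le]
  simpa only [zero_add] using add_one_le_iff_lt.2 (pow2_pos n)

theorem cast_pow2_mul_eps (n : M.D nat) : cast (pow2 n) * eps n = 1 :=
  mul_inv_cancel₀ (inv_pos.1 (eps_pos n)).ne'

theorem qval_qCode_pow2 {Γ : Ctx} (e : M.Env Γ) (a n : Term Γ nat) :
    qval (eval e (qCode a zeroT (predT (pow2T n)))) = cast (eval e a) * eps (eval e n) := by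
  rw [qval_qCode]
  simp [cast_pred (pow2_pos (eval e n)).ne', eps, div_eq_mul_inv]

/-- The inequality `ℙ(A) < q` in the order that the system puts on the reals: at some precision
the approximation of `ℙ(A)` stays below `q` by more than its error. -/
def ProbLT (A : M.D event) (q : M.FractionField) : Prop :=
  ∃ l, eps l ≤ q - prb A (l + 1)

theorem ProbLT.prb_le {A : M.D event} {q : M.FractionField} (h : ProbLT A q) (n : M.D nat) :
    prb A (n + 1) ≤ q + eps n := by
  obtain ⟨l, hl⟩ := h
  have hl₀ := eps_pos l
  have hn₀ := eps_pos n
  rcases le_total l n with hln | hln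
  · have habs := abs_le.1 (abs_prb_sub_le A (add_le_add_left hln 1))
    rw [eps_add_one] at habs
    linarith [habs.1]
  · have habs := abs_le.1 (abs_prb_sub_le A (add_le_add_left hln 1))
    rw [eps_add_one] at habs
    linarith [habs.2]

theorem ProbLT.exists_sub_eps {A : M.D event} {q : M.FractionField} (h : ProbLT A q) :
    ∃ m, ProbLT A (q - eps m) := by
  obtain ⟨l, hl⟩ := h
  refine ⟨l + 1 + 1, l + 1 + 1, ?_⟩
  have habs := (abs_le.1 (abs_prb_sub_le A (n := l + 1) (m := l + 1 + 1 + 1) ⟨1 + 1, by ring⟩)).1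
  simp only [eps_add_one] at *
  linarith

theorem exists_prb_le_add_eps [M.IsProbModel] (g : M.D (nat ⇾ event)) (l : M.D nat) :
    ∃ j, ∀ k, prb (M.app g j) (l + 1) ≤ prb (M.app g k) (l + 1) + eps (l + 1) := by
  by_contra! hdecrease
  have hnone (L : M.D nat) : ¬∃ j, prb (M.app g j) (l + 1) ≤ cast L * eps (l + 1) - 1 := by
    induction L using induction_on with
    | definable =>
      exact ⟨_, g ∷ l ∷ Env.nil, (ex nat (qLe (hat (probT (v2 ⬝ v0)) (succT v3))
        (qSub (qCode v1 zeroT (predT (pow2T (succT v3)))) qOne))).neg,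
        fun _ => by simp [qval_qCode_pow2]⟩
    | zero =>
      rintro ⟨j, hj⟩
      rw [map_zero, zero_mul] at hj
      linarith [neg_eps_lt_prb (M.app g j) l, eps_le_one l]
    | add_one L hL =>
      rintro ⟨j, hj⟩
      obtain ⟨k, hk⟩ := hdecrease j
      rw [map_add, map_one] at hj
      exact hL ⟨k, by linarith⟩
  refine hnone (pow2 (l + 1) * 4) ⟨0, ?_⟩
  rw [map_mul, map_ofNat, mul_right_comm, cast_pow2_mul_eps]
  linarith [prb_lt_one_add (M.app g 0) l, eps_le_one l]

theorem exists_prb_le_of_cover [M.IsProbModel] [M.IsModel (UBAxioms omega)]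
    {g : M.D (nat ⇾ event)} {A : M.D event} {q : M.FractionField}
    (hanti : ∀ {k k' : M.D nat} {w : M.D omega}, k ≤ k' → w ∈ M.app g k' → w ∈ M.app g k)
    (hA : ProbLT A q) (hcover : ∀ w ∉ A, ∃ k, w ∉ M.app g k) :
    ∃ k, ∀ n, prb (M.app g k) (n + 1) ≤ q + 2 * eps n := by
  obtain ⟨N, hN⟩ := exists_uniform_bound (V := omega) (g ∷ A ∷ Env.nil)
    (φ := memF v1 v3 ⋎ (memF v1 (v2 ⬝ v0)).neg) (.qf ⟨trivial, trivial, trivial⟩) fun w => by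
      by_cases hw : w ∈ A
      · exact ⟨0, by simp [hw]⟩
      · obtain ⟨k, hk⟩ := hcover w hw
        exact ⟨k, by simp [hk]⟩
  refine ⟨N, fun n => ?_⟩
  have hsubset : ∀ w ∈ M.app g N, w ∈ A := by
    intro w hw
    obtain ⟨k, hk, hsat⟩ := hN w
    simp only [sat_or, sat_neg, sat_memF, eval_app, eval_var_z, eval_var_s] at hsat
    exact hsat.resolve_right fun h => h (hanti hk hw)
  linarith [hA.prb_le n, prb_lt_prb_add_eps hsubset n]

/-- A family of events increasing in its first and decreasing in its second index. -/
structure IsMonoAnti (E : M.D (nat ⇾ nat ⇾ event)) : Prop where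
  mono {n n' k : M.D nat} {w : M.D omega} (h : n ≤ n') (hw : w ∈ M.app (M.app E n) k) :
    w ∈ M.app (M.app E n') k
  anti {n k k' : M.D nat} {w : M.D omega} (h : k ≤ k') (hw : w ∈ M.app (M.app E n) k') :
    w ∈ M.app (M.app E n) k

/-- The events `f (n + 1)` are finite unions `E 0 j₀ ∪ ⋯ ∪ E n jₙ`, where each `E n jₙ` has the
least probability among the `E n k` up to an error that decreases exponentially in `n`. -/
def IsCoveringSequence (E : M.D (nat ⇾ nat ⇾ event)) (l : M.D nat) (f : M.D (nat ⇾ event)) :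
    Prop :=
  ∀ n, ∃ j,
    (∀ k, prb (M.app (M.app E n) j) (n + l + 1) ≤
      prb (M.app (M.app E n) k) (n + l + 1) + eps (n + l + 1)) ∧
    ∀ w, w ∈ M.app f (n + 1) ↔ w ∈ M.app (M.app E n) j ∨ n ≠ 0 ∧ w ∈ M.app f n

theorem exists_isCoveringSequence [M.IsProbModel] (E : M.D (nat ⇾ nat ⇾ event)) (l : M.D nat) :
    ∃ f, IsCoveringSequence E l f := by
  obtain ⟨f, hf⟩ := exists_dependent_choice (ρ := event) (E ∷ l ∷ Env.nil)
    (ex nat (all nat (qLe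
        (hat (probT (.var (.s (.s (.s (.s (.s .z))))) ⬝ v4 ⬝ v1))
          (succT (addT v4 (.var (.s (.s (.s (.s (.s (.s .z))))))))))
        (qAdd (hat (probT (.var (.s (.s (.s (.s (.s .z))))) ⬝ v4 ⬝ v0))
            (succT (addT v4 (.var (.s (.s (.s (.s (.s (.s .z))))))))))
          (qPow (succT (addT v4 (.var (.s (.s (.s (.s (.s (.s .z)))))))))))) ⋏
      all omega (memF v0 v2 ⟺ (memF v0 (.var (.s (.s (.s (.s (.s .z))))) ⬝ v4 ⬝ v1) ⋎
        ((eq0 v4 zeroT).neg ⋏ memF v0 v3))))) fun n A => by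
      obtain ⟨j, hj⟩ := exists_prb_le_add_eps (M.app E n) (n + l)
      by_cases hn : n = 0
      · exact ⟨M.app (M.app E n) j, by simpa [hn] using ⟨j, by simpa [hn] using hj, by simp⟩⟩
      · exact ⟨M.app (M.app E n) j ∪ A, by simpa [hn, mem_union] using ⟨j, hj, by simp⟩⟩
  exact ⟨f, fun n => by simpa using hf n⟩

section Covering

variable {E : M.D (nat ⇾ nat ⇾ event)} {l : M.D nat} {f : M.D (nat ⇾ event)}

theorem IsCoveringSequence.mem_of_forall_mem (hf : IsCoveringSequence E l f) {n : M.D nat}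
    {w : M.D omega} (hw : ∀ k, w ∈ M.app (M.app E n) k) : w ∈ M.app f (n + 1) := by
  obtain ⟨j, -, hj⟩ := hf n
  exact (hj w).2 (.inl (hw j))

theorem IsCoveringSequence.mem_of_le (hf : IsCoveringSequence E l f) {n n' : M.D nat}
    {w : M.D omega} (hle : n ≤ n') (hw : w ∈ M.app f (n + 1)) : w ∈ M.app f (n' + 1) := by
  obtain ⟨d, rfl⟩ := hle
  induction d using induction_on with
  | definable =>
    exact ⟨_, w ∷ n ∷ f ∷ Env.nil, memF v1 (v3 ⬝ succT (addT v2 v0)), fun _ => by simp⟩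
  | zero => rwa [add_zero]
  | add_one d ih =>
    obtain ⟨j, -, hj⟩ := hf (n + d + 1)
    rw [← add_assoc]
    exact (hj w).2 (.inr ⟨Struct.add_one_ne_zero _, ih⟩)

theorem IsCoveringSequence.exists_cover [M.IsModel (UBAxioms event)]
    (hf : IsCoveringSequence E l f) (hsmall : ∀ n, eps l ≤ 1 - prb (M.app f (n + 1)) (l + 1)) :
    ∃ A, ProbLT A 1 ∧ ∀ w n, (∀ k, w ∈ M.app (M.app E n) k) → w ∈ A := by
  by_contra! hcover
  obtain ⟨N, hN⟩ := exists_uniform_bound (V := event) (f ∷ l ∷ Env.nil)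
    (φ := ex omega ((memF v0 (v3 ⬝ succT v1) ⋏ (memF v0 v2).neg) ⋎
      (qLe (qPow v4) (qSub qOne (hat (probT v2) (succT v4)))).neg))
    (.ex ⟨[], omega, .inr (.inl rfl), by simp, rfl⟩
      (.qf ⟨⟨trivial, trivial, trivial⟩, ⟨trivial, trivial⟩, trivial⟩)) fun A => by
      by_cases hA : eps l ≤ 1 - prb A (l + 1)
      · obtain ⟨w, n, hw, hwA⟩ := hcover A ⟨l, hA⟩
        exact ⟨n, by simpa using ⟨w, .inl ⟨hf.mem_of_forall_mem hw, hwA⟩⟩⟩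
      · exact ⟨0, by simpa using ⟨M.cst .point, .inr hA⟩⟩
  obtain ⟨n, hn, hsat⟩ := hN (M.app f (N + 1))
  simp only [sat_ex, sat_and, sat_or, sat_neg, sat_memF, sat_qLe, qval_qSub, qval_qOne,
    qval_qPow, eval_hat, qval_hatVal_probT, eval_app, eval_succT, eval_var_z, eval_var_s] at hsat
  obtain ⟨w, ⟨hw, hw'⟩ | hlarge⟩ := hsat
  · exact hw' (hf.mem_of_le hn hw)
  · exact hlarge (hsmall N)

variable [M.IsProbModel]

theorem prb_add_eps_le_of_subset_union {C C' D Q : M.D event} {s : M.D nat} {a b : M.FractionField}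
    (hC' : ∀ w ∈ C', w ∈ D ∨ w ∈ C) (hQD : ∀ w ∈ Q, w ∈ D) (hQC : ∀ w ∈ Q, w ∈ C)
    (hC : prb C (s + 1) + 8 * eps s ≤ prb Q (s + 1) + a)
    (hD : prb D (s + 1 + 1) ≤ b + eps (s + 1 + 1)) :
    prb C' (s + 1 + 1) + 8 * eps (s + 1) ≤ b + a := by
  have hle : s + 1 ≤ s + 1 + 1 := ⟨1, rfl⟩
  have hunion := prb_lt_prb_add_eps (A := C') (B := D ∪ C)
    (fun w hw => mem_union.2 (hC' w hw)) (s + 1)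
  have hsum := (abs_lt.1 (abs_prb_union_add_prb_inter_sub_lt D C s)).2
  have hinter := prb_lt_prb_add_eps (A := Q) (B := D ∩ C)
    (fun w hw => mem_inter.2 ⟨hQD w hw, hQC w hw⟩) (s + 1)
  have hCs := (abs_le.1 (abs_prb_sub_le C hle)).1
  have hQs := (abs_le.1 (abs_prb_sub_le Q hle)).2
  have hpos := eps_pos s
  simp only [eps_add_one] at *
  linarith

/-- The constants leave room for the errors at all stages of the induction: these add up to a
geometric series, whose remainder after stage `n` is accounted for by `8 * eps (n + l)`. -/
theorem IsCoveringSequence.prb_add_eps_le (hf : IsCoveringSequence E l f) (hE : IsMonoAnti E)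
    (n k : M.D nat) : prb (M.app f (n + 1)) (n + l + 1) + 8 * eps (n + l) ≤
      prb (M.app (M.app E n) k) (n + l + 1) + 10 * eps l := by
  induction n using induction_on generalizing k with
  | definable =>
    exact ⟨_, f ∷ E ∷ l ∷ 8 ∷ 10 ∷ Env.nil,
      all nat (qLe (qAdd (hat (probT (v2 ⬝ succT v1)) (succT (addT v1 v4)))
          (qCode (.var (.s (.s (.s (.s (.s .z)))))) zeroT (predT (pow2T (addT v1 v4)))))
        (qAdd (hat (probT (v3 ⬝ v1 ⬝ v0)) (succT (addT v1 v4)))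
          (qCode (.var (.s (.s (.s (.s (.s (.s .z))))))) zeroT (predT (pow2T v4))))),
      fun _ => by simp [qval_qCode_pow2, map_ofNat]⟩
  | zero =>
    obtain ⟨j, hmin, hmem⟩ := hf 0
    have hfirst := prb_lt_prb_add_eps (A := M.app f (0 + 1)) (B := M.app (M.app E 0) j)
      (fun w hw => by simpa using (hmem w).1 hw) l
    have hmin := hmin k
    have hpos := eps_pos l
    simp only [zero_add, eps_add_one] at *
    linarith
  | add_one n ih =>
    obtain ⟨i, -, hi⟩ := hf n
    obtain ⟨j, hmin, hj⟩ := hf (n + 1)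
    rw [add_right_comm n 1 l] at hmin ⊢
    refine prb_add_eps_le_of_subset_union (Q := M.app (M.app E n) (i + j)) (fun w hw => ?_)
      (fun w hw => ?_) (fun w hw => ?_) (ih _) (hmin k)
    · exact ((hj w).1 hw).imp_right And.right
    · exact hE.anti ⟨i, add_comm j i⟩ (hE.mono ⟨1, rfl⟩ hw)
    · exact (hi w).2 (.inl (hE.anti ⟨j, rfl⟩ hw))

theorem IsCoveringSequence.prb_le (hf : IsCoveringSequence E l f) (hE : IsMonoAnti E)
    {q : M.FractionField} {n k : M.D nat}
    (hk : ∀ i, prb (M.app (M.app E n) k) (i + 1) ≤ q + 2 * eps i) :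
    prb (M.app f (n + 1)) (l + 1) ≤ q + 11 * eps l := by
  have hinvariant := hf.prb_add_eps_le hE n k
  have habs := (abs_le.1 (abs_prb_sub_le (M.app f (n + 1))
    (n := l + 1) (m := n + l + 1) ⟨n, by ring⟩)).2
  have hbound := hk (n + l)
  have hpos := eps_pos l
  have hpos' := eps_pos (n + l)
  simp only [eps_add_one] at *
  linarith

end Covering

theorem exists_cover [M.IsProbModel] [M.IsModel (UBAxioms omega)] [M.IsModel (UBAxioms event)]
    {E : M.D (nat ⇾ nat ⇾ event)} (hE : IsMonoAnti E) {m : M.D nat}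
    (h : ∀ n, ∃ A, ProbLT A (1 - eps m) ∧ ∀ w ∉ A, ∃ k, w ∉ M.app (M.app E n) k) :
    ∃ A, ProbLT A 1 ∧ ∀ w n, (∀ k, w ∈ M.app (M.app E n) k) → w ∈ A := by
  obtain ⟨f, hf⟩ := exists_isCoveringSequence E (m + 1 + 1 + 1 + 1)
  refine hf.exists_cover fun n => ?_
  obtain ⟨A, hA, hcover⟩ := h n
  obtain ⟨k, hk⟩ := exists_prb_le_of_cover hE.anti hA hcover
  have hsmall := hf.prb_le hE hk
  have hpos := eps_pos m
  simp only [eps_add_one] at *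
  linarith

end Struct

/-! ## The formulas of the theorem in a model -/

namespace Struct

variable {M : Struct}

/-- The set of sample points at which an instance of the formula `φ(x, n, k, ω)` holds. -/
def MatrixSat {Γ : Ctx} (φ : Formula (MatrixCtx Γ)) (e : M.Env Γ) (x n k : M.D nat)
    (w : M.D omega) : Prop :=
  Sat (w ∷ k ∷ n ∷ x ∷ e) φ

theorem sat_matrixAt {Γ Δ : Ctx} (φ : Formula (MatrixCtx Γ)) (r : Ren Γ Δ) (x n k : Term Δ nat)
    (w : Term Δ omega) (e : M.Env Δ) : Sat e (matrixAt φ r x n k w) ↔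
      MatrixSat φ (fun _ v => e (r v)) (eval e x) (eval e n) (eval e k) (eval e w) := by
  rw [matrixAt, sat_subst, MatrixSat]
  refine iff_of_eq (congrArg (fun e => Sat e φ) ?_)
  funext τ v
  rcases v with _ | _ | _ | _ | v <;> rfl

theorem sat_measurableF {Γ : Ctx} {φ : Formula (MatrixCtx Γ)}
    {P : Term Γ (nat ⇾ nat ⇾ nat ⇾ event)} {e : M.Env Γ} : Sat e (measurableF φ P) ↔
    ∀ x n k w, w ∈ M.app (M.app (M.app (eval e P) x) n) k ↔ MatrixSat φ e x n k w := by
  simp only [measurableF, sat_all, sat_iff, sat_memF, sat_matrixAt, eval_app, eval_wk, eval_var_z,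
    eval_var_s]
  rfl

variable [M.IsModel FAxioms]

theorem sat_probGe {Γ : Ctx} (φ : Formula (omega :: Γ)) (q : Term Γ nat) (e : M.Env Γ) :
    Sat e (probGe φ (ratR q)) ↔
      ∀ A, ProbLT A (qval (eval e q)) → ∃ w ∉ A, Sat (w ∷ e) φ := by
  simp only [probGe, sat_all, sat_imp, sat_ltR, sat_ex, sat_and, sat_memF, sat_rename, eval_wk,
    hatVal_ratR, qval_hatVal_probT, eval_complT, eval_var_z, eval_var_s, mem_compl]
  refine forall_congr' fun A => imp_congr Iff.rfl (exists_congr fun w => and_congr Iff.rfl ?_)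
  refine iff_of_eq (congrArg (fun e => Sat e φ) ?_)
  funext τ v
  cases v <;> rfl

section Conditions

variable {Γ : Ctx} {φ : Formula (MatrixCtx Γ)} {P : Term Γ (nat ⇾ nat ⇾ nat ⇾ event)} {e : M.Env Γ}

theorem sat_monotoneF : Sat e (monotoneF φ) ↔
    ∀ x w k n n', n ≤ n' ∧ MatrixSat φ e x n k w → MatrixSat φ e x n' k w := by
  simp only [monotoneF, sat_all, sat_imp, sat_and, sat_le0, sat_matrixAt, eval_var_z, eval_var_s]
  rfl

theorem sat_antitoneF : Sat e (antitoneF φ) ↔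
    ∀ x w n k k', k ≤ k' ∧ MatrixSat φ e x n k' w → MatrixSat φ e x n k w := by
  simp only [antitoneF, sat_all, sat_imp, sat_and, sat_le0, sat_matrixAt, eval_var_z, eval_var_s]
  rfl

theorem sat_pointwiseF : Sat e (pointwiseF φ) ↔
    ∀ x A, ProbLT A 1 → ∃ w ∉ A, ∃ n, ∀ k, MatrixSat φ e x n k w := by
  simp only [pointwiseF, sat_all, sat_probGe, qval_qOne, sat_ex, sat_matrixAt, eval_var_z,
    eval_var_s]
  rfl

theorem sat_uniformF : Sat e (uniformF φ) ↔
    ∀ m x, ∃ n, ∀ A, ProbLT A (1 - eps m) → ∃ w ∉ A, ∀ k, MatrixSat φ e x n k w := by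
  simp only [uniformF, sat_all, sat_probGe, qval_qSub, qval_qPow, qval_qOne, sat_ex, sat_matrixAt,
    eval_var_z, eval_var_s]
  rfl

theorem sat_pointwiseF_of_sat_uniformF (h : Sat e (uniformF φ)) : Sat e (pointwiseF φ) := by
  rw [sat_uniformF] at h
  refine sat_pointwiseF.2 fun x A hA => ?_
  obtain ⟨m, hm⟩ := hA.exists_sub_eps
  obtain ⟨n, hn⟩ := h m x
  obtain ⟨w, hwA, hw⟩ := hn A hm
  exact ⟨w, hwA, n, hw⟩

theorem isMonoAnti_of_sat (hmeas : Sat e (measurableF φ P)) (hmono : Sat e (monotoneF φ))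
    (hanti : Sat e (antitoneF φ)) (x : M.D nat) : IsMonoAnti (M.app (eval e P) x) := by
  rw [sat_measurableF] at hmeas
  exact {
    mono := fun h hw =>
      (hmeas _ _ _ _).2 (sat_monotoneF.1 hmono _ _ _ _ _ ⟨h, (hmeas _ _ _ _).1 hw⟩)
    anti := fun h hw =>
      (hmeas _ _ _ _).2 (sat_antitoneF.1 hanti _ _ _ _ _ ⟨h, (hmeas _ _ _ _).1 hw⟩) }

theorem sat_uniformF_of_sat_pointwiseF [M.IsProbModel] [M.IsModel (UBAxioms omega)]
    [M.IsModel (UBAxioms event)] (hmeas : Sat e (measurableF φ P)) (hmono : Sat e (monotoneF φ))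
    (hanti : Sat e (antitoneF φ)) (h : Sat e (pointwiseF φ)) : Sat e (uniformF φ) := by
  rw [sat_pointwiseF] at h
  refine sat_uniformF.2 fun m x => ?_
  by_contra! hbad
  have hP (n k : M.D nat) (w : M.D omega) := sat_measurableF.1 hmeas x n k w
  obtain ⟨A, hA, hcover⟩ := exists_cover (m := m) (isMonoAnti_of_sat hmeas hmono hanti x)
    (by simpa only [hP] using hbad)
  obtain ⟨w, hwA, n, hw⟩ := h x A hA
  exact hwA (hcover w n fun k => (hP n k w).2 (hw k))

end Conditions

end Struct

end ProbLogic

open ProbLogic Ty Formula in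
theorem mainTheorem12_general {T : Theory} (hT : FPUB ≤ T) {Γ : Ctx} (Δ : List (Formula Γ))
    (φ : Formula (MatrixCtx Γ)) (P : Term Γ (nat ⇾ nat ⇾ nat ⇾ event))
    (hmeas : Deriv T Δ (measurableF φ P)) (hmono : Deriv T Δ (monotoneF φ))
    (hanti : Deriv T Δ (antitoneF φ)) : Deriv T Δ (pointwiseF φ ⟺ uniformF φ) := by
  have hF : FAxioms ≤ T := fun _ _ h => hT _ _ (.inl h)
  have := Theory.HasEquality.of_le hF
  refine Deriv.cut (measurableF φ P :: monotoneF φ :: antitoneF φ :: probAxioms Γ) ?_ ?_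
  · simp only [List.forall_mem_cons]
    exact ⟨hmeas, hmono, hanti, deriv_probAxioms hF Δ⟩
  · refine completeness _ _ fun M hM e he => ?_
    simp only [List.forall_mem_cons] at he
    obtain ⟨hmeas, hmono, hanti, hprob⟩ := he
    have : M.IsModel FAxioms := hM.mono hF
    have : M.IsModel (UBAxioms omega) := hM.mono fun _ _ h => hT _ _ (.inr (.inl h))
    have : M.IsModel (UBAxioms event) := hM.mono fun _ _ h => hT _ _ (.inr (.inr h))
    have : M.IsProbModel := .of_sat e hprob
    exact (Struct.sat_iff _ _ _).2 ⟨Struct.sat_uniformF_of_sat_pointwiseF hmeas hmono hanti,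
      Struct.sat_pointwiseF_of_sat_uniformF⟩

theorem mainTheorem12 {Γ : ProbLogic.Ctx} (Δ : List (ProbLogic.Formula Γ))
    (φ : ProbLogic.Formula (ProbLogic.MatrixCtx Γ)) (hφ : φ.QF)
    (P : ProbLogic.Term Γ (.fn .nat (.fn .nat (.fn .nat .event))))
    (hmeas : ProbLogic.Deriv ProbLogic.FPUB Δ (ProbLogic.measurableF φ P))
    (hmono : ProbLogic.Deriv ProbLogic.FPUB Δ (ProbLogic.monotoneF φ))
    (hanti : ProbLogic.Deriv ProbLogic.FPUB Δ (ProbLogic.antitoneF φ)) :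
    ProbLogic.Deriv ProbLogic.FPUB Δ
      (ProbLogic.Formula.iff (ProbLogic.pointwiseF φ) (ProbLogic.uniformF φ)) :=
  mainTheorem12_general le_rfl Δ φ P hmeas hmono hanti
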